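/- Equip $\mathbb R^{n,1}=\mathbb R^{n+1}$ with the Minkowski form $\langle x,x\rangle=-x_0^2+x_1^2+\dots+x_n^2$. A domain of dependence is a non-empty open set $D\subset\mathbb R^{n,1}$ which is the intersection of the futures of a family of lightlike affine hyperplanes and whose complement contains two non-parallel lightlike hyperplanes. Let $\tau(p)$, the cosmological time of $p\in D$, be the supremum of the lengths of the causal curves in $D$ ending at $p$, let $H_\epsilon=\tau^{-1}(\epsilon)$ with future unit normal $\nu_\epsilon$, and let the initial singularity of $D$ be the set of points $r\in\partial D$ such that $\tau(p)=\sqrt{-\langle p-r,p-r\rangle}$ for some $p\in D$ with $p-r$ future timelike. Let $v$ be a future-directed unit timelike vector and $P_v$ the hyperplane orthogonal to $v$ through the origin, with its Euclidean metric and volume $dV$. Then $\partial D$ is the graph $\{x+u(x)v\}$ of a convex function $u:P_v\to\mathbb R$, and $H_\epsilon$ is the graph of a function $u_\epsilon:P_v\to\mathbb R$. The intensity of the boundary of $D$ with respect to $v$ is the function on $P_v$ $$\iota_v(x)=\lim_{\epsilon\to 0^+}\bigl(-\epsilon\,\langle \nu_\epsilon(x+u_\epsilon(x)v),v\rangle\bigr).$$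 The boundary of $D$ is called flat if the distributional differential $d(*du)=\Delta u$, which is a locally finite positive measure on $P_v$, is concentrated on the set of those $x$ for which $x+u(x)v$ lies on the initial singularity. Theorem. Let $D\subset\mathbb R^{n,1}$ be a domain of dependence, and let $(D_k)_{k\in\mathbb N}$ be a sequence of domains of dependence with flat boundaries converging to $D$ in the Hausdorff sense on compact subsets. Let $\iota_v$ and $\iota_v^k$ be the intensities of $D$ and of $D_k$ with respect to a future-directed unit timelike vector $v$. Then the sequence $(\iota_v^k)_{k\in\mathbb N}$ converges weakly in $L^1_{loc}(P_v)$ to a limit $\iota_{lim}\in L^1_{loc}(P_v)$, that is, $\int_{P_v} f\,\iota_v^k\,dV\to\int_{P_v} f\,\iota_{lim}\,dV$ for every bounded measurable function $f$ with compact support, and $$\iota_{lim}\le\iota_v\le n\,\iota_{lim}\qquad\text{almost everywhere on }P_v.$$ -/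

import Mathlib

open Set Filter Topology MeasureTheory
open scoped ENNReal ContDiff

noncomputable section

namespace FlatSpacetime

/-- Minkowski space in dimension `n + 1`: a time coordinate and `n` space coordinates. -/
abbrev Minkowski (n : ℕ) : Type := ℝ × EuclideanSpace ℝ (Fin n)

/-- The Minkowski form `-dx₀² + dx₁² + … + dxₙ²`. -/
def lor {n : ℕ} (x y : Minkowski n) : ℝ := -(x.1 * y.1) + inner ℝ x.2 y.2

/-- Future-directed timelike vectors. -/
def IsFutureTimelike {n : ℕ} (w : Minkowski n) : Prop := lor w w < 0 ∧ 0 < w.1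

/-- Future-directed causal (timelike or lightlike) vectors. -/
def IsFutureCausal {n : ℕ} (w : Minkowski n) : Prop := lor w w ≤ 0 ∧ 0 < w.1

/-- Future-directed timelike unit vectors, i.e. points of the hyperboloid `H⁺`. -/
def IsUnitFutureTimelike {n : ℕ} (v : Minkowski n) : Prop := lor v v = -1 ∧ 0 < v.1

/-- Lightlike (nonzero null) vectors. -/
def IsLightlike {n : ℕ} (w : Minkowski n) : Prop := w ≠ 0 ∧ lor w w = 0

/-- The Lorentzian length of a causal vector. -/
def lorLength {n : ℕ} (w : Minkowski n) : ℝ := √(-lor w w)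

/-- The chronological future `I⁺(S)` of a set. -/
def chronFuture {n : ℕ} (S : Set (Minkowski n)) : Set (Minkowski n) :=
  {x | ∃ s ∈ S, IsFutureTimelike (x - s)}

/-- The affine hyperplane through `a` orthogonal to `ξ`; it is lightlike when `ξ` is. -/
def orthPlane {n : ℕ} (a ξ : Minkowski n) : Set (Minkowski n) := {x | lor (x - a) ξ = 0}

/-- Lightlike affine hyperplanes. -/
def IsLightlikePlane {n : ℕ} (P : Set (Minkowski n)) : Prop :=
  ∃ a ξ : Minkowski n, IsLightlike ξ ∧ P = orthPlane a ξ

/-- Domains of dependence: nonempty open sets that are the intersection of the futures of a family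
of lightlike hyperplanes (hence convex), and whose complement contains at least two non-parallel
lightlike hyperplanes. -/
structure IsDomainOfDependence {n : ℕ} (D : Set (Minkowski n)) : Prop where
  isOpen : IsOpen D
  nonempty : D.Nonempty
  eq_inter : ∃ F : Set (Set (Minkowski n)),
    (∀ P ∈ F, IsLightlikePlane P) ∧ D = ⋂ P ∈ F, chronFuture P
  two_planes : ∃ a b ξ ζ : Minkowski n, IsLightlike ξ ∧ IsLightlike ζ ∧ (∀ c : ℝ, ζ ≠ c • ξ) ∧
    orthPlane a ξ ⊆ Dᶜ ∧ orthPlane b ζ ⊆ Dᶜ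

/-- Hausdorff convergence on compact subsets of Minkowski space. -/
def ConvergesTo {n : ℕ} (Ds : ℕ → Set (Minkowski n)) (D : Set (Minkowski n)) : Prop :=
  ∀ K : Set (Minkowski n), IsCompact K → ∀ ε : ℝ, 0 < ε → ∀ᶠ k in atTop,
    Ds k ∩ K ⊆ Metric.thickening ε D ∧ D ∩ K ⊆ Metric.thickening ε (Ds k)

/-! ### Cosmological time and the initial singularity -/

/-- Future-directed causal (Lipschitz) curves `[0, 1] → D` ending at `p`. -/
structure IsCausalCurve {n : ℕ} (D : Set (Minkowski n)) (p : Minkowski n)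
    (c : ℝ → Minkowski n) : Prop where
  lipschitz : ∃ K, LipschitzOnWith K c (Icc 0 1)
  mem : ∀ t ∈ Icc (0 : ℝ) 1, c t ∈ D
  causal : ∀ᵐ t ∂(volume.restrict (Icc (0 : ℝ) 1)), IsFutureCausal (deriv c t)
  endpoint : c 1 = p

/-- The Lorentzian length of a curve `[0, 1] → ℝ^{n,1}`. -/
def curveLength {n : ℕ} (c : ℝ → Minkowski n) : ℝ :=
  ∫ t in (0 : ℝ)..1, lorLength (deriv c t)

/-- The cosmological time with values in `[0, ∞]`: the supremum of the lengths of the causal curves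
in `D` that end at `p`. -/
def cosmologicalTime {n : ℕ} (D : Set (Minkowski n)) (p : Minkowski n) : ℝ≥0∞ :=
  ⨆ (c : ℝ → Minkowski n) (_ : IsCausalCurve D p c), ENNReal.ofReal (curveLength c)

/-- The cosmological time as a real function (it is finite on a domain of dependence). -/
def cosmTime {n : ℕ} (D : Set (Minkowski n)) (p : Minkowski n) : ℝ :=
  (cosmologicalTime D p).toReal

/-- The initial singularity: the set of all `r = 𝐫(p)`, `p ∈ D`, where `𝐫(p)` is the point of
`∂D ∩ I⁻(p)` with `τ(p) = |p - r|`. -/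
def singularity {n : ℕ} (D : Set (Minkowski n)) : Set (Minkowski n) :=
  {r | r ∈ frontier D ∧ ∃ p ∈ D, IsFutureTimelike (p - r) ∧ cosmTime D p = lorLength (p - r)}

/-- The level surface `H_ε` of the cosmological time. -/
def levelSurface {n : ℕ} (D : Set (Minkowski n)) (ε : ℝ) : Set (Minkowski n) :=
  {q | q ∈ D ∧ cosmTime D q = ε}

/-- The gradient with respect to the Minkowski form: `⟨grad f, w⟩ = df(w)`. -/
def lorGradient {n : ℕ} (f : Minkowski n → ℝ) (q : Minkowski n) : Minkowski n :=
  (-(fderiv ℝ f q (1, 0)),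
    (InnerProductSpace.toDual ℝ (EuclideanSpace ℝ (Fin n))).symm
      ((fderiv ℝ f q).comp (ContinuousLinearMap.inr ℝ ℝ (EuclideanSpace ℝ (Fin n)))))

/-- The defining property of the Minkowski gradient. -/
theorem lor_lorGradient {n : ℕ} (f : Minkowski n → ℝ) (q w : Minkowski n) :
    lor (lorGradient f q) w = fderiv ℝ f q w := by
  have h : w = w.1 • ((1, 0) : Minkowski n) + (0, w.2) := by ext <;> simp
  conv_rhs => rw [h, map_add, map_smul]
  simp [lor, lorGradient, mul_comm]

/-- The future-directed unit normal at `q` of the level surface of the cosmological time through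
`q`. -/
def unitNormal {n : ℕ} (D : Set (Minkowski n)) (q : Minkowski n) : Minkowski n :=
  -((lorLength (lorGradient (cosmTime D) q))⁻¹ • lorGradient (cosmTime D) q)

/-! ### Graphs over the spacelike hyperplane `P_v` orthogonal to `v` -/

/-- `φ` is a linear isometry from Euclidean `n`-space onto the hyperplane `P_v` orthogonal to the
timelike vector `v` (surjectivity follows by dimension). -/
def IsOrthIsometry {n : ℕ} (v : Minkowski n)
    (φ : EuclideanSpace ℝ (Fin n) →ₗ[ℝ] Minkowski n) : Prop :=
  (∀ x y, lor (φ x) (φ y) = inner ℝ x y) ∧ ∀ x, lor (φ x) v = 0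

/-- The function `u` on `P_v` whose graph `{x + u(x) v}` is the boundary of `D`. -/
def boundaryFun {n : ℕ} (D : Set (Minkowski n)) (v : Minkowski n)
    (φ : EuclideanSpace ℝ (Fin n) →ₗ[ℝ] Minkowski n) (x : EuclideanSpace ℝ (Fin n)) : ℝ :=
  sInf {s : ℝ | φ x + s • v ∈ D}

/-- The function `u_ε` on `P_v` whose graph is the level surface `H_ε`: the set below consists of
exactly one number if `D` is a domain of dependence and `ε > 0`. -/
def levelFun {n : ℕ} (D : Set (Minkowski n)) (v : Minkowski n)
    (φ : EuclideanSpace ℝ (Fin n) →ₗ[ℝ] Minkowski n) (ε : ℝ) (x : EuclideanSpace ℝ (Fin n)) : ℝ :=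
  sInf {s : ℝ | φ x + s • v ∈ levelSurface D ε}

/-- The rescaled intensity `ι_ε = -ε ⟨ν_ε, v⟩` of the surface `H_ε`, as a function on `P_v`. -/
def levelIntensity {n : ℕ} (D : Set (Minkowski n)) (v : Minkowski n)
    (φ : EuclideanSpace ℝ (Fin n) →ₗ[ℝ] Minkowski n) (ε : ℝ) (x : EuclideanSpace ℝ (Fin n)) : ℝ :=
  -ε * lor (unitNormal D (φ x + levelFun D v φ ε x • v)) v

/-- The intensity `ι_v = lim_{ε → 0} ι_ε` of the boundary of `D`, as a function on `P_v`. -/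
def intensity {n : ℕ} (D : Set (Minkowski n)) (v : Minkowski n)
    (φ : EuclideanSpace ℝ (Fin n) →ₗ[ℝ] Minkowski n) (x : EuclideanSpace ℝ (Fin n)) : ℝ :=
  limUnder (𝓝[>] (0 : ℝ)) (fun ε => levelIntensity D v φ ε x)

/-- The boundary of `D`, seen as the graph of `u` over `P_v`, is flat: the distributional
differential `dω = Δu` of the form `ω = *du` is a locally finite measure that is concentrated on
the initial singularity. (Recall `df ∧ *du = ⟨grad f, grad u⟩ dV`.) -/
def HasFlatBoundary {n : ℕ} (D : Set (Minkowski n)) (v : Minkowski n)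
    (φ : EuclideanSpace ℝ (Fin n) →ₗ[ℝ] Minkowski n) : Prop :=
  ∃ μ : Measure (EuclideanSpace ℝ (Fin n)), IsLocallyFiniteMeasure μ ∧
    (∀ f : EuclideanSpace ℝ (Fin n) → ℝ, ContDiff ℝ ∞ f → HasCompactSupport f →
      ∫ x, f x ∂μ = -∫ x, inner ℝ (gradient f x) (gradient (boundaryFun D v φ) x)) ∧
    μ {x | φ x + boundaryFun D v φ x • v ∉ singularity D} = 0

/-- Weak convergence in `L¹_loc`: all functions are locally integrable, and the integrals against
every bounded measurable function with compact support converge. -/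
def WeaklyConvergesL1loc {n : ℕ} (g : ℕ → EuclideanSpace ℝ (Fin n) → ℝ)
    (G : EuclideanSpace ℝ (Fin n) → ℝ) : Prop :=
  (∀ k, LocallyIntegrable (g k) volume) ∧ LocallyIntegrable G volume ∧
    ∀ f : EuclideanSpace ℝ (Fin n) → ℝ, Measurable f → HasCompactSupport f →
      (∃ C : ℝ, ∀ x, |f x| ≤ C) →
      Tendsto (fun k => ∫ x, f x * g k x) atTop (𝓝 (∫ x, f x * G x))

end FlatSpacetime

end

/-!
Let `n` be the dimension of `P_v`. In the coordinates `(x, s) ↦ x + s v` a domain of dependence is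
the strict epigraph of a convex function `u` on `P_v` which is a supremum of affine functions with
unit gradients (`domain_eq_epigraph`, `IsNullConvex`); in particular `|∇u| = 1` almost everywhere.

*The intensity.* The level surface `H_ε` of the cosmological time is the graph of the Lorentzian
inf-convolution `level u ε x = min_y (u y + √(ε² + |x - y|²))`. Near a point of `H_ε` the
cosmological time is squeezed between the Lorentzian distance to the foot point and an affine
function, so it is differentiable there and `ε` times the vertical component of the unit normal is
`rho u ε x = √(ε² + |x - y|²)`, for the minimizer `y` (`hasFDerivAt_cosmTime`,
`levelIntensity_eq`). As `ε → 0` this decreases to the length `rayLength u x` of the longest past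
light ray in `∂D` that starts above `x` (`intensity_eq_rayLength`), which vanishes on the initial
singularity (`rayLength_eq_zero_of_mem_singularity`).

*The limit.* Let `flowMeasure u` be the image of `dx dt` under the gradient flow
`(x, t) ↦ x + t ∇u(x)`, `t > 0`. Its lines are light rays of `∂D`, traversed with unit speed, and
it is expanding by convexity, so `flowMeasure u ≤ rayLength u dx` (`flowMeasure_le_rayMeasure`).
Conversely, let `p = slope u ε` be the gradient of `level u ε`. The monotonicity of the
subdifferential of `u` at the foot points gives almost everywhere
`div (rho p) = ⟨∇rho, p⟩ + rho Δ(level u ε) ≤ n` and `⟨∇rho, p⟩ ≤ 1` (`key_inequality`,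
`rho_mul_trace_le`, `inner_fderiv_slope_le`). Testing the divergence theorem for `rho p` with
functions transported by the flow of `p`, and letting `ε → 0`, one gets
`rayLength u dx ≤ n flowMeasure u` (`rayMeasure_le_finrank_smul`). If the boundary is flat, then
`rho Δ(level u ε)` tends weakly to zero, as `Δu` lives where `rayLength u` vanishes; only the term
`⟨∇rho, p⟩ ≤ 1` survives, and `rayLength u dx = flowMeasure u` (`flowMeasure_eq_rayMeasure`).

*Convergence.* Hausdorff convergence of the domains is pointwise convergence of the functions `u`,
hence almost everywhere convergence of their gradients, hence vague convergence of the flow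
measures (`tendsto_integral_flowMeasure`). So the weak limit of the intensities of the flat
boundaries is the density of `flowMeasure u`, and the two bounds above are the claim. Since the
intensities are locally uniformly bounded (`eventually_rayLength_le`), the convergence extends from
continuous to bounded measurable test functions.
-/

open Set Filter Topology MeasureTheory
open scoped ENNReal ContDiff

noncomputable section

namespace FlatSpacetime

/-! ### Lorentzian inf-convolution -/

section Prox

variable {E : Type*} [NormedAddCommGroup E]

/-- The function `√(ε² + |w|²)`, whose graph is a hyperboloid. -/
def hyp (ε : ℝ) (w : E) : ℝ := √(ε ^ 2 + ‖w‖ ^ 2)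

lemma hyp_sq (ε : ℝ) (w : E) : hyp ε w ^ 2 = ε ^ 2 + ‖w‖ ^ 2 :=
  Real.sq_sqrt (by positivity)

lemma hyp_nonneg (ε : ℝ) (w : E) : 0 ≤ hyp ε w := Real.sqrt_nonneg _

lemma le_hyp {ε : ℝ} (w : E) : ε ≤ hyp ε w :=
  Real.le_sqrt_of_sq_le (by nlinarith [sq_nonneg ‖w‖])

lemma norm_le_hyp (ε : ℝ) (w : E) : ‖w‖ ≤ hyp ε w :=
  Real.le_sqrt_of_sq_le (by nlinarith [sq_nonneg ε])

lemma hyp_pos {ε : ℝ} (hε : 0 < ε) (w : E) : 0 < hyp ε w := hε.trans_le (le_hyp w)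

lemma norm_lt_hyp {ε : ℝ} (hε : 0 < ε) (w : E) : ‖w‖ < hyp ε w := by
  refine lt_of_pow_lt_pow_left₀ 2 (hyp_nonneg _ _) ?_
  rw [hyp_sq]; nlinarith

lemma hyp_le {ε : ℝ} (hε : 0 ≤ ε) (w : E) : hyp ε w ≤ ε + ‖w‖ :=
  (Real.sqrt_le_left (by positivity)).2 (by nlinarith [mul_nonneg hε (norm_nonneg w)])

lemma hyp_zero {ε : ℝ} (hε : 0 ≤ ε) : hyp ε (0 : E) = ε := by simp [hyp, Real.sqrt_sq hε]

lemma continuous_hyp (ε : ℝ) : Continuous (hyp ε : E → ℝ) := by unfold hyp; fun_prop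

variable [InnerProductSpace ℝ E]

/-- The hyperboloid lies below the paraboloid that touches it at `w`. -/
lemma hyp_add_le {ε : ℝ} (hε : 0 < ε) (w h : E) :
    hyp ε (w + h) ≤ hyp ε w + (hyp ε w)⁻¹ * inner ℝ w h + (2 * hyp ε w)⁻¹ * ‖h‖ ^ 2 := by
  have h0 := hyp_pos hε w
  have h1 := hyp_sq ε w
  have h2 := hyp_sq ε (w + h)
  rw [norm_add_sq_real] at h2
  have h3 := sq_nonneg (hyp ε (w + h) - hyp ε w)
  have : hyp ε w + (hyp ε w)⁻¹ * inner ℝ w h + (2 * hyp ε w)⁻¹ * ‖h‖ ^ 2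
      = (2 * hyp ε w ^ 2 + 2 * inner ℝ w h + ‖h‖ ^ 2) / (2 * hyp ε w) := by
    field_simp
  rw [this, le_div_iff₀ (by positivity)]
  nlinarith

/-- The hyperboloid is convex. -/
lemma le_hyp_add {ε : ℝ} (hε : 0 < ε) (w h : E) :
    hyp ε w + (hyp ε w)⁻¹ * inner ℝ w h ≤ hyp ε (w + h) := by
  have h0 := hyp_pos hε w
  have h0' := hyp_pos hε (w + h)
  have h1 := hyp_sq ε w
  have h2 := hyp_sq ε (w + h)
  have h3 : inner ℝ w (w + h) ≤ ‖w‖ * ‖w + h‖ := real_inner_le_norm _ _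
  have h3' : inner ℝ w (w + h) = ‖w‖ ^ 2 + inner ℝ w h := by
    rw [inner_add_right, real_inner_self_eq_norm_sq]
  have h4 : ε ^ 2 + ‖w‖ * ‖w + h‖ ≤ hyp ε w * hyp ε (w + h) := by
    apply le_of_sq_le_sq _ (by positivity)
    rw [mul_pow, h1, h2]
    nlinarith [sq_nonneg (ε * (‖w‖ - ‖w + h‖))]
  have : hyp ε w + (hyp ε w)⁻¹ * inner ℝ w h = (hyp ε w ^ 2 + inner ℝ w h) / hyp ε w := by
    field_simp
  rw [this, div_le_iff₀ h0]
  nlinarith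

/-- Convex functions that are suprema of affine functions with unit gradients: at every point there
is a subgradient of norm one. The coercivity condition expresses that two of these affine functions
have different gradients. These are the functions whose strict epigraphs are the domains of
dependence. -/
structure IsNullConvex (u : E → ℝ) : Prop where
  exists_subgradient : ∀ x, ∃ e : E, ‖e‖ = 1 ∧ ∀ y, u x + inner ℝ e (y - x) ≤ u y
  coercive : ∃ κ > (0 : ℝ), ∃ C : ℝ, ∀ y, κ * ‖y‖ - C ≤ u y + ‖y‖

namespace IsNullConvex

variable {u : E → ℝ}

lemma sub_le (hu : IsNullConvex u) (x y : E) : u x - u y ≤ ‖x - y‖ := by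
  obtain ⟨e, he, h⟩ := hu.exists_subgradient x
  have h1 := h y
  have h2 := abs_real_inner_le_norm e (y - x)
  rw [he, one_mul, norm_sub_rev] at h2
  linarith [neg_abs_le (inner ℝ e (y - x) : ℝ)]

lemma lipschitzWith (hu : IsNullConvex u) : LipschitzWith 1 u := by
  refine LipschitzWith.of_dist_le_mul fun x y => ?_
  rw [NNReal.coe_one, one_mul, dist_eq_norm, dist_eq_norm, Real.norm_eq_abs, abs_le]
  have := hu.sub_le x y
  have := hu.sub_le y x
  rw [norm_sub_rev] at this
  constructor <;> linarith

lemma continuous (hu : IsNullConvex u) : Continuous u := hu.lipschitzWith.continuous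

lemma convex (hu : IsNullConvex u) (y h : E) {θ : ℝ} (h0 : 0 ≤ θ) (h1 : θ ≤ 1) :
    u (y + θ • h) ≤ u y + θ * (u (y + h) - u y) := by
  obtain ⟨e, -, he⟩ := hu.exists_subgradient (y + θ • h)
  have a := he y
  have b := he (y + h)
  have e1 : y - (y + θ • h) = (-θ) • h := by module
  have e2 : y + h - (y + θ • h) = (1 - θ) • h := by module
  rw [e1, inner_smul_right] at a
  rw [e2, inner_smul_right] at b
  nlinarith [mul_le_mul_of_nonneg_left a (sub_nonneg.2 h1), mul_le_mul_of_nonneg_left b h0]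

end IsNullConvex

/-- A minimizer of `y ↦ u y + √(ε² + |x - y|²)`: the foot point on the graph of `u` of the point
of the level surface above `x`. It exists by coercivity, see `IsNullConvex.prox_spec`. -/
def prox (u : E → ℝ) (ε : ℝ) (x : E) : E :=
  Classical.epsilon fun y => ∀ z, u y + hyp ε (x - y) ≤ u z + hyp ε (x - z)

/-- The Lorentzian inf-convolution `inf_y (u y + √(ε² + |x - y|²))`; its graph is the level set `ε`
of the cosmological time. -/
def level (u : E → ℝ) (ε : ℝ) (x : E) : ℝ := u (prox u ε x) + hyp ε (x - prox u ε x)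

/-- The intensity `ε / √(1 - |slope|²)` of the level surface, in terms of the foot point. -/
def rho (u : E → ℝ) (ε : ℝ) (x : E) : ℝ := hyp ε (x - prox u ε x)

/-- The gradient of `level u ε`. -/
def slope (u : E → ℝ) (ε : ℝ) (x : E) : E := (rho u ε x)⁻¹ • (x - prox u ε x)

omit [InnerProductSpace ℝ E] in
lemma rho_pos (u : E → ℝ) {ε : ℝ} (hε : 0 < ε) (x : E) : 0 < rho u ε x := hyp_pos hε _

omit [InnerProductSpace ℝ E] in
lemma le_rho (u : E → ℝ) (ε : ℝ) (x : E) : ε ≤ rho u ε x := le_hyp _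

lemma rho_smul_slope (u : E → ℝ) {ε : ℝ} (hε : 0 < ε) (x : E) :
    rho u ε x • slope u ε x = x - prox u ε x := by
  rw [slope, smul_inv_smul₀ (rho_pos u hε x).ne']

lemma inner_slope (u : E → ℝ) (ε : ℝ) (x h : E) :
    inner ℝ (slope u ε x) h = (rho u ε x)⁻¹ * inner ℝ (x - prox u ε x) h := by
  rw [slope, real_inner_smul_left]

lemma one_sub_norm_slope_sq (u : E → ℝ) {ε : ℝ} (hε : 0 < ε) (x : E) :
    rho u ε x ^ 2 * (1 - ‖slope u ε x‖ ^ 2) = ε ^ 2 := by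
  have h := hyp_sq ε (x - prox u ε x)
  have h0 := rho_pos u hε x
  rw [← rho_smul_slope u hε, norm_smul, Real.norm_of_nonneg h0.le, rho_smul_slope u hε] at h
  change rho u ε x ^ 2 = _ at h
  linarith

lemma norm_slope_lt_one (u : E → ℝ) {ε : ℝ} (hε : 0 < ε) (x : E) : ‖slope u ε x‖ < 1 := by
  have h := one_sub_norm_slope_sq u hε x
  have h0 := rho_pos u hε x
  by_contra! hc
  have : rho u ε x ^ 2 * (1 - ‖slope u ε x‖ ^ 2) ≤ 0 :=
    mul_nonpos_of_nonneg_of_nonpos (by positivity) (by nlinarith)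
  nlinarith [sq_pos_of_pos hε]

namespace IsNullConvex

variable {u : E → ℝ}

lemma le_level_self (hu : IsNullConvex u) (ε : ℝ) (x : E) : u x ≤ level u ε x := by
  have := hu.sub_le x (prox u ε x)
  have := norm_le_hyp ε (x - prox u ε x)
  unfold level; linarith

lemma lt_level_self (hu : IsNullConvex u) {ε : ℝ} (hε : 0 < ε) (x : E) : u x < level u ε x := by
  have := hu.sub_le x (prox u ε x)
  have := norm_lt_hyp hε (x - prox u ε x)
  unfold level; linarith

section Minimizer

variable [FiniteDimensional ℝ E]

lemma exists_minimizer (hu : IsNullConvex u) (ε : ℝ) (x : E) :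
    ∃ y, ∀ z, u y + hyp ε (x - y) ≤ u z + hyp ε (x - z) := by
  obtain ⟨κ, hκ, C, hC⟩ := hu.coercive
  refine Continuous.exists_forall_le (f := fun y => u y + hyp ε (x - y))
    (hu.continuous.add ((continuous_hyp ε).comp (continuous_const.sub continuous_id))) ?_
  have h1 : Tendsto (fun y : E => κ * ‖y‖ - (C + ‖x‖)) (cocompact E) atTop :=
    tendsto_atTop_add_const_right _ _ ((tendsto_norm_cocompact_atTop (E := E)).const_mul_atTop hκ)
  refine tendsto_atTop_mono (fun y => ?_) h1
  have := norm_le_hyp ε (x - y)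
  have := norm_sub_norm_le y x
  rw [norm_sub_rev] at this
  linarith [hC y]

lemma prox_spec (hu : IsNullConvex u) (ε : ℝ) (x z : E) :
    u (prox u ε x) + hyp ε (x - prox u ε x) ≤ u z + hyp ε (x - z) :=
  Classical.epsilon_spec (hu.exists_minimizer ε x) z

lemma level_le (hu : IsNullConvex u) (ε : ℝ) (x z : E) : level u ε x ≤ u z + hyp ε (x - z) :=
  hu.prox_spec ε x z

/-- The slope of the level surface at `x` is a subgradient of `u` at the foot point. -/
lemma subgradient_prox (hu : IsNullConvex u) {ε : ℝ} (hε : 0 < ε) (x z : E) :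
    u (prox u ε x) + inner ℝ (slope u ε x) (z - prox u ε x) ≤ u z := by
  set y := prox u ε x with hy
  set h := z - y with hh
  have key : ∀ θ ∈ Ioc (0 : ℝ) 1,
      u y + inner ℝ (slope u ε x) h - θ * ((2 * rho u ε x)⁻¹ * ‖h‖ ^ 2) ≤ u z := by
    rintro θ ⟨h0, h1⟩
    have a := hu.prox_spec ε x (y + θ • h)
    have b := hu.convex y h h0.le h1
    have c := hyp_add_le hε (x - y) (-(θ • h))
    rw [inner_neg_right, inner_smul_right, norm_neg, norm_smul, Real.norm_of_nonneg h0.le] at c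
    have e : x - (y + θ • h) = x - y + -(θ • h) := by abel
    rw [e, ← hy] at a
    have e2 : y + h = z := by rw [hh]; abel
    rw [e2] at b
    rw [inner_slope, ← hy, rho, ← hy]
    have : θ * (u y + (hyp ε (x - y))⁻¹ * inner ℝ (x - y) h
        - θ * ((2 * hyp ε (x - y))⁻¹ * ‖h‖ ^ 2)) ≤ θ * u z := by linarith
    exact le_of_mul_le_mul_left this h0
  have lim : Tendsto (fun θ : ℝ => u y + inner ℝ (slope u ε x) h
      - θ * ((2 * rho u ε x)⁻¹ * ‖h‖ ^ 2)) (𝓝[>] 0)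
      (𝓝 (u y + inner ℝ (slope u ε x) h - 0 * ((2 * rho u ε x)⁻¹ * ‖h‖ ^ 2))) :=
    ((continuous_const.sub (continuous_id.mul continuous_const)).tendsto _).mono_left
      nhdsWithin_le_nhds
  rw [zero_mul, sub_zero] at lim
  exact le_of_tendsto lim (by
    filter_upwards [Ioc_mem_nhdsGT zero_lt_one] with θ hθ using key θ hθ)

/-- The level function is convex, with subgradient `slope u ε x` at `x`. -/
lemma le_level (hu : IsNullConvex u) {ε : ℝ} (hε : 0 < ε) (x x' : E) :
    level u ε x + inner ℝ (slope u ε x) (x' - x) ≤ level u ε x' := by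
  have a := hu.subgradient_prox hε x (prox u ε x')
  have b := le_hyp_add hε (x - prox u ε x) (x' - prox u ε x' - (x - prox u ε x))
  rw [add_sub_cancel] at b
  change _ + (rho u ε x)⁻¹ * _ ≤ _ at b
  rw [← inner_slope] at b
  have e : x' - x = (prox u ε x' - prox u ε x)
    + (x' - prox u ε x' - (x - prox u ε x)) := by abel
  rw [e, inner_add_right]
  unfold level
  linarith

/-- The level function lies below a paraboloid touching it at `x`. -/
lemma level_le_quadratic (hu : IsNullConvex u) {ε : ℝ} (hε : 0 < ε) (x x' : E) :
    level u ε x' ≤ level u ε x + inner ℝ (slope u ε x) (x' - x)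
      + (2 * rho u ε x)⁻¹ * ‖x' - x‖ ^ 2 := by
  have a := hu.level_le ε x' (prox u ε x)
  have b := hyp_add_le hε (x - prox u ε x) (x' - x)
  have e : x - prox u ε x + (x' - x) = x' - prox u ε x := by abel
  rw [e] at b
  rw [inner_slope]
  unfold level at a ⊢
  unfold rho
  linarith

lemma level_le_add (hu : IsNullConvex u) {ε : ℝ} (hε : 0 ≤ ε) (x : E) :
    level u ε x ≤ u x + ε := by
  simpa [hyp_zero hε] using hu.level_le ε x x

/-- Cocoercivity of the slope, the gradient of a convex function that lies below paraboloids of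
opening `1 / ε`. -/
lemma slope_cocoercive (hu : IsNullConvex u) {ε : ℝ} (hε : 0 < ε) (x x' : E) :
    ε * ‖slope u ε x - slope u ε x'‖ ^ 2 ≤ inner ℝ (slope u ε x - slope u ε x') (x - x') := by
  have key : ∀ a b : E, level u ε b + inner ℝ (slope u ε b) (a - b)
      + ε / 2 * ‖slope u ε a - slope u ε b‖ ^ 2 ≤ level u ε a := by
    intro a b
    set d := slope u ε a - slope u ε b with hd
    have h1 := hu.le_level hε b (a - ε • d)
    have h2 := hu.level_le_quadratic hε a (a - ε • d)
    have e1 : a - ε • d - a = -(ε • d) := by abel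
    have e2 : a - ε • d - b = (a - b) + -(ε • d) := by abel
    rw [e1, inner_neg_right, inner_smul_right, norm_neg, norm_smul, Real.norm_of_nonneg hε.le] at h2
    rw [e2, inner_add_right, inner_neg_right, inner_smul_right] at h1
    have h3 : inner ℝ (slope u ε a) d - inner ℝ (slope u ε b) d = ‖d‖ ^ 2 := by
      rw [← inner_sub_left, ← hd, real_inner_self_eq_norm_sq]
    have h4 : (2 * rho u ε a)⁻¹ * (ε * ‖d‖) ^ 2 ≤ (2 * ε)⁻¹ * (ε * ‖d‖) ^ 2 := by
      have := le_rho u ε a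
      gcongr
    have h5 : (2 * ε)⁻¹ * (ε * ‖d‖) ^ 2 = ε / 2 * ‖d‖ ^ 2 := by field_simp
    have h3' : ε * inner ℝ (slope u ε a) d - ε * inner ℝ (slope u ε b) d = ε * ‖d‖ ^ 2 := by
      rw [← mul_sub, h3]
    linarith
  have h1 := key x x'
  have h2 := key x' x
  rw [norm_sub_rev] at h2
  rw [← neg_sub x x', inner_neg_right] at h2
  rw [inner_sub_left]
  linarith

lemma norm_slope_sub_le (hu : IsNullConvex u) {ε : ℝ} (hε : 0 < ε) (x x' : E) :
    ‖slope u ε x - slope u ε x'‖ ≤ ε⁻¹ * ‖x - x'‖ := by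
  have h := hu.slope_cocoercive hε x x'
  have h1 := real_inner_le_norm (slope u ε x - slope u ε x') (x - x')
  rcases (norm_nonneg (slope u ε x - slope u ε x')).eq_or_lt' with h0 | h0
  · rw [h0]; positivity
  rw [← div_eq_inv_mul, le_div_iff₀ hε]
  refine le_of_mul_le_mul_left ?_ h0
  linarith

lemma lipschitzWith_slope (hu : IsNullConvex u) {ε : ℝ} (hε : 0 < ε) :
    LipschitzWith (Real.toNNReal ε⁻¹) (slope u ε) :=
  LipschitzWith.of_dist_le_mul fun x y => by
    rw [dist_eq_norm, dist_eq_norm, Real.coe_toNNReal _ (by positivity)]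
    exact hu.norm_slope_sub_le hε x y

lemma continuous_slope (hu : IsNullConvex u) {ε : ℝ} (hε : 0 < ε) : Continuous (slope u ε) :=
  (hu.lipschitzWith_slope hε).continuous

/-- Monotonicity of the subdifferential of `u`, at the foot points. -/
lemma inner_slope_sub_prox_nonneg (hu : IsNullConvex u) {ε : ℝ} (hε : 0 < ε) (x x' : E) :
    0 ≤ inner ℝ (slope u ε x' - slope u ε x) (prox u ε x' - prox u ε x) := by
  have h1 := hu.subgradient_prox hε x (prox u ε x')
  have h2 := hu.subgradient_prox hε x' (prox u ε x)
  rw [← neg_sub (prox u ε x') (prox u ε x), inner_neg_right] at h2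
  rw [inner_sub_left]
  linarith

end Minimizer

end IsNullConvex

lemma rho_eq (u : E → ℝ) {ε : ℝ} (hε : 0 < ε) (x : E) :
    rho u ε x = ε / √(1 - ‖slope u ε x‖ ^ 2) := by
  have h := one_sub_norm_slope_sq u hε x
  have h0 := rho_pos u hε x
  have h1 := norm_slope_lt_one u hε x
  have h2 : 0 < 1 - ‖slope u ε x‖ ^ 2 := by nlinarith [norm_nonneg (slope u ε x)]
  rw [eq_div_iff (Real.sqrt_pos.2 h2).ne']
  refine (sq_eq_sq₀ (by positivity) hε.le).1 ?_
  rw [mul_pow, Real.sq_sqrt h2.le, h]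

namespace IsNullConvex

variable {u : E → ℝ} [FiniteDimensional ℝ E]

lemma continuous_rho (hu : IsNullConvex u) {ε : ℝ} (hε : 0 < ε) : Continuous (rho u ε) := by
  have : rho u ε = fun x => ε / √(1 - ‖slope u ε x‖ ^ 2) := funext (rho_eq u hε)
  rw [this]
  have := hu.continuous_slope hε
  refine continuous_const.div (by fun_prop) fun x => ?_
  have h1 := norm_slope_lt_one u hε x
  exact (Real.sqrt_pos.2 (by nlinarith [norm_nonneg (slope u ε x)])).ne'

end IsNullConvex

end Prox

/-! ### Light rays in the graph and the limit of the intensities -/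

section Intensity

variable {E : Type*} [NormedAddCommGroup E] [InnerProductSpace ℝ E]

/-- The set of lengths of the segments that start at `x`, end at some `y`, and along which the graph
of `u` descends with slope one, that is, along which the graph contains a past light ray. -/
def rayLengths (u : E → ℝ) (x : E) : Set ℝ := {r | ∃ y, ‖x - y‖ = r ∧ u y + r ≤ u x}

/-- The length of the longest past light ray in the graph of `u` that starts above `x`. -/
def rayLength (u : E → ℝ) (x : E) : ℝ := sSup (rayLengths u x)

/-- If the functions `U i` converge pointwise to `u`, then subgradients of `U i` at a point where
`u` is differentiable converge to the gradient of `u`. -/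
lemma tendsto_subgradient [FiniteDimensional ℝ E] {ι : Type*} {l : Filter ι} {U : ι → E → ℝ}
    {p : ι → E} {u : E → ℝ} {x g : E} (hg : HasGradientAt u g x)
    (hU : ∀ z, Tendsto (fun i => U i z) l (𝓝 (u z)))
    (hp : ∀ᶠ i in l, ∀ z, U i x + inner ℝ (p i) (z - x) ≤ U i z) : Tendsto p l (𝓝 g) := by
  have upper : ∀ h : E, ∀ c, inner ℝ g h < c → ∀ᶠ i in l, inner ℝ (p i) h < c := by
    intro h c hc
    have hd : HasDerivAt (fun t : ℝ => u (x + t • h)) (inner ℝ g h) 0 := by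
      have h1 : HasDerivAt (fun t : ℝ => x + t • h) h 0 := by
        simpa using ((hasDerivAt_id (0 : ℝ)).smul_const h).const_add x
      have h2 : HasFDerivAt u ((InnerProductSpace.toDual ℝ E) g) (x + (0 : ℝ) • h) := by
        rw [zero_smul, add_zero]; exact hg.hasFDerivAt
      simpa [Function.comp_def] using h2.comp_hasDerivAt (0 : ℝ) h1
    have h3 := hd.tendsto_slope_zero_right
    obtain ⟨s, hs, hs0⟩ := ((h3.eventually_lt_const hc).and self_mem_nhdsWithin).exists
    have hs0 : 0 < s := hs0
    simp only [zero_add, zero_smul, add_zero, smul_eq_mul] at hs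
    have h4 : Tendsto (fun i => s⁻¹ * (U i (x + s • h) - U i x)) l
        (𝓝 (s⁻¹ * (u (x + s • h) - u x))) := ((hU _).sub (hU _)).const_mul _
    filter_upwards [h4.eventually_lt_const hs, hp] with i hi hpi
    refine lt_of_le_of_lt ?_ hi
    have := hpi (x + s • h)
    rw [add_sub_cancel_left, inner_smul_right] at this
    rw [← div_eq_inv_mul, le_div_iff₀ hs0]
    linarith
  have key : ∀ h : E, Tendsto (fun i => inner ℝ h (p i)) l (𝓝 (inner ℝ h g)) := by
    intro h
    rw [tendsto_order]
    constructor
    · intro a ha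
      have := upper (-h) (-a) (by rw [inner_neg_right, real_inner_comm]; linarith)
      filter_upwards [this] with i hi
      rw [inner_neg_right, real_inner_comm] at hi
      linarith
    · intro a ha
      filter_upwards [upper h a (by rwa [real_inner_comm])] with i hi
      rwa [real_inner_comm]
  let b := stdOrthonormalBasis ℝ E
  have h1 : Tendsto (fun i => ∑ j, (inner ℝ (b j) (p i) : ℝ) • b j) l
      (𝓝 (∑ j, (inner ℝ (b j) g : ℝ) • b j)) :=
    tendsto_finsetSum _ fun j _ => (key (b j)).smul_const _
  simpa only [b.sum_repr'] using h1

/-- At a point of differentiability the gradient is the only subgradient. -/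
lemma subgradient_eq_gradient [FiniteDimensional ℝ E] {u : E → ℝ} {x g e : E}
    (hg : HasGradientAt u g x) (he : ∀ z, u x + inner ℝ e (z - x) ≤ u z) : e = g :=
  tendsto_nhds_unique (tendsto_const_nhds (f := (atTop : Filter ℕ)))
    (tendsto_subgradient (U := fun _ : ℕ => u) hg (fun _ => tendsto_const_nhds)
      (Eventually.of_forall fun _ => he))

namespace IsNullConvex

variable {u : E → ℝ} [FiniteDimensional ℝ E]

/-- The foot point of the level surface is at least as far away as the end of any light ray. -/
lemma sub_prox_le_of_ray (hu : IsNullConvex u) {ε : ℝ} (hε : 0 < ε) {x z : E}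
    (hz : u z + ‖x - z‖ ≤ u x) : ‖x - z‖ ≤ ‖x - prox u ε x‖ := by
  by_contra! hlt
  have h1 := hu.prox_spec ε x z
  have h2 := hu.sub_le x (prox u ε x)
  set r := ‖x - prox u ε x‖
  set R := ‖x - z‖
  set N := hyp ε (x - prox u ε x)
  set M := hyp ε (x - z)
  have a : N ^ 2 = ε ^ 2 + r ^ 2 := hyp_sq _ _
  have b : M ^ 2 = ε ^ 2 + R ^ 2 := hyp_sq _ _
  have hN : 0 < N := hyp_pos hε _
  have hM : 0 < M := hyp_pos hε _
  have hr : 0 ≤ r := norm_nonneg _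
  -- `√(ε² + r²) - r` is strictly decreasing in `r`
  have c : N - r ≤ M - R := by linarith
  have d1 : (N - r) * (N + r) = ε ^ 2 := by linarith
  have d2 : (M - R) * (M + R) = ε ^ 2 := by linarith
  have hNM : N < M := lt_of_pow_lt_pow_left₀ 2 hM.le (by rw [a, b]; nlinarith)
  have hpos : 0 < N - r := by
    by_contra! h
    nlinarith [sq_pos_of_pos hε]
  nlinarith

lemma norm_sub_prox_mono (hu : IsNullConvex u) {ε ε' : ℝ} (hε : 0 < ε) (h : ε ≤ ε') (x : E) :
    ‖x - prox u ε x‖ ≤ ‖x - prox u ε' x‖ := by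
  rcases h.eq_or_lt with rfl | h
  · exact le_rfl
  by_contra! hlt
  have h1 := hu.prox_spec ε x (prox u ε' x)
  have h2 := hu.prox_spec ε' x (prox u ε x)
  set w := x - prox u ε x
  set w' := x - prox u ε' x
  have a1 := hyp_sq ε w
  have a2 := hyp_sq ε w'
  have b1 := hyp_sq ε' w
  have b2 := hyp_sq ε' w'
  have hw := norm_nonneg w'
  have hsq : ‖w'‖ ^ 2 < ‖w‖ ^ 2 := by gcongr
  have c1 : hyp ε w' < hyp ε w := lt_of_pow_lt_pow_left₀ 2 (hyp_nonneg _ _) (by linarith)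
  have c2 : hyp ε' w' < hyp ε' w := lt_of_pow_lt_pow_left₀ 2 (hyp_nonneg _ _) (by linarith)
  have p1 := hyp_pos hε w
  have p2 := hyp_pos hε w'
  have p3 := hyp_pos (hε.trans h) w'
  -- `√(ε'² + r²) - √(ε² + r²)` is strictly decreasing in `r`
  have d : hyp ε' w' - hyp ε w' ≤ hyp ε' w - hyp ε w := by linarith
  have e1 : (hyp ε' w' - hyp ε w') * (hyp ε' w' + hyp ε w') = ε' ^ 2 - ε ^ 2 := by linarith
  have e2 : (hyp ε' w - hyp ε w) * (hyp ε' w + hyp ε w) = ε' ^ 2 - ε ^ 2 := by linarith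
  have hd : 0 < ε' ^ 2 - ε ^ 2 := by nlinarith
  have hpos : 0 < hyp ε' w' - hyp ε w' := by
    by_contra! h
    nlinarith
  nlinarith

lemma rho_mono (hu : IsNullConvex u) {ε ε' : ℝ} (hε : 0 < ε) (h : ε ≤ ε') (x : E) :
    rho u ε x ≤ rho u ε' x := by
  have := hu.norm_sub_prox_mono hε h x
  unfold rho hyp
  gcongr

/-- Coercivity bounds the foot points, hence the intensities of the level surfaces. -/
lemma exists_rho_le (hu : IsNullConvex u) (R : ℝ) :
    ∃ M > 0, ∀ ε ∈ Ioc (0 : ℝ) 1, ∀ x, ‖x‖ ≤ R → rho u ε x ≤ M := by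
  obtain ⟨κ, hκ, C, hC⟩ := hu.coercive
  refine ⟨max 1 (1 + R + κ⁻¹ * (C + |u 0| + 2 * R + 1)), by positivity,
    fun ε hε x hx => le_max_of_le_right ?_⟩
  set y := prox u ε x with hy
  have h1 : rho u ε x ≤ ε + ‖x - y‖ := hyp_le hε.1.le _
  have h2 := hu.level_le_add hε.1.le x
  have h3 := norm_le_hyp ε (x - y)
  have h4 := hC y
  have h5 : ‖x - y‖ ≤ ‖x‖ + ‖y‖ := norm_sub_le _ _
  have h6 : ‖y‖ - ‖x‖ ≤ ‖x - y‖ := by rw [norm_sub_rev]; exact norm_sub_norm_le _ _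
  have h7 := hu.sub_le x 0
  rw [sub_zero] at h7
  have h8 := le_abs_self (u 0)
  rw [level, ← hy] at h2
  have h9 : κ * ‖y‖ ≤ C + |u 0| + 2 * R + 1 := by linarith [hε.2]
  have h10 : ‖y‖ ≤ κ⁻¹ * (C + |u 0| + 2 * R + 1) := by
    rwa [← div_eq_inv_mul, le_div_iff₀ hκ, mul_comm]
  linarith [hε.2]

/-- There is a longest past light ray at every point, and its length is the limit of the
intensities of the level surfaces. -/
lemma exists_isGreatest_rayLengths (hu : IsNullConvex u) (x : E) :
    ∃ L, IsGreatest (rayLengths u x) L ∧ Tendsto (fun ε => rho u ε x) (𝓝[>] 0) (𝓝 L) := by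
  obtain ⟨M, -, hM⟩ := hu.exists_rho_le ‖x‖
  let e : ℕ → ℝ := fun j => 1 / ((j : ℝ) + 1)
  have he0 : ∀ j, 0 < e j := fun j => by positivity
  have he1 : ∀ j, e j ≤ 1 := fun j => by
    rw [div_le_one (by positivity)]; linarith [(Nat.cast_nonneg j : (0 : ℝ) ≤ j)]
  have het : Tendsto e atTop (𝓝 0) := tendsto_one_div_add_atTop_nhds_zero_nat
  have hb : ∀ j, prox u (e j) x ∈ Metric.closedBall x M := fun j => by
    rw [mem_closedBall_iff_norm']
    exact (norm_le_hyp _ _).trans (hM _ ⟨he0 j, he1 j⟩ x le_rfl)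
  obtain ⟨y, -, ψ, hψ, hy⟩ := (isCompact_closedBall x M).tendsto_subseq hb
  have heψ : Tendsto (fun j => e (ψ j)) atTop (𝓝 0) := het.comp hψ.tendsto_atTop
  have hnorm : Tendsto (fun j => ‖x - prox u (e (ψ j)) x‖) atTop (𝓝 ‖x - y‖) :=
    (tendsto_const_nhds.sub hy).norm
  have hray : u y + ‖x - y‖ ≤ u x := by
    have h1 : Tendsto (fun j => u (prox u (e (ψ j)) x) + ‖x - prox u (e (ψ j)) x‖) atTop
        (𝓝 (u y + ‖x - y‖)) := ((hu.continuous.tendsto y).comp hy).add hnorm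
    have h2 : Tendsto (fun j => u x + e (ψ j)) atTop (𝓝 (u x + 0)) := heψ.const_add _
    rw [add_zero] at h2
    refine le_of_tendsto_of_tendsto' h1 h2 fun j => ?_
    have := hu.level_le_add (he0 (ψ j)).le x
    have := norm_le_hyp (e (ψ j)) (x - prox u (e (ψ j)) x)
    unfold level at *
    linarith
  have hle : ∀ ε, 0 < ε → ‖x - y‖ ≤ rho u ε x := fun ε hε =>
    (hu.sub_prox_le_of_ray hε hray).trans (norm_le_hyp _ _)
  refine ⟨‖x - y‖, ⟨⟨y, rfl, hray⟩, ?_⟩, ?_⟩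
  · rintro r ⟨z, rfl, hz⟩
    exact ge_of_tendsto' hnorm fun j => hu.sub_prox_le_of_ray (he0 _) hz
  · rw [tendsto_order]
    constructor
    · intro a ha
      filter_upwards [self_mem_nhdsWithin] with ε hε using ha.trans_le (hle ε hε)
    · intro a ha
      have h1 : Tendsto (fun j => e (ψ j) + ‖x - prox u (e (ψ j)) x‖) atTop (𝓝 (0 + ‖x - y‖)) :=
        heψ.add hnorm
      rw [zero_add] at h1
      obtain ⟨j, hj⟩ := (h1.eventually_lt_const ha).exists
      filter_upwards [Ioc_mem_nhdsGT (he0 (ψ j))] with ε hε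
      exact (hu.rho_mono hε.1 hε.2 x).trans_lt ((hyp_le (he0 _).le _).trans_lt hj)

lemma isGreatest_rayLength (hu : IsNullConvex u) (x : E) :
    IsGreatest (rayLengths u x) (rayLength u x) := by
  obtain ⟨L, hL, -⟩ := hu.exists_isGreatest_rayLengths x
  rwa [rayLength, hL.csSup_eq]

lemma tendsto_rho (hu : IsNullConvex u) (x : E) :
    Tendsto (fun ε => rho u ε x) (𝓝[>] 0) (𝓝 (rayLength u x)) := by
  obtain ⟨L, hL, h⟩ := hu.exists_isGreatest_rayLengths x
  rwa [rayLength, hL.csSup_eq]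

lemma rayLength_nonneg (hu : IsNullConvex u) (x : E) : 0 ≤ rayLength u x :=
  (hu.isGreatest_rayLength x).2 ⟨x, by simp⟩

lemma rayLength_le_rho (hu : IsNullConvex u) {ε : ℝ} (hε : 0 < ε) (x : E) :
    rayLength u x ≤ rho u ε x := by
  obtain ⟨y, hy, h⟩ := (hu.isGreatest_rayLength x).1
  rw [← hy] at h ⊢
  exact (hu.sub_prox_le_of_ray hε h).trans (norm_le_hyp _ _)

lemma measurable_rayLength [MeasurableSpace E] [BorelSpace E] (hu : IsNullConvex u) :
    Measurable (rayLength u) := by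
  have h : Tendsto (fun j : ℕ => 1 / ((j : ℝ) + 1)) atTop (𝓝[>] 0) :=
    tendsto_nhdsWithin_iff.2 ⟨tendsto_one_div_add_atTop_nhds_zero_nat,
      Eventually.of_forall fun j => by simp only [mem_Ioi]; positivity⟩
  exact measurable_of_tendsto_metrizable
    (fun j => (hu.continuous_rho (ε := 1 / ((j : ℝ) + 1)) (by positivity)).measurable)
    (tendsto_pi_nhds.2 fun x => (hu.tendsto_rho x).comp h)

lemma exists_rayLength_le (hu : IsNullConvex u) (R : ℝ) :
    ∃ M > 0, ∀ x, ‖x‖ ≤ R → rayLength u x ≤ M := by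
  obtain ⟨M, hM, h⟩ := hu.exists_rho_le R
  exact ⟨M, hM, fun x hx => (hu.rayLength_le_rho one_pos x).trans (h 1 ⟨one_pos, le_rfl⟩ x hx)⟩

lemma tendsto_level (hu : IsNullConvex u) (x : E) :
    Tendsto (fun ε => level u ε x) (𝓝[>] 0) (𝓝 (u x)) := by
  have h : Tendsto (fun ε : ℝ => u x + ε) (𝓝[>] 0) (𝓝 (u x + 0)) :=
    (tendsto_id.const_add _).mono_left nhdsWithin_le_nhds
  rw [add_zero] at h
  exact tendsto_of_tendsto_of_tendsto_of_le_of_le' tendsto_const_nhds h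
    (Eventually.of_forall fun ε => hu.le_level_self ε x)
    (by filter_upwards [self_mem_nhdsWithin] with ε hε using hu.level_le_add (le_of_lt hε) x)

lemma tendsto_slope (hu : IsNullConvex u) {x g : E} (hg : HasGradientAt u g x) :
    Tendsto (fun ε => slope u ε x) (𝓝[>] 0) (𝓝 g) :=
  tendsto_subgradient hg hu.tendsto_level
    (by filter_upwards [self_mem_nhdsWithin] with ε hε using hu.le_level hε x)

/-- Where `u` is differentiable, its gradient is the subgradient of norm one. -/
lemma norm_gradient (hu : IsNullConvex u) {x g : E} (hg : HasGradientAt u g x) : ‖g‖ = 1 := by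
  obtain ⟨e, he, h⟩ := hu.exists_subgradient x
  rwa [← subgradient_eq_gradient hg h]

lemma le_of_hasGradientAt (hu : IsNullConvex u) {x g : E} (hg : HasGradientAt u g x) (z : E) :
    u x + inner ℝ g (z - x) ≤ u z := by
  obtain ⟨e, he, h⟩ := hu.exists_subgradient x
  rw [← subgradient_eq_gradient hg h]
  exact h z

/-- The gradient flow moves points along light rays. -/
lemma le_rayLength_add (hu : IsNullConvex u) {x g : E} (hg : HasGradientAt u g x) {t : ℝ}
    (ht : 0 ≤ t) : t ≤ rayLength u (x + t • g) := by
  refine (hu.isGreatest_rayLength _).2 ⟨x, ?_, ?_⟩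
  · rw [add_sub_cancel_left, norm_smul, hu.norm_gradient hg, mul_one, Real.norm_of_nonneg ht]
  · have := hu.le_of_hasGradientAt hg (x + t • g)
    rwa [add_sub_cancel_left, inner_smul_right, real_inner_self_eq_norm_sq, hu.norm_gradient hg,
      one_pow, mul_one] at this

/-- The gradient flow is expanding. -/
lemma norm_sub_le_flow (hu : IsNullConvex u) {x g x' g' : E} (hg : HasGradientAt u g x)
    (hg' : HasGradientAt u g' x') {t : ℝ} (ht : 0 ≤ t) :
    ‖x - x'‖ ≤ ‖(x + t • g) - (x' + t • g')‖ := by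
  have h1 := hu.le_of_hasGradientAt hg x'
  have h2 := hu.le_of_hasGradientAt hg' x
  rw [← neg_sub x x', inner_neg_right] at h1
  have h3 : 0 ≤ inner ℝ (x - x') (g - g') := by
    rw [real_inner_comm, inner_sub_left]; linarith
  have e : (x + t • g) - (x' + t • g') = (x - x') + t • (g - g') := by module
  rw [e]
  refine le_of_sq_le_sq ?_ (norm_nonneg _)
  rw [norm_add_sq_real, inner_smul_right]
  nlinarith [mul_nonneg ht h3, sq_nonneg ‖t • (g - g')‖]

lemma ae_hasGradientAt [MeasurableSpace E] [BorelSpace E] (hu : IsNullConvex u)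
    (μ : Measure E) [μ.IsAddHaarMeasure] : ∀ᵐ x ∂μ, HasGradientAt u (gradient u x) x := by
  filter_upwards [hu.lipschitzWith.ae_differentiableAt (μ := μ)] with x hx
  exact hx.hasGradientAt

end IsNullConvex

end Intensity

/-! ### Second order estimates for the level surfaces -/

section SecondOrder

variable {E : Type*} [NormedAddCommGroup E] [InnerProductSpace ℝ E] [FiniteDimensional ℝ E]

omit [FiniteDimensional ℝ E] in
lemma hasFDerivAt_rho {u : E → ℝ} {ε : ℝ} (hε : 0 < ε) {x : E} {Q : E →L[ℝ] E}
    (hQ : HasFDerivAt (slope u ε) Q x) :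
    HasFDerivAt (rho u ε)
      ((rho u ε x ^ 3 / ε ^ 2) • (innerSL ℝ (slope u ε x)).comp Q) x := by
  have h1 := norm_slope_lt_one u hε x
  have h2 : 0 < 1 - ‖slope u ε x‖ ^ 2 := by nlinarith [norm_nonneg (slope u ε x)]
  have h3 := ((hasDerivAt_inv (Real.sqrt_pos.2 h2).ne').comp_hasFDerivAt x
    ((hQ.norm_sq.const_sub 1).sqrt h2.ne')).const_mul ε
  have e : rho u ε = fun y => ε * (√(1 - ‖slope u ε y‖ ^ 2))⁻¹ :=
    funext fun y => by rw [rho_eq u hε, div_eq_mul_inv]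
  have h4 := rho_eq u hε x
  rw [e]
  refine h3.congr_fderiv ?_
  ext h
  have h5 : 0 < √(1 - ‖slope u ε x‖ ^ 2) := Real.sqrt_pos.2 h2
  simp only [_root_.smul_apply, _root_.neg_apply,
    ContinuousLinearMap.comp_apply, innerSL_apply_apply, smul_eq_mul]
  field_simp
  rw [two_smul, two_mul]

namespace IsNullConvex

variable {u : E → ℝ}

/-- The infinitesimal form of the monotonicity of the subdifferential of `u` at the foot points. -/
lemma key_inequality (hu : IsNullConvex u) {ε : ℝ} (hε : 0 < ε) {x : E} {Q : E →L[ℝ] E}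
    (hQ : HasFDerivAt (slope u ε) Q x) (h : E) :
    rho u ε x * ‖Q h‖ ^ 2 + rho u ε x ^ 3 / ε ^ 2 * inner ℝ (slope u ε x) (Q h) ^ 2
      ≤ inner ℝ (Q h) h := by
  have hl : HasDerivAt (fun s : ℝ => x + s • h) h 0 := by
    simpa using ((hasDerivAt_id (0 : ℝ)).smul_const h).const_add x
  have hx : x = x + (0 : ℝ) • h := by simp
  have hP : HasFDerivAt (prox u ε) (ContinuousLinearMap.id ℝ E -
      (rho u ε x • Q + ((rho u ε x ^ 3 / ε ^ 2) •
        (innerSL ℝ (slope u ε x)).comp Q).smulRight (slope u ε x))) x := by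
    have e : prox u ε = fun y => y - rho u ε y • slope u ε y :=
      funext fun y => by rw [rho_smul_slope u hε, sub_sub_cancel]
    rw [e]
    exact (hasFDerivAt_id x).sub ((hasFDerivAt_rho hε hQ).smul hQ)
  have d1 : HasDerivAt (fun s : ℝ => slope u ε (x + s • h)) (Q h) 0 := by
    rw [hx] at hQ
    exact hQ.comp_hasDerivAt (0 : ℝ) hl
  have d2 := by
    rw [hx] at hP
    exact hP.comp_hasDerivAt (0 : ℝ) hl
  have t1 := d1.tendsto_slope_zero_right
  have t2 := d2.tendsto_slope_zero_right
  have t3 := ge_of_tendsto (t1.inner (𝕜 := ℝ) t2) (b := 0) (by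
    filter_upwards [self_mem_nhdsWithin] with s hs
    have hs : 0 < s := hs
    simp only [zero_add, zero_smul, add_zero, Function.comp_apply]
    rw [inner_smul_left, inner_smul_right]
    have := hu.inner_slope_sub_prox_nonneg hε x (x + s • h)
    have hs' : 0 ≤ s⁻¹ := by positivity
    exact mul_nonneg hs' (mul_nonneg hs' this))
  rw [← hx] at t3
  simp only [_root_.sub_apply, _root_.add_apply,
    _root_.smul_apply, ContinuousLinearMap.smulRight_apply,
    ContinuousLinearMap.comp_apply, innerSL_apply_apply, ContinuousLinearMap.id_apply, smul_eq_mul,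
    inner_sub_right, inner_add_right, inner_smul_right, real_inner_self_eq_norm_sq] at t3
  rw [real_inner_comm (slope u ε x) (Q h)] at t3
  nlinarith

lemma inner_fderiv_nonneg (hu : IsNullConvex u) {ε : ℝ} (hε : 0 < ε) {x : E} {Q : E →L[ℝ] E}
    (hQ : HasFDerivAt (slope u ε) Q x) (h : E) : 0 ≤ inner ℝ (Q h) h := by
  have h0 := rho_pos u hε x
  exact le_trans (by positivity) (hu.key_inequality hε hQ h)

/-- The level surface is at most as curved as the hyperboloid that touches it from above. -/
lemma inner_fderiv_le (hu : IsNullConvex u) {ε : ℝ} (hε : 0 < ε) {x : E} {Q : E →L[ℝ] E}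
    (hQ : HasFDerivAt (slope u ε) Q x) (h : E) :
    rho u ε x * inner ℝ (Q h) h ≤ ‖h‖ ^ 2 - inner ℝ (slope u ε x) h ^ 2 := by
  have h0 := rho_pos u hε x
  have h1 := hu.key_inequality hε hQ h
  have h2 := one_sub_norm_slope_sq u hε x
  set r := rho u ε x
  set p := slope u ε x
  set q := Q h
  -- complete the square: `q` is compared with the value `a / r` for the hyperboloid
  set a := h - (inner ℝ p h : ℝ) • p with ha
  have s1 : 0 ≤ ‖r • q - a‖ ^ 2 := sq_nonneg _
  have s2 : 0 ≤ r ^ 2 / ε ^ 2 * inner ℝ p (r • q - a) ^ 2 := by positivity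
  have e1 : ‖r • q - a‖ ^ 2 = r ^ 2 * ‖q‖ ^ 2 - 2 * r * inner ℝ q h
      + 2 * r * inner ℝ p h * inner ℝ p q
      + ‖h‖ ^ 2 - 2 * inner ℝ p h ^ 2 + inner ℝ p h ^ 2 * ‖p‖ ^ 2 := by
    rw [norm_sub_sq_real, ha, norm_sub_sq_real, norm_smul, norm_smul, inner_smul_left,
      inner_sub_right, inner_smul_right, inner_smul_right, real_inner_comm p q,
      real_inner_comm p h, Real.norm_of_nonneg h0.le, mul_pow, mul_pow, Real.norm_eq_abs, sq_abs]
    simp only [conj_trivial]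
    ring
  have e2 : inner ℝ p (r • q - a) = r * inner ℝ p q - inner ℝ p h * (1 - ‖p‖ ^ 2) := by
    rw [ha, inner_sub_right, inner_sub_right, inner_smul_right, inner_smul_right,
      real_inner_self_eq_norm_sq]
    ring
  have e3 : r ^ 2 / ε ^ 2 * inner ℝ p (r • q - a) ^ 2 = r ^ 4 / ε ^ 2 * inner ℝ p q ^ 2
      - 2 * r * inner ℝ p q * inner ℝ p h + inner ℝ p h ^ 2 * (1 - ‖p‖ ^ 2) := by
    rw [e2, ← h2]
    have : 1 - ‖p‖ ^ 2 ≠ 0 := by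
      intro h; rw [h, mul_zero] at h2; nlinarith [sq_pos_of_pos hε]
    field_simp
    ring
  have e4 : r * (r * ‖q‖ ^ 2 + r ^ 3 / ε ^ 2 * inner ℝ p q ^ 2)
      = r ^ 2 * ‖q‖ ^ 2 + r ^ 4 / ε ^ 2 * inner ℝ p q ^ 2 := by ring
  have h3 := mul_le_mul_of_nonneg_left h1 h0.le
  rw [e4] at h3
  linarith

/-- The term `⟨∇rho, slope⟩` of the divergence of `rho • slope` is at most one. -/
lemma inner_fderiv_slope_le (hu : IsNullConvex u) {ε : ℝ} (hε : 0 < ε) {x : E} {Q : E →L[ℝ] E}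
    (hQ : HasFDerivAt (slope u ε) Q x) :
    rho u ε x ^ 3 / ε ^ 2 * inner ℝ (slope u ε x) (Q (slope u ε x)) ≤ ‖slope u ε x‖ ^ 2 := by
  have h0 := rho_pos u hε x
  have h1 := hu.inner_fderiv_le hε hQ (slope u ε x)
  have h2 := one_sub_norm_slope_sq u hε x
  rw [real_inner_self_eq_norm_sq, real_inner_comm] at h1
  have h3 : rho u ε x ^ 3 / ε ^ 2 * inner ℝ (slope u ε x) (Q (slope u ε x))
      = rho u ε x ^ 2 / ε ^ 2 * (rho u ε x * inner ℝ (slope u ε x) (Q (slope u ε x))) := by ring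
  have h4 : rho u ε x ^ 2 / ε ^ 2 * (‖slope u ε x‖ ^ 2 - (‖slope u ε x‖ ^ 2) ^ 2)
      = ‖slope u ε x‖ ^ 2 := by
    have : rho u ε x ^ 2 / ε ^ 2 * (‖slope u ε x‖ ^ 2 - (‖slope u ε x‖ ^ 2) ^ 2)
      = ‖slope u ε x‖ ^ 2 * (rho u ε x ^ 2 * (1 - ‖slope u ε x‖ ^ 2)) / ε ^ 2 := by ring
    rw [this, h2]; field_simp
  rw [h3, ← h4]
  gcongr

lemma norm_fderiv_slope_le (hu : IsNullConvex u) {ε : ℝ} (hε : 0 < ε) {x : E} {Q : E →L[ℝ] E}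
    (hQ : HasFDerivAt (slope u ε) Q x) :
    rho u ε x * ‖Q (slope u ε x)‖ ≤ ε / rho u ε x := by
  have h0 := rho_pos u hε x
  have h1 := hu.key_inequality hε hQ (slope u ε x)
  have h2 := hu.inner_fderiv_slope_le hε hQ
  have h3 := norm_slope_lt_one u hε x
  rw [le_div_iff₀ h0]
  refine le_of_sq_le_sq ?_ hε.le
  have h4 : rho u ε x ^ 3 * inner ℝ (slope u ε x) (Q (slope u ε x)) ≤ ε ^ 2 := by
    have h5 : ‖slope u ε x‖ ^ 2 ≤ 1 := by nlinarith [norm_nonneg (slope u ε x)]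
    have := h2.trans h5
    rw [div_mul_eq_mul_div, div_le_iff₀ (by positivity)] at this
    linarith
  have h6 : rho u ε x * ‖Q (slope u ε x)‖ ^ 2
      ≤ inner ℝ (slope u ε x) (Q (slope u ε x)) := by
    rw [real_inner_comm]
    refine le_trans ?_ h1
    have : 0 ≤ rho u ε x ^ 3 / ε ^ 2 * inner ℝ (slope u ε x) (Q (slope u ε x)) ^ 2 := by
      positivity
    linarith
  calc (rho u ε x * ‖Q (slope u ε x)‖ * rho u ε x) ^ 2
      = rho u ε x ^ 3 * (rho u ε x * ‖Q (slope u ε x)‖ ^ 2) := by ring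
    _ ≤ rho u ε x ^ 3 * inner ℝ (slope u ε x) (Q (slope u ε x)) := by gcongr
    _ ≤ ε ^ 2 := h4

lemma trace_nonneg (hu : IsNullConvex u) {ε : ℝ} (hε : 0 < ε) {x : E} {Q : E →L[ℝ] E}
    (hQ : HasFDerivAt (slope u ε) Q x) : 0 ≤ LinearMap.trace ℝ E Q := by
  rw [LinearMap.trace_eq_sum_inner _ (stdOrthonormalBasis ℝ E)]
  refine Finset.sum_nonneg fun i _ => ?_
  rw [real_inner_comm]
  exact hu.inner_fderiv_nonneg hε hQ _

/-- The trace of `inner_fderiv_le`: with `inner_fderiv_slope_le` it bounds the divergence of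
`rho • slope` by the dimension. -/
lemma rho_mul_trace_le (hu : IsNullConvex u) {ε : ℝ} (hε : 0 < ε) {x : E} {Q : E →L[ℝ] E}
    (hQ : HasFDerivAt (slope u ε) Q x) :
    rho u ε x * LinearMap.trace ℝ E Q ≤ Module.finrank ℝ E - ‖slope u ε x‖ ^ 2 := by
  let b := stdOrthonormalBasis ℝ E
  rw [LinearMap.trace_eq_sum_inner _ b, Finset.mul_sum]
  have h : ∀ i, rho u ε x * inner ℝ (b i) (Q (b i)) ≤ 1 - inner ℝ (slope u ε x) (b i) ^ 2 := by
    intro i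
    have := hu.inner_fderiv_le hε hQ (b i)
    rwa [b.orthonormal.1 i, one_pow, real_inner_comm] at this
  refine (Finset.sum_le_sum fun i _ => h i).trans_eq ?_
  rw [Finset.sum_sub_distrib, OrthonormalBasis.sum_sq_inner_left]
  simp

end IsNullConvex

section Divergence

variable [MeasurableSpace E] [BorelSpace E] (μ : Measure E) [μ.IsAddHaarMeasure]

/-- Integration by parts against the divergence of a Lipschitz vector field. -/
lemma integral_mul_trace_fderiv {p : E → E} {K C : NNReal} (hp : LipschitzWith K p) {g : E → ℝ}
    (hg : LipschitzWith C g) (hgc : HasCompactSupport g) :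
    Integrable (fun x => g x * LinearMap.trace ℝ E (fderiv ℝ p x)) μ ∧
    Integrable (fun x => fderiv ℝ g x (p x)) μ ∧
    ∫ x, g x * LinearMap.trace ℝ E (fderiv ℝ p x) ∂μ = -∫ x, fderiv ℝ g x (p x) ∂μ := by
  let b := stdOrthonormalBasis ℝ E
  let f : Fin (Module.finrank ℝ E) → E → ℝ := fun i x => inner ℝ (b i) (p x)
  have hf : ∀ i, LipschitzWith K (f i) := fun i => by
    refine LipschitzWith.of_dist_le_mul fun x y => ?_
    rw [Real.dist_eq, ← inner_sub_right]
    refine (abs_real_inner_le_norm _ _).trans ?_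
    rw [b.orthonormal.1 i, one_mul, ← dist_eq_norm]
    exact hp.dist_le_mul x y
  have a1 : ∀ᵐ x ∂μ, g x * LinearMap.trace ℝ E (fderiv ℝ p x)
      = ∑ i, lineDeriv ℝ (f i) x (b i) * g x := by
    filter_upwards [hp.ae_differentiableAt (μ := μ)] with x hx
    rw [LinearMap.trace_eq_sum_inner _ b, mul_comm, Finset.sum_mul]
    refine Finset.sum_congr rfl fun i _ => ?_
    have h1 : HasFDerivAt (f i) ((innerSL ℝ (b i)).comp (fderiv ℝ p x)) x :=
      (innerSL ℝ (b i)).hasFDerivAt.comp x hx.hasFDerivAt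
    rw [h1.differentiableAt.lineDeriv_eq_fderiv, h1.fderiv]
    rfl
  have a2 : ∀ᵐ x ∂μ, fderiv ℝ g x (p x) = ∑ i, -(lineDeriv ℝ g x (-b i) * f i x) := by
    filter_upwards [hg.ae_differentiableAt (μ := μ)] with x hx
    conv_lhs => rw [← b.sum_repr' (p x), map_sum]
    refine Finset.sum_congr rfl fun i _ => ?_
    rw [hx.lineDeriv_eq_fderiv, map_smul, map_neg, smul_eq_mul]
    ring
  have i1 : ∀ i, Integrable (fun x => lineDeriv ℝ (f i) x (b i) * g x) μ := fun i =>
    (hg.continuous.integrable_of_hasCompactSupport hgc).smul_of_top_right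
      ((hf i).memLp_lineDeriv (b i))
  have i2 : ∀ i, Integrable (fun x => lineDeriv ℝ g x (-b i) * f i x) μ := fun i => by
    have hs : Function.support (fun x => lineDeriv ℝ g x (-b i) * f i x) ⊆ tsupport g := by
      intro x hx
      by_contra hx'
      apply hx
      have h0 : g =ᶠ[𝓝 x] fun _ => 0 := by
        filter_upwards [(isClosed_tsupport g).isOpen_compl.mem_nhds hx'] with y hy
        exact image_eq_zero_of_notMem_tsupport hy
      have h1 : lineDeriv ℝ g x (-b i) = 0 := by rw [h0.lineDeriv_eq]; simp [lineDeriv]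
      simp [h1]
    rw [← integrableOn_iff_integrable_of_support_subset hs]
    have h1 : IntegrableOn (f i) (tsupport g) μ :=
      (hf i).continuous.continuousOn.integrableOn_compact hgc
    exact h1.smul_of_top_right ((hg.memLp_lineDeriv (μ := μ) (-b i)).restrict _)
  have i3 : ∀ i, Integrable (fun x => -(lineDeriv ℝ g x (-b i) * f i x)) μ := fun i => (i2 i).neg
  refine ⟨(integrable_congr a1).2 (integrable_finsetSum _ fun i _ => i1 i),
    (integrable_congr a2).2 (integrable_finsetSum _ fun i _ => i3 i), ?_⟩
  rw [integral_congr_ae a1, integral_congr_ae a2, integral_finsetSum _ fun i _ => i1 i,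
    integral_finsetSum _ fun i _ => i3 i, ← Finset.sum_neg_distrib]
  refine Finset.sum_congr rfl fun i _ => ?_
  rw [integral_neg, neg_neg]
  exact (hf i).integral_lineDeriv_mul_eq hg hgc (b i)

end Divergence

end SecondOrder

/-! ### The transport inequality for the level surfaces -/

section Transport

variable {E : Type*} [NormedAddCommGroup E] [InnerProductSpace ℝ E] [FiniteDimensional ℝ E]

namespace IsNullConvex

variable {u : E → ℝ}

/-- The intensity of a level surface is locally Lipschitz; hence its product with a compactly
supported Lipschitz function is Lipschitz. -/
lemma exists_lipschitzWith_mul_rho (hu : IsNullConvex u) {ε : ℝ} (hε : 0 < ε) {φ : E → ℝ}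
    {K : NNReal} (hφ : LipschitzWith K φ) (hc : HasCompactSupport φ) :
    ∃ C, LipschitzWith C (fun x => φ x * rho u ε x) := by
  obtain ⟨R, hR⟩ := hc.isBounded.subset_closedBall (0 : E)
  obtain ⟨M, hM⟩ := (isCompact_closedBall (0 : E) R).exists_bound_of_continuousOn
    (hu.continuous_rho hε).continuousOn
  obtain ⟨F, hF⟩ := hc.exists_bound_of_continuous hφ.continuous
  have hF0 : 0 ≤ F := (norm_nonneg _).trans (hF 0)
  have hρ : ∀ x, 0 < rho u ε x := rho_pos u hε
  have hM' : ∀ x ∈ tsupport φ, rho u ε x ≤ M := fun x hx => (le_abs_self _).trans (hM x (hR hx))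
  have h0 : ∀ x, x ∉ tsupport φ → φ x = 0 := fun x => image_eq_zero_of_notMem_tsupport
  have hK : ∀ x y, |φ x - φ y| ≤ K * ‖x - y‖ := fun x y => by
    rw [← Real.dist_eq, ← dist_eq_norm]; exact hφ.dist_le_mul x y
  have hρL : ∀ x ∈ tsupport φ, ∀ y ∈ tsupport φ,
      |rho u ε x - rho u ε y| ≤ M ^ 4 / ε ^ 4 * ‖x - y‖ := by
    intro x hx y hy
    have a1 := one_sub_norm_slope_sq u hε x
    have a2 := one_sub_norm_slope_sq u hε y
    have b1 := norm_slope_lt_one u hε x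
    have b2 := norm_slope_lt_one u hε y
    have c := hu.norm_slope_sub_le hε x y
    have d : |‖slope u ε x‖ - ‖slope u ε y‖| ≤ ε⁻¹ * ‖x - y‖ := (abs_norm_sub_norm_le _ _).trans c
    have hx0 := hρ x
    have hy0 := hρ y
    have hxM := hM' x hx
    have hyM := hM' y hy
    have lx := le_rho u ε x
    have ly := le_rho u ε y
    set a := rho u ε x
    set b := rho u ε y
    set s := ‖slope u ε x‖
    set r := ‖slope u ε y‖
    have hs : 0 ≤ s := norm_nonneg _
    have hr : 0 ≤ r := norm_nonneg _
    have e : ε ^ 2 * ((a + b) * (a - b)) = a ^ 2 * b ^ 2 * ((s + r) * (s - r)) := by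
      linear_combination b ^ 2 * a1 - a ^ 2 * a2
    have e2 : ε ^ 2 * ((a + b) * |a - b|) = a ^ 2 * b ^ 2 * ((s + r) * |s - r|) := by
      have := congrArg abs e
      rwa [abs_mul, abs_mul, abs_mul, abs_of_pos (by positivity : 0 < ε ^ 2),
        abs_of_pos (by positivity : 0 < a + b), abs_of_pos (by positivity : 0 < a ^ 2 * b ^ 2),
        abs_mul, abs_of_nonneg (by positivity : 0 ≤ s + r)] at this
    have e3 : a ^ 2 * b ^ 2 * ((s + r) * |s - r|) ≤ M ^ 2 * M ^ 2 * (2 * (ε⁻¹ * ‖x - y‖)) := by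
      have : s + r ≤ 2 := by linarith
      gcongr
    have e4 : ε ^ 2 * (2 * ε * |a - b|) ≤ ε ^ 2 * ((a + b) * |a - b|) := by
      have : 2 * ε ≤ a + b := by linarith
      gcongr
    have e5 : ε ^ 2 * (2 * ε * |a - b|) ≤ M ^ 2 * M ^ 2 * (2 * (ε⁻¹ * ‖x - y‖)) := by linarith
    have e6 : M ^ 2 * M ^ 2 * (2 * (ε⁻¹ * ‖x - y‖))
        = ε ^ 2 * (2 * ε * (M ^ 4 / ε ^ 4 * ‖x - y‖)) := by field_simp
    rw [e6] at e5
    exact le_of_mul_le_mul_left (le_of_mul_le_mul_left e5 (by positivity)) (by positivity)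
  refine ⟨Real.toNNReal (F * (M ^ 4 / ε ^ 4) + K * |M|), LipschitzWith.of_dist_le_mul fun x y => ?_⟩
  rw [Real.dist_eq, dist_eq_norm, Real.coe_toNNReal _ (by positivity), add_mul]
  have p1 : 0 ≤ F * (M ^ 4 / ε ^ 4) * ‖x - y‖ := by positivity
  have p2 : 0 ≤ K * |M| * ‖x - y‖ := by positivity
  by_cases hx : x ∈ tsupport φ
  · by_cases hy : y ∈ tsupport φ
    · have e : φ x * rho u ε x - φ y * rho u ε y
          = φ x * (rho u ε x - rho u ε y) + (φ x - φ y) * rho u ε y := by ring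
      rw [e]
      refine (abs_add_le _ _).trans (add_le_add ?_ ?_)
      · rw [abs_mul, mul_assoc]
        exact mul_le_mul (hF x) (hρL x hx y hy) (abs_nonneg _) hF0
      · rw [abs_mul, abs_of_pos (hρ y), mul_right_comm]
        exact mul_le_mul (hK x y) ((hM' y hy).trans (le_abs_self M)) (hρ y).le (by positivity)
    · have := hK x y
      rw [h0 y hy, sub_zero] at this
      rw [h0 y hy, zero_mul, sub_zero, abs_mul, abs_of_pos (hρ x)]
      have := mul_le_mul this ((hM' x hx).trans (le_abs_self M)) (hρ x).le (by positivity)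
      linarith
  · by_cases hy : y ∈ tsupport φ
    · have := hK x y
      rw [h0 x hx, zero_sub, abs_neg] at this
      rw [h0 x hx, zero_mul, zero_sub, abs_neg, abs_mul, abs_of_pos (hρ y)]
      have := mul_le_mul this ((hM' y hy).trans (le_abs_self M)) (hρ y).le (by positivity)
      linarith
    · rw [h0 x hx, h0 y hy]
      simp only [zero_mul, sub_zero, abs_zero]
      linarith

end IsNullConvex

section Measure

variable [MeasurableSpace E] [BorelSpace E] (μ : Measure E) [μ.IsAddHaarMeasure]

lemma integrable_prod_of_continuous {F : E × ℝ → ℝ} (hF : Continuous F) {R T : ℝ}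
    (h0 : ∀ x, ∀ t ∈ Icc 0 T, R < ‖x‖ → F (x, t) = 0) :
    Integrable F (μ.prod (volume.restrict (Ioc 0 T))) := by
  rw [← Measure.restrict_univ (μ := μ), Measure.prod_restrict]
  refine IntegrableOn.of_forall_sdiff_eq_zero (s := Metric.closedBall (0 : E) R ×ˢ Icc 0 T)
    (hF.continuousOn.integrableOn_compact ((isCompact_closedBall _ _).prod isCompact_Icc))
    (MeasurableSet.univ.prod measurableSet_Ioc) ?_
  rintro ⟨x, t⟩ ⟨⟨-, ht⟩, hn⟩
  refine h0 x t (Ioc_subset_Icc_self ht) ?_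
  by_contra! hx
  exact hn ⟨mem_closedBall_zero_iff.2 hx, Ioc_subset_Icc_self ht⟩

/-- The Laplacian of `level u ε`, as the divergence of its Lipschitz gradient `slope u ε`; it has
the junk value zero on the null set where the slope is not differentiable. -/
def levelLaplacian (u : E → ℝ) (ε : ℝ) (x : E) : ℝ :=
  LinearMap.trace ℝ E (fderiv ℝ (slope u ε) x)

omit [FiniteDimensional ℝ E] [MeasurableSpace E] [BorelSpace E] in
lemma lt_norm_flow {R t T : ℝ} {x p : E} (ht : t ∈ Icc 0 T) (hp : ‖p‖ ≤ 1) (hx : R + T < ‖x‖) :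
    R < ‖x + t • p‖ := by
  have h1 := norm_sub_le (x + t • p) (t • p)
  rw [add_sub_cancel_right, norm_smul, Real.norm_of_nonneg ht.1] at h1
  nlinarith [ht.1, ht.2, norm_nonneg p]

namespace IsNullConvex

variable {u : E → ℝ}

/-- The transport inequality at level `ε` and time `t`: the divergence theorem for the vector field
`rho • slope`, tested against `f` composed with the flow of `slope` at time `t`. The divergence of
`rho • slope` is the sum of `⟨∇rho, slope⟩`, which is the first term in `hB`, and of
`rho * levelLaplacian`; a fraction `θ` of the latter enters the bound `c`, and the rest is kept as
an integral against the cutoff `χ`. -/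
lemma neg_integral_rho_mul_le (hu : IsNullConvex u) {ε t T R : ℝ} (hε : 0 < ε) (ht : t ∈ Icc 0 T)
    {f : E → ℝ} (hf : ContDiff ℝ 1 f) (hR : tsupport f ⊆ Metric.closedBall 0 R) {F L : ℝ}
    (hf0 : ∀ x, 0 ≤ f x) (hF : ∀ x, f x ≤ F) (hL : ∀ x, ‖fderiv ℝ f x‖ ≤ L)
    {θ c : ℝ} (hθ : θ ≤ 1)
    (hB : ∀ x (Q : E →L[ℝ] E), HasFDerivAt (slope u ε) Q x →
      rho u ε x ^ 3 / ε ^ 2 * inner ℝ (slope u ε x) (Q (slope u ε x))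
        + θ * (rho u ε x * LinearMap.trace ℝ E Q) ≤ c)
    {χ : E → ℝ} {K : NNReal} (hχ : LipschitzWith K χ) (hχc : HasCompactSupport χ)
    (hχ0 : ∀ x, 0 ≤ χ x) (hχ1 : ∀ x, ‖x‖ ≤ R + T → χ x = 1) :
    -∫ x, rho u ε x * fderiv ℝ f (x + t • slope u ε x) (slope u ε x) ∂μ
      ≤ c * ∫ x, f (x + t • slope u ε x) ∂μ
        + ((1 - θ) * (F * ∫ x, χ x * rho u ε x * levelLaplacian u ε x ∂μ)
        + T * L * ∫ x in Metric.closedBall 0 (R + T), ε / rho u ε x ∂μ) := by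
  have hp := hu.lipschitzWith_slope hε
  have hpc := hu.continuous_slope hε
  have hρc := hu.continuous_rho hε
  have hρ := rho_pos u hε
  have hp1 : ∀ x, ‖slope u ε x‖ ≤ 1 := fun x => (norm_slope_lt_one u hε x).le
  have hfc : HasCompactSupport f :=
    (isCompact_closedBall (0 : E) R).of_isClosed_subset (isClosed_tsupport f) hR
  have hz : ∀ x, x ∉ Metric.closedBall (0 : E) (R + T) → x + t • slope u ε x ∉ tsupport f := by
    intro x hx hx'
    rw [mem_closedBall_zero_iff, not_le] at hx
    have := lt_norm_flow ht (hp1 x) hx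
    have := mem_closedBall_zero_iff.1 (hR hx')
    linarith
  have hz0 : ∀ x, x ∉ Metric.closedBall (0 : E) (R + T) → f (x + t • slope u ε x) = 0 :=
    fun x hx => image_eq_zero_of_notMem_tsupport (hz x hx)
  have hz1 : ∀ x, x ∉ Metric.closedBall (0 : E) (R + T) →
      fderiv ℝ f (x + t • slope u ε x) = 0 :=
    fun x hx => fderiv_of_notMem_tsupport ℝ (hz x hx)
  obtain ⟨K1, hK1⟩ := hf.lipschitzWith_of_hasCompactSupport hfc (by simp)
  have hψ := hK1.comp (LipschitzWith.id.add ((lipschitzWith_smul t).comp hp))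
  have hψc : HasCompactSupport (fun x => f (x + t • slope u ε x)) :=
    HasCompactSupport.intro (isCompact_closedBall (0 : E) (R + T)) hz0
  obtain ⟨C, hg⟩ := hu.exists_lipschitzWith_mul_rho hε hψ hψc
  have hgc : HasCompactSupport (fun x => f (x + t • slope u ε x) * rho u ε x) := hψc.mul_right
  obtain ⟨i1, i2, ibp⟩ := integral_mul_trace_fderiv μ hp hg hgc
  obtain ⟨C', hχρ⟩ := hu.exists_lipschitzWith_mul_rho hε hχ hχc
  obtain ⟨i3, -, -⟩ := integral_mul_trace_fderiv μ hp hχρ (hχc.mul_right)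
  simp only [Function.comp_apply, id] at i1 i2 ibp
  have i4 : Integrable (fun x => f (x + t • slope u ε x)) μ :=
    (hf.continuous.comp (by fun_prop)).integrable_of_hasCompactSupport hψc
  have i5 : Integrable ((Metric.closedBall (0 : E) (R + T)).indicator
      (fun x => ε / rho u ε x)) μ :=
    (integrable_indicator_iff Metric.isClosed_closedBall.measurableSet).2
      ((continuous_const.div hρc fun x => (hρ x).ne').continuousOn.integrableOn_compact
        (isCompact_closedBall _ _))
  have hD := hf.continuous_fderiv (by simp)
  have i6 : Integrable (fun x => rho u ε x * fderiv ℝ f (x + t • slope u ε x) (slope u ε x)) μ := by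
    refine Continuous.integrable_of_hasCompactSupport
      (hρc.mul ((hD.comp (by fun_prop)).clm_apply hpc)) ?_
    refine HasCompactSupport.intro (isCompact_closedBall (0 : E) (R + T)) fun x hx => ?_
    rw [hz1 x hx]; simp
  have hdiff := hp.ae_differentiableAt (μ := μ)
  have hT : 0 ≤ T := ht.1.trans ht.2
  have hL0 : 0 ≤ L := (norm_nonneg _).trans (hL 0)
  have hF0 : 0 ≤ F := (hf0 0).trans (hF 0)
  have pointwise : ∀ᵐ x ∂μ, -(rho u ε x * fderiv ℝ f (x + t • slope u ε x) (slope u ε x))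
      ≤ -(fderiv ℝ (fun x => f (x + t • slope u ε x) * rho u ε x) x (slope u ε x))
        - θ * (f (x + t • slope u ε x) * rho u ε x * levelLaplacian u ε x)
        + c * f (x + t • slope u ε x)
        + T * L * (Metric.closedBall (0 : E) (R + T)).indicator (fun x => ε / rho u ε x) x := by
    filter_upwards [hdiff] with x hx
    set p := slope u ε x with hpx
    have hQ := hx.hasFDerivAt
    set Q := fderiv ℝ (slope u ε) x with hQdef
    have hm : HasFDerivAt (fun y => y + t • slope u ε y) (ContinuousLinearMap.id ℝ E + t • Q) x :=
      (hasFDerivAt_id x).add (hQ.const_smul t)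
    have hfd : HasFDerivAt f (fderiv ℝ f (x + t • p)) (x + t • slope u ε x) :=
      (hf.differentiable (by simp) _).hasFDerivAt
    have hG := (hfd.comp x hm).mul (hasFDerivAt_rho hε hQ)
    have hG' : fderiv ℝ (fun x => f (x + t • slope u ε x) * rho u ε x) x p
        = f (x + t • p) * (rho u ε x ^ 3 / ε ^ 2 * inner ℝ p (Q p))
          + rho u ε x * (fderiv ℝ f (x + t • p) p + t * fderiv ℝ f (x + t • p) (Q p)) := by
      have : fderiv ℝ (fun x => f (x + t • slope u ε x) * rho u ε x) x = _ := hG.fderiv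
      rw [this]
      simp [hpx]
      ring
    have hB' := mul_le_mul_of_nonneg_left (hB x Q hQ) (hf0 (x + t • p))
    rw [hG', levelLaplacian, ← hQdef]
    have herr : t * (rho u ε x * fderiv ℝ f (x + t • p) (Q p))
        ≤ T * L * (Metric.closedBall (0 : E) (R + T)).indicator (fun x => ε / rho u ε x) x := by
      by_cases hxB : x ∈ Metric.closedBall (0 : E) (R + T)
      · rw [indicator_of_mem hxB]
        have e1 : fderiv ℝ f (x + t • p) (Q p) ≤ L * ‖Q p‖ :=
          (le_abs_self _).trans ((fderiv ℝ f (x + t • p)).le_of_opNorm_le (hL _) _)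
        have e2 := hu.norm_fderiv_slope_le hε hQ
        have hρx := hρ x
        calc t * (rho u ε x * fderiv ℝ f (x + t • p) (Q p))
            ≤ t * (rho u ε x * (L * ‖Q p‖)) := by have := ht.1; gcongr
          _ = t * L * (rho u ε x * ‖Q p‖) := by ring
          _ ≤ T * L * (ε / rho u ε x) := by
            have := ht.2
            gcongr
      · rw [indicator_of_notMem hxB, mul_zero, hz1 x hxB]; simp
    linarith
  have hmono := integral_mono_ae i6.neg
    (((i2.neg.sub (i1.const_mul θ)).add (i4.const_mul c)).add (i5.const_mul (T * L))) pointwise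
  have hsplit : ∫ x, (-(fderiv ℝ (fun x => f (x + t • slope u ε x) * rho u ε x) x (slope u ε x))
        - θ * (f (x + t • slope u ε x) * rho u ε x * levelLaplacian u ε x)
        + c * f (x + t • slope u ε x)
        + T * L * (Metric.closedBall (0 : E) (R + T)).indicator (fun x => ε / rho u ε x) x) ∂μ
      = (1 - θ) * ∫ x, f (x + t • slope u ε x) * rho u ε x * levelLaplacian u ε x ∂μ
        + c * ∫ x, f (x + t • slope u ε x) ∂μ
        + T * L * ∫ x in Metric.closedBall 0 (R + T), ε / rho u ε x ∂μ := by
    rw [← integral_indicator Metric.isClosed_closedBall.measurableSet]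
    have j1 := integral_add ((i2.neg.sub (i1.const_mul θ)).add (i4.const_mul c))
      (i5.const_mul (T * L))
    have j2 := integral_add (i2.neg.sub (i1.const_mul θ)) (i4.const_mul c)
    have j3 := integral_sub i2.neg (i1.const_mul θ)
    simp only [Pi.add_apply, Pi.sub_apply, Pi.neg_apply, integral_const_mul,
      integral_neg] at j1 j2 j3
    unfold levelLaplacian
    rw [j1, j2, j3, ← ibp]
    ring
  have hlap : ∫ x, f (x + t • slope u ε x) * rho u ε x * levelLaplacian u ε x ∂μ
      ≤ F * ∫ x, χ x * rho u ε x * levelLaplacian u ε x ∂μ := by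
    rw [← integral_const_mul]
    refine integral_mono_ae i1 (i3.const_mul F) ?_
    filter_upwards [hdiff] with x hx
    have htr : 0 ≤ rho u ε x * levelLaplacian u ε x :=
      mul_nonneg (hρ x).le (hu.trace_nonneg hε hx.hasFDerivAt)
    have : f (x + t • slope u ε x) ≤ F * χ x := by
      by_cases hxB : x ∈ Metric.closedBall (0 : E) (R + T)
      · rw [hχ1 x (mem_closedBall_zero_iff.1 hxB), mul_one]; exact hF _
      · rw [hz0 x hxB]; exact mul_nonneg hF0 (hχ0 x)
    have := mul_le_mul_of_nonneg_right this htr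
    change f (x + t • slope u ε x) * rho u ε x * levelLaplacian u ε x
      ≤ F * (χ x * rho u ε x * levelLaplacian u ε x)
    linarith
  have hneg := integral_neg (μ := μ)
    fun x => rho u ε x * fderiv ℝ f (x + t • slope u ε x) (slope u ε x)
  rw [← hneg]
  have hl := mul_le_mul_of_nonneg_left hlap (sub_nonneg.2 hθ)
  refine (hmono.trans_eq hsplit).trans ?_
  linarith

end IsNullConvex

end Measure

end Transport

/-! ### The transport inequality in the limit -/

section TransportLimit

variable {E : Type*} [NormedAddCommGroup E] [InnerProductSpace ℝ E] [FiniteDimensional ℝ E]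
variable [MeasurableSpace E] [BorelSpace E] (μ : Measure E) [μ.IsAddHaarMeasure]

namespace IsNullConvex

variable {u : E → ℝ}

/-- The transport inequality at level `ε`, integrated over the times in `[0, T]`. -/
lemma integral_rho_mul_sub_le (hu : IsNullConvex u) {ε T R : ℝ} (hε : 0 < ε) (hT : 0 ≤ T)
    {f : E → ℝ} (hf : ContDiff ℝ 1 f) (hR : tsupport f ⊆ Metric.closedBall 0 R) {F L : ℝ}
    (hf0 : ∀ x, 0 ≤ f x) (hF : ∀ x, f x ≤ F) (hL : ∀ x, ‖fderiv ℝ f x‖ ≤ L)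
    {θ c : ℝ} (hθ : θ ≤ 1)
    (hB : ∀ x (Q : E →L[ℝ] E), HasFDerivAt (slope u ε) Q x →
      rho u ε x ^ 3 / ε ^ 2 * inner ℝ (slope u ε x) (Q (slope u ε x))
        + θ * (rho u ε x * LinearMap.trace ℝ E Q) ≤ c)
    {χ : E → ℝ} {K : NNReal} (hχ : LipschitzWith K χ) (hχc : HasCompactSupport χ)
    (hχ0 : ∀ x, 0 ≤ χ x) (hχ1 : ∀ x, ‖x‖ ≤ R + T → χ x = 1) :
    ∫ x, rho u ε x * (f x - f (x + T • slope u ε x)) ∂μ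
      ≤ c * ∫ z : E × ℝ, f (z.1 + z.2 • slope u ε z.1) ∂(μ.prod (volume.restrict (Ioc 0 T)))
        + T * ((1 - θ) * (F * ∫ x, χ x * rho u ε x * levelLaplacian u ε x ∂μ)
        + T * L * ∫ x in Metric.closedBall 0 (R + T), ε / rho u ε x ∂μ) := by
  have hpc := hu.continuous_slope hε
  have hρc := hu.continuous_rho hε
  have hD := hf.continuous_fderiv (by simp)
  have hfc := hf.continuous
  have hz : ∀ x, ∀ t ∈ Icc 0 T, R + T < ‖x‖ → x + t • slope u ε x ∉ tsupport f := by
    intro x t ht hx hx'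
    have := lt_norm_flow ht (norm_slope_lt_one u hε x).le hx
    have := mem_closedBall_zero_iff.1 (hR hx')
    linarith
  have i1 := integrable_prod_of_continuous μ
    (F := fun z : E × ℝ => rho u ε z.1 * fderiv ℝ f (z.1 + z.2 • slope u ε z.1) (slope u ε z.1))
    ((hρc.comp continuous_fst).mul ((hD.comp (by fun_prop)).clm_apply (by fun_prop)))
    (R := R + T) (T := T) (fun x t ht hx => by
      rw [fderiv_of_notMem_tsupport ℝ (hz x t ht hx)]; simp)
  have i2 := integrable_prod_of_continuous μ
    (F := fun z : E × ℝ => f (z.1 + z.2 • slope u ε z.1)) (by fun_prop)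
    (R := R + T) (T := T) (fun x t ht hx => image_eq_zero_of_notMem_tsupport (hz x t ht hx))
  set κ := (1 - θ) * (F * ∫ x, χ x * rho u ε x * levelLaplacian u ε x ∂μ)
        + T * L * ∫ x in Metric.closedBall 0 (R + T), ε / rho u ε x ∂μ with hκ
  have ftc : ∀ x, rho u ε x * (f x - f (x + T • slope u ε x))
      = -∫ t in Ioc 0 T, rho u ε x * fderiv ℝ f (x + t • slope u ε x) (slope u ε x) := by
    intro x
    rw [integral_const_mul, ← intervalIntegral.integral_of_le hT]
    have hd : ∀ t ∈ uIcc 0 T, HasDerivAt (fun t : ℝ => f (x + t • slope u ε x))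
        (fderiv ℝ f (x + t • slope u ε x) (slope u ε x)) t := by
      intro t _
      have h1 : HasDerivAt (fun t : ℝ => x + t • slope u ε x) (slope u ε x) t := by
        simpa using ((hasDerivAt_id t).smul_const (slope u ε x)).const_add x
      exact ((hf.differentiable (by simp) _).hasFDerivAt).comp_hasDerivAt t h1
    rw [intervalIntegral.integral_eq_sub_of_hasDerivAt hd
      (((hD.comp (by fun_prop)).clm_apply continuous_const).intervalIntegrable _ _)]
    simp only [zero_smul, add_zero]
    ring
  have i3 : Integrable (fun t : ℝ => ∫ x, f (x + t • slope u ε x) ∂μ)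
      (volume.restrict (Ioc 0 T)) := i2.swap.integral_prod_left
  have i4 : Integrable (fun t : ℝ =>
      ∫ x, rho u ε x * fderiv ℝ f (x + t • slope u ε x) (slope u ε x) ∂μ)
      (volume.restrict (Ioc 0 T)) := i1.swap.integral_prod_left
  calc ∫ x, rho u ε x * (f x - f (x + T • slope u ε x)) ∂μ
      = -∫ x, (∫ t : ℝ in Ioc 0 T,
          rho u ε x * fderiv ℝ f (x + t • slope u ε x) (slope u ε x)) ∂μ := by
        simp_rw [ftc, integral_neg]
    _ = ∫ t : ℝ in Ioc 0 T,
          -∫ x, rho u ε x * fderiv ℝ f (x + t • slope u ε x) (slope u ε x) ∂μ := by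
        rw [integral_integral_swap i1, integral_neg]
    _ ≤ ∫ t : ℝ in Ioc 0 T, (c * ∫ x, f (x + t • slope u ε x) ∂μ + κ) := by
        refine integral_mono_ae i4.neg
          ((i3.const_mul c).add (integrable_const κ)) ?_
        filter_upwards [ae_restrict_mem measurableSet_Ioc] with t ht
        exact hu.neg_integral_rho_mul_le μ hε (Ioc_subset_Icc_self ht) hf hR hf0 hF hL hθ hB hχ hχc
          hχ0 hχ1
    _ = _ := by
        rw [integral_add (i3.const_mul c) (integrable_const κ),
          integral_const_mul, integral_prod_symm _ i2]
        simp [hT]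

/-- The transport inequality in the limit `ε → 0`: if the divergence of `rho • slope` is at most
`c`, up to the part `(1 - θ) * rho * levelLaplacian`, which is required to vanish in the limit, then
the intensity integrates to at most `c` times the time spent by the gradient flow, both weighted by
the test function. -/
lemma integral_mul_rayLength_le (hu : IsNullConvex u) {T R : ℝ} (hT : 0 ≤ T)
    (hRT : ∀ x, ‖x‖ ≤ R → rayLength u x < T)
    {f : E → ℝ} (hf : ContDiff ℝ 1 f) (hR : tsupport f ⊆ Metric.closedBall 0 R)
    (hf0 : ∀ x, 0 ≤ f x) {θ c : ℝ} (hθ : θ ≤ 1)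
    (hB : ∀ ε > 0, ∀ x (Q : E →L[ℝ] E), HasFDerivAt (slope u ε) Q x →
      rho u ε x ^ 3 / ε ^ 2 * inner ℝ (slope u ε x) (Q (slope u ε x))
        + θ * (rho u ε x * LinearMap.trace ℝ E Q) ≤ c)
    {χ : E → ℝ} {K : NNReal} (hχ : LipschitzWith K χ) (hχc : HasCompactSupport χ)
    (hχ0 : ∀ x, 0 ≤ χ x) (hχ1 : ∀ x, ‖x‖ ≤ R + T → χ x = 1)
    (hlap : Tendsto (fun ε => (1 - θ) * ∫ x, χ x * rho u ε x * levelLaplacian u ε x ∂μ)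
      (𝓝[>] 0) (𝓝 0)) :
    ∫ x, f x * rayLength u x ∂μ
      ≤ c * ∫ z : E × ℝ, f (z.1 + z.2 • gradient u z.1) ∂(μ.prod (volume.restrict (Ioc 0 T))) := by
  have hfc : HasCompactSupport f :=
    (isCompact_closedBall (0 : E) R).of_isClosed_subset (isClosed_tsupport f) hR
  obtain ⟨F, hF⟩ := hfc.exists_bound_of_continuous hf.continuous
  obtain ⟨L, hL⟩ := (hfc.fderiv (𝕜 := ℝ)).exists_bound_of_continuous
    (hf.continuous_fderiv (by simp))
  have hF' : ∀ x, f x ≤ F := fun x => (le_abs_self _).trans (hF x)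
  have hF0 : 0 ≤ F := (norm_nonneg _).trans (hF 0)
  obtain ⟨M, hM0, hM⟩ := hu.exists_rho_le (R + T)
  have hgrad := hu.ae_hasGradientAt μ
  have hz : ∀ ε > 0, ∀ x, ∀ t ∈ Icc 0 T, R + T < ‖x‖ → f (x + t • slope u ε x) = 0 := by
    intro ε hε x t ht hx
    refine image_eq_zero_of_notMem_tsupport fun hx' => ?_
    have := lt_norm_flow ht (norm_slope_lt_one u hε x).le hx
    have := mem_closedBall_zero_iff.1 (hR hx')
    linarith
  have small : ∀ᶠ ε in 𝓝[>] (0 : ℝ), ε ∈ Ioc (0 : ℝ) 1 := Ioc_mem_nhdsGT zero_lt_one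
  -- the boundary term at time `T` disappears in the limit, as the flow has left the support of `f`
  have l1 : Tendsto (fun ε => ∫ x, rho u ε x * (f x - f (x + T • slope u ε x)) ∂μ) (𝓝[>] 0)
      (𝓝 (∫ x, f x * rayLength u x ∂μ)) := by
    refine tendsto_integral_filter_of_dominated_convergence
      ((Metric.closedBall (0 : E) (R + T)).indicator fun _ => M * (2 * F)) ?_ ?_ ?_ ?_
    · filter_upwards [small] with ε hε
      have h1 := hu.continuous_rho hε.1
      have h2 := hu.continuous_slope hε.1
      have h3 := hf.continuous
      exact (h1.mul (h3.sub (h3.comp (by fun_prop)))).aestronglyMeasurable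
    · filter_upwards [small] with ε hε
      refine Eventually.of_forall fun x => ?_
      by_cases hx : x ∈ Metric.closedBall (0 : E) (R + T)
      · rw [indicator_of_mem hx, norm_mul, Real.norm_of_nonneg (rho_pos u hε.1 x).le]
        refine mul_le_mul (hM ε hε x (mem_closedBall_zero_iff.1 hx)) ?_ (norm_nonneg _) hM0.le
        refine (norm_sub_le _ _).trans ?_
        linarith [hF x, hF (x + T • slope u ε x)]
      · rw [indicator_of_notMem hx]
        rw [mem_closedBall_zero_iff, not_le] at hx
        have h0 : f x = 0 := by
          refine image_eq_zero_of_notMem_tsupport fun hx' => ?_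
          have := mem_closedBall_zero_iff.1 (hR hx')
          linarith
        rw [hz ε hε.1 x T ⟨hT, le_rfl⟩ hx, h0]; simp
    · exact (integrable_indicator_iff Metric.isClosed_closedBall.measurableSet).2
        (integrableOn_const (isCompact_closedBall _ _).measure_lt_top.ne)
    · filter_upwards [hgrad] with x hx
      have h1 := hu.tendsto_rho x
      have h2 := hu.tendsto_slope hx
      have h3 : Tendsto (fun ε => f (x + T • slope u ε x)) (𝓝[>] 0)
          (𝓝 (f (x + T • gradient u x))) :=
        (hf.continuous.tendsto _).comp ((h2.const_smul T).const_add x)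
      have h4 : f (x + T • gradient u x) = 0 := by
        refine image_eq_zero_of_notMem_tsupport fun hx' => ?_
        have := hRT _ (mem_closedBall_zero_iff.1 (hR hx'))
        have := hu.le_rayLength_add hx hT
        linarith
      rw [h4] at h3
      have h5 := h1.mul (h3.const_sub (f x))
      rwa [sub_zero, mul_comm] at h5
  have l2 : Tendsto (fun ε => ∫ z : E × ℝ, f (z.1 + z.2 • slope u ε z.1)
        ∂(μ.prod (volume.restrict (Ioc 0 T)))) (𝓝[>] 0)
      (𝓝 (∫ z : E × ℝ, f (z.1 + z.2 • gradient u z.1) ∂(μ.prod (volume.restrict (Ioc 0 T))))) := by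
    have hmem : ∀ᵐ z : E × ℝ ∂(μ.prod (volume.restrict (Ioc 0 T))), z.2 ∈ Ioc 0 T :=
      Measure.quasiMeasurePreserving_snd.ae (ae_restrict_mem measurableSet_Ioc)
    refine tendsto_integral_filter_of_dominated_convergence
      ((Metric.closedBall (0 : E) (R + T) ×ˢ (univ : Set ℝ)).indicator fun _ => F) ?_ ?_ ?_ ?_
    · filter_upwards [small] with ε hε
      have h2 := hu.continuous_slope hε.1
      have h3 := hf.continuous
      exact (h3.comp (by fun_prop)).aestronglyMeasurable
    · filter_upwards [small] with ε hε
      filter_upwards [hmem] with z hzT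
      by_cases hx : z.1 ∈ Metric.closedBall (0 : E) (R + T)
      · rw [indicator_of_mem (by exact ⟨hx, mem_univ _⟩)]; exact hF _
      · rw [indicator_of_notMem (fun h => hx h.1)]
        rw [mem_closedBall_zero_iff, not_le] at hx
        rw [hz ε hε.1 z.1 z.2 (Ioc_subset_Icc_self hzT) hx]; simp
    · refine (integrable_indicator_iff
        (Metric.isClosed_closedBall.measurableSet.prod MeasurableSet.univ)).2
        (integrableOn_const ?_)
      rw [Measure.prod_prod]
      refine ENNReal.mul_ne_top (isCompact_closedBall _ _).measure_lt_top.ne ?_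
      simp
    · filter_upwards [Measure.quasiMeasurePreserving_fst.ae hgrad] with z hzg
      exact (hf.continuous.tendsto _).comp (((hu.tendsto_slope hzg).const_smul z.2).const_add z.1)
  -- the error term vanishes because `ε / rho = √(1 - |slope|²)` and the gradient has norm one
  have l3 : Tendsto (fun ε => ∫ x in Metric.closedBall 0 (R + T), ε / rho u ε x ∂μ) (𝓝[>] 0)
      (𝓝 0) := by
    suffices h : Tendsto (fun ε => ∫ x in Metric.closedBall 0 (R + T), ε / rho u ε x ∂μ) (𝓝[>] 0)
        (𝓝 (∫ x in Metric.closedBall (0 : E) (R + T), (0 : ℝ) ∂μ)) by simpa using h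
    refine tendsto_integral_filter_of_dominated_convergence (fun _ => 1) ?_ ?_ ?_ ?_
    · filter_upwards [small] with ε hε
      exact (continuous_const.div (hu.continuous_rho hε.1)
        fun x => (rho_pos u hε.1 x).ne').aestronglyMeasurable
    · filter_upwards [small] with ε hε
      refine Eventually.of_forall fun x => ?_
      have := rho_pos u hε.1 x
      rw [Real.norm_of_nonneg (div_nonneg hε.1.le this.le), div_le_one this]
      exact le_rho u ε x
    · exact integrableOn_const (isCompact_closedBall _ _).measure_lt_top.ne
    · refine ae_restrict_of_ae ?_
      filter_upwards [hgrad] with x hx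
      have h2 : Tendsto (fun ε => √(1 - ‖slope u ε x‖ ^ 2)) (𝓝[>] 0)
          (𝓝 (√(1 - ‖gradient u x‖ ^ 2))) :=
        ((((hu.tendsto_slope hx).norm).pow 2).const_sub 1).sqrt
      rw [hu.norm_gradient hx] at h2
      norm_num at h2
      refine h2.congr' ?_
      filter_upwards [small] with ε hε
      have h3 := norm_slope_lt_one u hε.1 x
      have h4 : 0 < 1 - ‖slope u ε x‖ ^ 2 := by nlinarith [norm_nonneg (slope u ε x)]
      rw [rho_eq u hε.1, div_div_cancel₀ hε.1.ne']
  have l4 : Tendsto (fun ε =>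
      c * ∫ z : E × ℝ, f (z.1 + z.2 • slope u ε z.1) ∂(μ.prod (volume.restrict (Ioc 0 T)))
        + T * ((1 - θ) * (F * ∫ x, χ x * rho u ε x * levelLaplacian u ε x ∂μ)
        + T * L * ∫ x in Metric.closedBall 0 (R + T), ε / rho u ε x ∂μ)) (𝓝[>] 0)
      (𝓝 (c * ∫ z : E × ℝ, f (z.1 + z.2 • gradient u z.1) ∂(μ.prod (volume.restrict (Ioc 0 T)))
        + T * (F * 0 + T * L * 0))) := by
    refine (l2.const_mul c).add (((?_ : Tendsto _ _ _).add (l3.const_mul (T * L))).const_mul T)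
    refine (hlap.const_mul F).congr fun ε => by ring
  have := le_of_tendsto_of_tendsto l1 l4 (by
    filter_upwards [small] with ε hε
    exact hu.integral_rho_mul_sub_le μ hε.1 hT hf hR hf0 hF' hL hθ (hB ε hε.1) hχ hχc hχ0 hχ1)
  simpa using this

end IsNullConvex

end TransportLimit

/-! ### The time spent by the gradient flow -/

section FlowMeasure

variable {E : Type*} [NormedAddCommGroup E] [InnerProductSpace ℝ E] [FiniteDimensional ℝ E]
variable [MeasurableSpace E] [BorelSpace E] (μ : Measure E) [μ.IsAddHaarMeasure]

/-- The image of `μ × dt` under the gradient flow `(x, t) ↦ x + t ∇u(x)`, `t > 0`: it measures how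
long flow lines stay in a given set. -/
def flowMeasure (u : E → ℝ) : Measure E :=
  Measure.map (fun z : E × ℝ => z.1 + z.2 • gradient u z.1) (μ.prod (volume.restrict (Ioi 0)))

/-- The measure with density `rayLength u`. -/
def rayMeasure (u : E → ℝ) : Measure E := μ.withDensity fun x => ENNReal.ofReal (rayLength u x)

lemma measurable_gradient (u : E → ℝ) : Measurable (gradient u) :=
  (InnerProductSpace.toDual ℝ E).symm.continuous.measurable.comp (measurable_fderiv ℝ u)

lemma measurable_flow (u : E → ℝ) :
    Measurable (fun z : E × ℝ => z.1 + z.2 • gradient u z.1) :=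
  measurable_fst.add (measurable_snd.smul ((measurable_gradient u).comp measurable_fst))

/-- Short maps do not increase Haar measure. -/
lemma measure_image_le_of_lipschitzOnWith_one {g : E → E} {s : Set E} (hg : LipschitzOnWith 1 g s) :
    μ (g '' s) ≤ μ s := by
  rw [Measure.isAddLeftInvariant_eq_smul μ (Measure.hausdorffMeasure (Module.finrank ℝ E))]
  simp only [Measure.smul_apply]
  have := hg.hausdorffMeasure_image_le (d := Module.finrank ℝ E) (by positivity)
  simp only [ENNReal.coe_one, ENNReal.one_rpow, one_mul] at this
  gcongr

omit [MeasurableSpace E] [BorelSpace E] in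
lemma exists_cutoff (R : ℝ) : ∃ χ : E → ℝ, ContDiff ℝ ∞ χ ∧ HasCompactSupport χ ∧
    (∀ x, 0 ≤ χ x) ∧ (∀ x, χ x ≤ 1) ∧ (∀ x, ‖x‖ ≤ R → χ x = 1) ∧
    tsupport χ ⊆ Metric.closedBall 0 (max R 0 + 2) := by
  let b : ContDiffBump (0 : E) := ⟨max R 0 + 1, max R 0 + 2, by positivity, by linarith⟩
  refine ⟨b, b.contDiff, b.hasCompactSupport, fun x => b.nonneg, fun x => b.le_one, fun x hx => ?_,
    b.tsupport_eq.subset⟩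
  refine b.one_of_mem_closedBall (mem_closedBall_zero_iff.2 ?_)
  change ‖x‖ ≤ max R 0 + 1
  linarith [le_max_left R 0]

namespace IsNullConvex

variable {u : E → ℝ}

/-- The flow at time `t` is injective with a short inverse, and its values are end points of light
rays of length at least `t`. -/
lemma measure_flow_preimage_le (hu : IsNullConvex u) {t : ℝ} (ht : 0 ≤ t) (A : Set E) :
    μ {x | x + t • gradient u x ∈ A} ≤ μ (A ∩ {x | t ≤ rayLength u x}) := by
  set Φ : E → E := fun x => x + t • gradient u x
  set B : Set E := {x | HasGradientAt u (gradient u x) x ∧ Φ x ∈ A}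
  have h1 : μ {x | x + t • gradient u x ∈ A} ≤ μ B := by
    refine measure_mono_ae ?_
    filter_upwards [hu.ae_hasGradientAt μ] with x hx hxA using ⟨hx, hxA⟩
  have hexp : ∀ x ∈ B, ∀ y ∈ B, ‖x - y‖ ≤ ‖Φ x - Φ y‖ :=
    fun x hx y hy => hu.norm_sub_le_flow hx.1 hy.1 ht
  have hinj : InjOn Φ B := fun x hx y hy hxy => by
    have := hexp x hx y hy
    rw [hxy, sub_self, norm_zero, norm_le_zero_iff, sub_eq_zero] at this
    exact this
  set g := Function.invFunOn Φ B
  have hgΦ : ∀ x ∈ B, g (Φ x) = x := fun x hx => hinj.leftInvOn_invFunOn hx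
  have hg : LipschitzOnWith 1 g (Φ '' B) := by
    refine LipschitzOnWith.of_dist_le_mul ?_
    rintro _ ⟨x, hx, rfl⟩ _ ⟨y, hy, rfl⟩
    rw [hgΦ x hx, hgΦ y hy, NNReal.coe_one, one_mul, dist_eq_norm, dist_eq_norm]
    exact hexp x hx y hy
  have h2 : B = g '' (Φ '' B) := by
    rw [image_image]
    ext x
    refine ⟨fun hx => ⟨x, hx, hgΦ x hx⟩, ?_⟩
    rintro ⟨y, hy, rfl⟩
    change g (Φ y) ∈ B
    rwa [hgΦ y hy]
  have h3 : Φ '' B ⊆ A ∩ {x | t ≤ rayLength u x} := by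
    rintro _ ⟨x, hx, rfl⟩
    exact ⟨hx.2, hu.le_rayLength_add hx.1 ht⟩
  calc μ {x | x + t • gradient u x ∈ A} ≤ μ B := h1
    _ = μ (g '' (Φ '' B)) := by rw [← h2]
    _ ≤ μ (Φ '' B) := measure_image_le_of_lipschitzOnWith_one μ hg
    _ ≤ _ := measure_mono h3

/-- Since the gradient flow is expanding and moves points along light rays, it spends at most the
time `rayLength` near a point. -/
lemma flowMeasure_le_rayMeasure (hu : IsNullConvex u) : flowMeasure μ u ≤ rayMeasure μ u := by
  refine Measure.le_iff.2 fun A hA => ?_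
  rw [flowMeasure, Measure.map_apply (measurable_flow u) hA,
    Measure.prod_apply_symm (measurable_flow u hA), rayMeasure, withDensity_apply _ hA,
    lintegral_eq_lintegral_meas_le _ (Eventually.of_forall hu.rayLength_nonneg)
      hu.measurable_rayLength.aemeasurable]
  refine setLIntegral_mono' measurableSet_Ioi fun t ht => ?_
  have hm : MeasurableSet {x | t ≤ rayLength u x} :=
    measurableSet_le measurable_const hu.measurable_rayLength
  rw [Measure.restrict_apply hm, inter_comm]
  exact hu.measure_flow_preimage_le μ (le_of_lt ht) A

lemma isLocallyFiniteMeasure_rayMeasure (hu : IsNullConvex u) :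
    IsLocallyFiniteMeasure (rayMeasure μ u) := by
  refine ⟨fun x => ⟨Metric.ball x 1, Metric.ball_mem_nhds x one_pos, ?_⟩⟩
  obtain ⟨M, -, hM⟩ := hu.exists_rayLength_le (‖x‖ + 1)
  rw [rayMeasure, withDensity_apply _ measurableSet_ball]
  have h1 : ∫⁻ y in Metric.ball x 1, ENNReal.ofReal (rayLength u y) ∂μ
      ≤ ∫⁻ _ in Metric.ball x 1, ENNReal.ofReal M ∂μ := by
    refine setLIntegral_mono' measurableSet_ball fun y hy => ENNReal.ofReal_le_ofReal (hM y ?_)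
    have h1 := norm_le_norm_add_norm_sub' y x
    have h2 := mem_ball_iff_norm.1 hy
    linarith
  refine h1.trans_lt ?_
  rw [setLIntegral_const]
  exact ENNReal.mul_lt_top ENNReal.ofReal_lt_top measure_ball_lt_top

lemma isLocallyFiniteMeasure_flowMeasure (hu : IsNullConvex u) :
    IsLocallyFiniteMeasure (flowMeasure μ u) :=
  have := hu.isLocallyFiniteMeasure_rayMeasure μ
  Measure.isLocallyFiniteMeasure_of_le (hu.flowMeasure_le_rayMeasure μ)

/-- Smooth test functions suffice for the comparison of the two measures, by outer and inner
regularity. -/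
lemma rayMeasure_le_smul_flowMeasure (hu : IsNullConvex u) (c : NNReal)
    (h : ∀ f : E → ℝ, ContDiff ℝ ∞ f → HasCompactSupport f → (∀ x, 0 ≤ f x) → ∃ T : ℝ,
      ∫ x, f x * rayLength u x ∂μ ≤ c * ∫ z : E × ℝ, f (z.1 + z.2 • gradient u z.1)
        ∂(μ.prod (volume.restrict (Ioc 0 T)))) :
    rayMeasure μ u ≤ c • flowMeasure μ u := by
  have := hu.isLocallyFiniteMeasure_rayMeasure μ
  have := hu.isLocallyFiniteMeasure_flowMeasure μ
  have smooth : ∀ f : E → ℝ, ContDiff ℝ ∞ f → HasCompactSupport f → (∀ x, 0 ≤ f x) →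
      ∫⁻ x, ENNReal.ofReal (f x) ∂(rayMeasure μ u)
        ≤ c * ∫⁻ x, ENNReal.ofReal (f x) ∂(flowMeasure μ u) := by
    intro f hf hfc hf0
    obtain ⟨T, hT⟩ := h f hf hfc hf0
    have hfm : Measurable fun x => ENNReal.ofReal (f x) :=
      hf.continuous.measurable.ennreal_ofReal
    have hint : Integrable (fun x => f x * rayLength u x) μ := by
      obtain ⟨R, hR⟩ := hfc.isBounded.subset_closedBall (0 : E)
      obtain ⟨M, -, hM⟩ := hu.exists_rayLength_le R
      refine Integrable.mono' ((hf.continuous.integrable_of_hasCompactSupport hfc).const_mul M)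
        (hf.continuous.measurable.mul hu.measurable_rayLength).aestronglyMeasurable
        (Eventually.of_forall fun x => ?_)
      rw [Real.norm_of_nonneg (mul_nonneg (hf0 x) (hu.rayLength_nonneg x)), mul_comm]
      by_cases hx : x ∈ tsupport f
      · exact mul_le_mul_of_nonneg_right (hM x (mem_closedBall_zero_iff.1 (hR hx))) (hf0 x)
      · rw [image_eq_zero_of_notMem_tsupport hx]; simp
    have e1 : ∫⁻ x, ENNReal.ofReal (f x) ∂(rayMeasure μ u)
        = ENNReal.ofReal (∫ x, f x * rayLength u x ∂μ) := by
      rw [rayMeasure, lintegral_withDensity_eq_lintegral_mul _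
        hu.measurable_rayLength.ennreal_ofReal hfm, ofReal_integral_eq_lintegral_ofReal hint
        (Eventually.of_forall fun x => mul_nonneg (hf0 x) (hu.rayLength_nonneg x))]
      refine lintegral_congr fun x => ?_
      rw [Pi.mul_apply, mul_comm, ENNReal.ofReal_mul (hf0 x)]
    have e2 : ∫⁻ x, ENNReal.ofReal (f x) ∂(flowMeasure μ u)
        = ∫⁻ z : E × ℝ, ENNReal.ofReal (f (z.1 + z.2 • gradient u z.1))
          ∂(μ.prod (volume.restrict (Ioi 0))) := by
      rw [flowMeasure, lintegral_map hfm (measurable_flow u)]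
    rw [e1, e2]
    refine (ENNReal.ofReal_le_ofReal hT).trans ?_
    rw [ENNReal.ofReal_mul c.coe_nonneg, ENNReal.ofReal_coe_nnreal]
    gcongr
    rw [integral_eq_lintegral_of_nonneg_ae (Eventually.of_forall fun z => hf0 _)
      (hf.continuous.measurable.comp (measurable_flow u)).aestronglyMeasurable]
    refine ENNReal.ofReal_toReal_le.trans (lintegral_mono' ?_ le_rfl)
    exact Measure.prod_mono le_rfl (Measure.restrict_mono Ioc_subset_Ioi_self le_rfl)
  have isOpen_le : ∀ U : Set E, IsOpen U → rayMeasure μ u U ≤ (c • flowMeasure μ u) U := by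
    intro U hU
    rw [hU.measure_eq_iSup_isCompact]
    refine iSup_le fun K => iSup_le fun hKU => iSup_le fun hK => ?_
    obtain ⟨R, hR⟩ := hK.isBounded.subset_ball (0 : E)
    obtain ⟨f, hf0, hf1, hf01⟩ := exists_contMDiffMap_zero_one_of_isClosed (n := ⊤)
      (modelWithCornersSelf ℝ E) (s := (U ∩ Metric.ball 0 R)ᶜ) (t := K)
      (hU.inter Metric.isOpen_ball).isClosed_compl hK.isClosed
      (disjoint_compl_left_iff_subset.2 (subset_inter hKU hR))
    have hfc : HasCompactSupport f :=
      HasCompactSupport.intro (isCompact_closedBall (0 : E) R) fun x hx =>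
        hf0 fun hx' => hx (Metric.ball_subset_closedBall hx'.2)
    have hs := smooth f f.contMDiff.contDiff hfc fun x => (hf01 x).1
    calc rayMeasure μ u K = ∫⁻ x, K.indicator 1 x ∂(rayMeasure μ u) := by
          rw [lintegral_indicator_one hK.measurableSet]
      _ ≤ ∫⁻ x, ENNReal.ofReal (f x) ∂(rayMeasure μ u) := by
          refine lintegral_mono fun x => ?_
          by_cases hx : x ∈ K
          · rw [hf1 hx]; simp [hx]
          · simp [hx]
      _ ≤ c * ∫⁻ x, ENNReal.ofReal (f x) ∂(flowMeasure μ u) := hs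
      _ ≤ c * ∫⁻ x, U.indicator 1 x ∂(flowMeasure μ u) := by
          gcongr with x
          by_cases hx : x ∈ U
          · simpa [hx] using (hf01 x).2
          · have : f x = 0 := hf0 fun hx' => hx hx'.1
            simp [this]
      _ = (c • flowMeasure μ u) U := by
          rw [lintegral_indicator_one hU.measurableSet]; rfl
  have : IsLocallyFiniteMeasure (c • flowMeasure μ u) := inferInstance
  refine Measure.le_iff.2 fun A _ => ?_
  rw [A.measure_eq_iInf_isOpen (c • flowMeasure μ u)]
  exact le_iInf fun U => le_iInf fun hAU => le_iInf fun hU =>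
    (measure_mono hAU).trans (isOpen_le U hU)

/-- The transport inequality as an inequality of measures. -/
lemma rayMeasure_le_of_divergence_le (hu : IsNullConvex u) {θ : ℝ} (hθ : θ ≤ 1) (c : NNReal)
    (hB : ∀ ε > 0, ∀ x (Q : E →L[ℝ] E), HasFDerivAt (slope u ε) Q x →
      rho u ε x ^ 3 / ε ^ 2 * inner ℝ (slope u ε x) (Q (slope u ε x))
        + θ * (rho u ε x * LinearMap.trace ℝ E Q) ≤ c)
    (hlap : ∀ χ : E → ℝ, ContDiff ℝ ∞ χ → HasCompactSupport χ → (∀ x, 0 ≤ χ x) →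
      Tendsto (fun ε => (1 - θ) * ∫ x, χ x * rho u ε x * levelLaplacian u ε x ∂μ)
        (𝓝[>] 0) (𝓝 0)) :
    rayMeasure μ u ≤ c • flowMeasure μ u := by
  refine hu.rayMeasure_le_smul_flowMeasure μ c fun f hf hfc hf0 => ?_
  obtain ⟨R, hR⟩ := hfc.isBounded.subset_closedBall (0 : E)
  obtain ⟨M, hM0, hM⟩ := hu.exists_rayLength_le R
  obtain ⟨χ, h1, h2, h3, -, h5, -⟩ := exists_cutoff (E := E) (R + (M + 1))
  obtain ⟨K, hK⟩ := h1.lipschitzWith_of_hasCompactSupport h2 (by simp)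
  exact ⟨M + 1, hu.integral_mul_rayLength_le μ (by positivity)
    (fun x hx => (hM x hx).trans_lt (lt_add_one M)) (hf.of_le (by simp)) hR hf0 hθ hB hK h2 h3 h5
    (hlap χ h1 h2 h3)⟩

/-- In general the divergence of `rho • slope` is at most the dimension. -/
lemma rayMeasure_le_finrank_smul (hu : IsNullConvex u) :
    rayMeasure μ u ≤ (Module.finrank ℝ E : NNReal) • flowMeasure μ u := by
  refine hu.rayMeasure_le_of_divergence_le μ (θ := 1) le_rfl _ (fun ε hε x Q hQ => ?_) ?_
  · have h1 := hu.inner_fderiv_slope_le hε hQ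
    have h2 := hu.rho_mul_trace_le hε hQ
    rw [NNReal.coe_natCast]
    linarith
  · simp

/-- If the distributional Laplacian of `u` is carried by the set where no light ray starts, then
the Laplacians of the level functions, weighted by the intensity, vanish in the limit. -/
lemma tendsto_integral_rho_mul_levelLaplacian (hu : IsNullConvex u) (ν : Measure E)
    [IsLocallyFiniteMeasure ν]
    (hν : ∀ f : E → ℝ, ContDiff ℝ ∞ f → HasCompactSupport f →
      ∫ x, f x ∂ν = -∫ x, inner ℝ (gradient f x) (gradient u x) ∂μ)
    (hν0 : ∀ᵐ x ∂ν, rayLength u x = 0) {χ : E → ℝ} (hχ : ContDiff ℝ ∞ χ)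
    (hχc : HasCompactSupport χ) (hχ0 : ∀ x, 0 ≤ χ x) :
    Tendsto (fun ε => ∫ x, χ x * rho u ε x * levelLaplacian u ε x ∂μ) (𝓝[>] 0) (𝓝 0) := by
  have small : ∀ᶠ ε in 𝓝[>] (0 : ℝ), ε ∈ Ioc (0 : ℝ) 1 := Ioc_mem_nhdsGT zero_lt_one
  have tr_nonneg : ∀ ε > 0, ∀ᵐ x ∂μ, 0 ≤ levelLaplacian u ε x := fun ε hε => by
    filter_upwards [(hu.lipschitzWith_slope hε).ae_differentiableAt (μ := μ)] with x hx
    exact hu.trace_nonneg hε hx.hasFDerivAt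
  obtain ⟨K, hK⟩ := hχ.lipschitzWith_of_hasCompactSupport hχc (by simp)
  rw [tendsto_order]
  constructor
  · intro a ha
    filter_upwards [small] with ε hε
    refine ha.trans_le (integral_nonneg_of_ae ?_)
    filter_upwards [tr_nonneg ε hε.1] with x hx
    exact mul_nonneg (mul_nonneg (hχ0 x) (rho_pos u hε.1 x).le) hx
  intro δ hδ
  -- for small `ε₀` the weight `rho u ε₀` is small in mean for the Laplacian of `u`
  have l1 : Tendsto (fun ε => ∫ x, χ x * rho u ε x ∂ν) (𝓝[>] 0) (𝓝 0) := by
    suffices h : Tendsto (fun ε => ∫ x, χ x * rho u ε x ∂ν) (𝓝[>] 0)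
        (𝓝 (∫ x, (0 : ℝ) ∂ν)) by simpa using h
    refine tendsto_integral_filter_of_dominated_convergence (fun x => χ x * rho u 1 x) ?_ ?_ ?_ ?_
    · filter_upwards [small] with ε hε
      exact (hχ.continuous.mul (hu.continuous_rho hε.1)).aestronglyMeasurable
    · filter_upwards [small] with ε hε
      refine Eventually.of_forall fun x => ?_
      rw [Real.norm_of_nonneg (mul_nonneg (hχ0 x) (rho_pos u hε.1 x).le)]
      exact mul_le_mul_of_nonneg_left (hu.rho_mono hε.1 hε.2 x) (hχ0 x)
    · exact (hχ.continuous.mul (hu.continuous_rho one_pos)).integrable_of_hasCompactSupport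
        hχc.mul_right
    · filter_upwards [hν0] with x hx
      have := (hu.tendsto_rho x).const_mul (χ x)
      rwa [hx, mul_zero] at this
  obtain ⟨ε₀, hε₀δ, hε₀⟩ := ((l1.eventually_lt_const (half_pos hδ)).and small).exists
  have iχ : Integrable χ ν := hχ.continuous.integrable_of_hasCompactSupport hχc
  have iχ0 : 0 ≤ ∫ x, χ x ∂ν := integral_nonneg hχ0
  obtain ⟨η, hη, hη'⟩ : ∃ η > 0, 2 * η * ∫ x, χ x ∂ν < δ / 2 := by
    refine ⟨δ / (8 * (1 + ∫ x, χ x ∂ν)), by positivity, ?_⟩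
    rw [mul_comm, ← mul_assoc, ← mul_div_assoc, div_lt_iff₀ (by positivity)]
    nlinarith
  -- a smooth function slightly larger than `rho u ε₀`
  obtain ⟨g, hg, hgρ, -⟩ := (hu.continuous_rho hε₀.1).exists_contDiff_approx ⊤
    (ε := fun _ => η) continuous_const (fun _ => hη)
  have hg1 : ∀ x, rho u ε₀ x ≤ g x + η := fun x => by
    have := (abs_lt.1 (by simpa [Real.dist_eq] using hgρ x : |g x - rho u ε₀ x| < η)).1
    linarith
  have hg2 : ∀ x, g x + η ≤ rho u ε₀ x + 2 * η := fun x => by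
    have := (abs_lt.1 (by simpa [Real.dist_eq] using hgρ x : |g x - rho u ε₀ x| < η)).2
    linarith
  set h : E → ℝ := fun x => χ x * (g x + η) with hh
  have hhd : ContDiff ℝ ∞ h := hχ.mul (hg.add contDiff_const)
  have hhc : HasCompactSupport h := hχc.mul_right
  obtain ⟨C, hC⟩ := hhd.lipschitzWith_of_hasCompactSupport hhc (by simp)
  have hνh : ∫ x, h x ∂ν < δ := by
    have i1 : Integrable (fun x => χ x * rho u ε₀ x) ν :=
      (hχ.continuous.mul (hu.continuous_rho hε₀.1)).integrable_of_hasCompactSupport hχc.mul_right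
    have : ∫ x, h x ∂ν ≤ ∫ x, (χ x * rho u ε₀ x + 2 * η * χ x) ∂ν := by
      refine integral_mono (hhd.continuous.integrable_of_hasCompactSupport hhc)
        (i1.add (iχ.const_mul _)) fun x => ?_
      have := mul_le_mul_of_nonneg_left (hg2 x) (hχ0 x)
      simp only [hh]
      linarith
    rw [integral_add i1 (iχ.const_mul _), integral_const_mul] at this
    linarith
  have l2 : Tendsto (fun ε => ∫ x, h x * levelLaplacian u ε x ∂μ) (𝓝[>] 0) (𝓝 (∫ x, h x ∂ν)) := by
    have e : ∀ᶠ ε in 𝓝[>] (0 : ℝ), -∫ x, fderiv ℝ h x (slope u ε x) ∂μ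
        = ∫ x, h x * levelLaplacian u ε x ∂μ := by
      filter_upwards [small] with ε hε
      exact (integral_mul_trace_fderiv μ (hu.lipschitzWith_slope hε.1) hC hhc).2.2.symm
    refine Tendsto.congr' e ?_
    rw [hν h hhd hhc]
    refine Tendsto.neg ?_
    have hD := hhd.continuous_fderiv (by simp)
    refine tendsto_integral_filter_of_dominated_convergence (fun x => ‖fderiv ℝ h x‖) ?_ ?_ ?_ ?_
    · filter_upwards [small] with ε hε
      exact (hD.clm_apply (hu.continuous_slope hε.1)).aestronglyMeasurable
    · filter_upwards [small] with ε hε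
      refine Eventually.of_forall fun x => ?_
      refine ((fderiv ℝ h x).le_opNorm _).trans ?_
      exact mul_le_of_le_one_right (norm_nonneg _) (norm_slope_lt_one u hε.1 x).le
    · exact hD.norm.integrable_of_hasCompactSupport (hhc.fderiv (𝕜 := ℝ)).norm
    · filter_upwards [hu.ae_hasGradientAt μ] with x hx
      rw [inner_gradient_left]
      exact ((fderiv ℝ h x).continuous.tendsto _).comp (hu.tendsto_slope hx)
  filter_upwards [l2.eventually_lt_const hνh, Ioc_mem_nhdsGT hε₀.1] with ε hε hεε₀
  refine lt_of_le_of_lt ?_ hε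
  obtain ⟨C', hC'⟩ := hu.exists_lipschitzWith_mul_rho hεε₀.1 hK hχc
  have hp := hu.lipschitzWith_slope hεε₀.1
  refine integral_mono_ae (integral_mul_trace_fderiv μ hp hC' hχc.mul_right).1
    (integral_mul_trace_fderiv μ hp hC hhc).1 ?_
  filter_upwards [tr_nonneg ε hεε₀.1] with x hx
  refine mul_le_mul_of_nonneg_right (mul_le_mul_of_nonneg_left ?_ (hχ0 x)) hx
  exact (hu.rho_mono hεε₀.1 hεε₀.2 x).trans (hg1 x)

/-- For a flat boundary the intensity is exactly the density of the time spent by the flow: only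
the term `⟨∇rho, slope⟩ ≤ 1` of the divergence survives in the limit. -/
lemma flowMeasure_eq_rayMeasure (hu : IsNullConvex u) (ν : Measure E) [IsLocallyFiniteMeasure ν]
    (hν : ∀ f : E → ℝ, ContDiff ℝ ∞ f → HasCompactSupport f →
      ∫ x, f x ∂ν = -∫ x, inner ℝ (gradient f x) (gradient u x) ∂μ)
    (hν0 : ∀ᵐ x ∂ν, rayLength u x = 0) : flowMeasure μ u = rayMeasure μ u := by
  refine le_antisymm (hu.flowMeasure_le_rayMeasure μ) ?_
  have := hu.rayMeasure_le_of_divergence_le μ (θ := 0) zero_le_one 1 (fun ε hε x Q hQ => ?_)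
    (fun χ h1 h2 h3 => ?_)
  · rwa [one_smul] at this
  · have h1 := hu.inner_fderiv_slope_le hε hQ
    have h2 := norm_slope_lt_one u hε x
    rw [NNReal.coe_one]
    nlinarith [norm_nonneg (slope u ε x)]
  · simpa using hu.tendsto_integral_rho_mul_levelLaplacian μ ν hν hν0 h1 h2 h3

end IsNullConvex

end FlowMeasure

/-! ### Convergence of the flow measures -/

section Convergence

variable {E : Type*} [NormedAddCommGroup E] [InnerProductSpace ℝ E] [FiniteDimensional ℝ E]

/-- Pointwise convergence gives a uniform local bound for the lengths of light rays: a long ray of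
`U k` would violate the coercivity of `u`. -/
lemma eventually_rayLength_le {u : E → ℝ} {U : ℕ → E → ℝ} (hu : IsNullConvex u)
    (hU : ∀ k, IsNullConvex (U k)) (hlim : ∀ x, Tendsto (fun k => U k x) atTop (𝓝 (u x)))
    (R : ℝ) : ∃ M, ∀ᶠ k in atTop, ∀ x, ‖x‖ ≤ R → rayLength (U k) x ≤ M := by
  obtain ⟨κ, hκ, C, hC⟩ := hu.coercive
  set M := R + κ⁻¹ * (|C| + |u 0| + 2 * |R| + 6) + |R| + 1 with hM
  have hM1 : 1 ≤ M := by
    have : 0 ≤ R + |R| := by linarith [neg_abs_le R]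
    have : 0 ≤ κ⁻¹ * (|C| + |u 0| + 2 * |R| + 6) := by positivity
    linarith
  -- the convergence is uniform up to a constant on the ball of radius `R + M`
  obtain ⟨s, -, hs, hcover⟩ :=
    (isCompact_closedBall (0 : E) (R + M)).finite_cover_balls (e := 1) one_pos
  have hev : ∀ᶠ k in atTop, ∀ z ∈ s, |U k z - u z| < 1 := by
    rw [eventually_all_finite hs]
    intro z _
    have := (hlim z).eventually (Metric.ball_mem_nhds (u z) one_pos)
    simpa [Real.dist_eq] using this
  refine ⟨M, ?_⟩
  filter_upwards [hev] with k hk x hx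
  -- finitely many points control `U k` on a ball, since all functions are 1-Lipschitz
  have close : ∀ y, ‖y‖ ≤ R + M → |U k y - u y| ≤ 3 := by
    intro y hy
    obtain ⟨z, hz, hyz⟩ := mem_iUnion₂.1 (hcover (mem_closedBall_zero_iff.2 hy))
    have hyz := mem_ball_iff_norm.1 hyz
    have h1 := hk z hz
    have h2 := (hU k).sub_le y z
    have h3 := (hU k).sub_le z y
    have h4 := hu.sub_le y z
    have h5 := hu.sub_le z y
    rw [norm_sub_rev] at h3 h5
    rw [abs_lt] at h1
    rw [abs_le]
    constructor <;> linarith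
  obtain ⟨y, hy, hr⟩ := ((hU k).isGreatest_rayLength x).1
  set r := rayLength (U k) x
  by_contra! hMr
  have hr0 : 0 < r := by linarith
  -- the ray is cut at length `M`, which keeps it in the ball where `U k` is close to `u`
  set y₀ := x + (M / r) • (y - x) with hy₀
  have e1 : ‖x - y₀‖ = M := by
    rw [hy₀, sub_add_cancel_left, norm_neg, norm_smul, norm_sub_rev, hy,
      Real.norm_of_nonneg (by positivity), div_mul_cancel₀ _ hr0.ne']
  have h1 : U k y₀ + M ≤ U k x := by
    have h2 := (hU k).convex x (y - x) (θ := M / r) (by positivity)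
      ((div_le_one hr0).2 hMr.le)
    rw [add_sub_cancel] at h2
    have h3 : M / r * (U k y - U k x) ≤ M / r * (-r) := by
      have : 0 ≤ M / r := by positivity
      gcongr
      linarith
    have h4 : M / r * (-r) = -M := by field_simp
    linarith
  have hn1 : ‖y₀‖ ≤ R + M := by
    have := norm_le_norm_add_norm_sub' y₀ x
    rw [norm_sub_rev, e1] at this
    linarith
  have hn2 : M - R ≤ ‖y₀‖ := by
    have := norm_sub_le x y₀
    rw [e1] at this
    linarith
  have h2 := (abs_le.1 (close y₀ hn1)).1
  have h3 := (abs_le.1 (close x (by linarith))).2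
  have h4 := hC y₀
  have h5 := hu.sub_le x 0
  rw [sub_zero] at h5
  have h6 : κ * ‖y₀‖ ≤ |C| + |u 0| + 2 * |R| + 6 := by
    linarith [le_abs_self C, le_abs_self (u 0), le_abs_self R]
  have h7 : κ * (M - R) ≤ κ * ‖y₀‖ := by gcongr
  have h8 : κ * (M - R) = (|C| + |u 0| + 2 * |R| + 6) + κ * (|R| + 1) := by
    rw [hM]; field_simp; ring
  have : 0 < κ * (|R| + 1) := by positivity
  linarith

variable [MeasurableSpace E] [BorelSpace E] (μ : Measure E) [μ.IsAddHaarMeasure]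

/-- The measures `flowMeasure` depend continuously on `u`, in the vague topology, because the
gradients converge almost everywhere. -/
lemma tendsto_integral_flowMeasure {u : E → ℝ} {U : ℕ → E → ℝ} (hu : IsNullConvex u)
    (hU : ∀ k, IsNullConvex (U k)) (hlim : ∀ x, Tendsto (fun k => U k x) atTop (𝓝 (u x)))
    {f : E → ℝ} (hf : Continuous f) (hfc : HasCompactSupport f) :
    Tendsto (fun k => ∫ x, f x ∂(flowMeasure μ (U k))) atTop
      (𝓝 (∫ x, f x ∂(flowMeasure μ u))) := by
  obtain ⟨R, hR⟩ := hfc.isBounded.subset_closedBall (0 : E)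
  obtain ⟨F, hF⟩ := hfc.exists_bound_of_continuous hf
  obtain ⟨M, hM⟩ := eventually_rayLength_le hu hU hlim R
  have e : ∀ w : E → ℝ, ∫ x, f x ∂(flowMeasure μ w) = ∫ z : E × ℝ,
      f (z.1 + z.2 • gradient w z.1) ∂(μ.prod (volume.restrict (Ioi 0))) := fun w =>
    integral_map (measurable_flow w).aemeasurable hf.aestronglyMeasurable
  simp_rw [e]
  have hall : ∀ᵐ x ∂μ, ∀ k, HasGradientAt (U k) (gradient (U k) x) x :=
    ae_all_iff.2 fun k => (hU k).ae_hasGradientAt μ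
  have hall' := (Measure.quasiMeasurePreserving_fst (μ := μ)
    (ν := volume.restrict (Ioi (0 : ℝ)))).ae hall
  have hu' := (Measure.quasiMeasurePreserving_fst (μ := μ)
    (ν := volume.restrict (Ioi (0 : ℝ)))).ae (hu.ae_hasGradientAt μ)
  have hpos : ∀ᵐ z : E × ℝ ∂(μ.prod (volume.restrict (Ioi 0))), z.2 ∈ Ioi (0 : ℝ) :=
    Measure.quasiMeasurePreserving_snd.ae (ae_restrict_mem measurableSet_Ioi)
  refine tendsto_integral_filter_of_dominated_convergence
    ((Metric.closedBall (0 : E) (R + M) ×ˢ Iic M).indicator fun _ => F) ?_ ?_ ?_ ?_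
  · exact Eventually.of_forall fun k =>
      (hf.measurable.comp (measurable_flow (U k))).aestronglyMeasurable
  · filter_upwards [hM] with k hk
    filter_upwards [hall', hpos] with z hz ht
    have ht : 0 < z.2 := ht
    by_cases hx : z ∈ Metric.closedBall (0 : E) (R + M) ×ˢ Iic M
    · rw [indicator_of_mem hx]; exact hF _
    · rw [indicator_of_notMem hx]
      refine (norm_eq_zero.2 (image_eq_zero_of_notMem_tsupport fun hx' => hx ?_)).le
      -- a flow line meets the support of `f` at a time at most the length of a light ray there
      have h1 := mem_closedBall_zero_iff.1 (hR hx')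
      have h2 := ((hU k).le_rayLength_add (hz k) ht.le).trans (hk _ h1)
      refine ⟨mem_closedBall_zero_iff.2 ?_, h2⟩
      have h3 := norm_sub_le (z.1 + z.2 • gradient (U k) z.1) (z.2 • gradient (U k) z.1)
      rw [add_sub_cancel_right, norm_smul, (hU k).norm_gradient (hz k), mul_one,
        Real.norm_of_nonneg ht.le] at h3
      linarith
  · refine (integrable_indicator_iff
      (Metric.isClosed_closedBall.measurableSet.prod measurableSet_Iic)).2 (integrableOn_const ?_)
    rw [Measure.prod_prod]
    refine ENNReal.mul_ne_top (isCompact_closedBall _ _).measure_lt_top.ne ?_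
    rw [Measure.restrict_apply measurableSet_Iic, Iic_inter_Ioi]
    simp
  · filter_upwards [hall', hu'] with z hz hzu
    have h1 : Tendsto (fun k => gradient (U k) z.1) atTop (𝓝 (gradient u z.1)) :=
      tendsto_subgradient hzu hlim (Eventually.of_forall fun k => (hU k).le_of_hasGradientAt (hz k))
    exact (hf.tendsto _).comp ((h1.const_smul z.2).const_add z.1)

/-- The density of `flowMeasure` with respect to Haar measure. -/
def flowDensity (u : E → ℝ) (x : E) : ℝ := ((flowMeasure μ u).rnDeriv μ x).toReal

omit [BorelSpace E] [μ.IsAddHaarMeasure] in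
lemma measurable_flowDensity (u : E → ℝ) : Measurable (flowDensity μ u) :=
  (Measure.measurable_rnDeriv _ _).ennreal_toReal

omit [BorelSpace E] [μ.IsAddHaarMeasure] in
lemma flowDensity_nonneg (u : E → ℝ) (x : E) : 0 ≤ flowDensity μ u x := ENNReal.toReal_nonneg

lemma withDensity_rnDeriv_flowMeasure {u : E → ℝ} (hu : IsNullConvex u) :
    μ.withDensity ((flowMeasure μ u).rnDeriv μ) = flowMeasure μ u := by
  have := hu.isLocallyFiniteMeasure_flowMeasure μ
  exact Measure.withDensity_rnDeriv_eq _ _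
    ((Measure.absolutelyContinuous_of_le (hu.flowMeasure_le_rayMeasure μ)).trans
      (withDensity_absolutelyContinuous _ _))

lemma integral_flowMeasure {u : E → ℝ} (hu : IsNullConvex u) (f : E → ℝ) :
    ∫ x, f x ∂(flowMeasure μ u) = ∫ x, f x * flowDensity μ u x ∂μ := by
  have := hu.isLocallyFiniteMeasure_flowMeasure μ
  conv_lhs => rw [← withDensity_rnDeriv_flowMeasure μ hu]
  rw [integral_withDensity_eq_integral_toReal_smul (Measure.measurable_rnDeriv _ _)
    (Measure.rnDeriv_lt_top _ _)]
  simp_rw [smul_eq_mul, mul_comm]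
  rfl

omit [μ.IsAddHaarMeasure] in
lemma integral_rayMeasure {u : E → ℝ} (hu : IsNullConvex u) (f : E → ℝ) :
    ∫ x, f x ∂(rayMeasure μ u) = ∫ x, f x * rayLength u x ∂μ := by
  rw [rayMeasure, integral_withDensity_eq_integral_toReal_smul
    hu.measurable_rayLength.ennreal_ofReal (Eventually.of_forall fun _ => ENNReal.ofReal_lt_top)]
  refine integral_congr_ae (Eventually.of_forall fun x => ?_)
  simp only [smul_eq_mul]
  rw [ENNReal.toReal_ofReal (hu.rayLength_nonneg x), mul_comm]

/-- The two bounds for the flow measure, in terms of densities. -/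
lemma flowDensity_bounds {u : E → ℝ} (hu : IsNullConvex u) :
    ∀ᵐ x ∂μ, flowDensity μ u x ≤ rayLength u x ∧
      rayLength u x ≤ Module.finrank ℝ E * flowDensity μ u x := by
  have := hu.isLocallyFiniteMeasure_flowMeasure μ
  have e := withDensity_rnDeriv_flowMeasure μ hu
  have h1 : (flowMeasure μ u).rnDeriv μ ≤ᵐ[μ] fun x => ENNReal.ofReal (rayLength u x) := by
    refine ae_le_of_forall_setLIntegral_le_of_sigmaFinite (Measure.measurable_rnDeriv _ _)
      fun s hs _ => ?_
    rw [← withDensity_apply _ hs, ← withDensity_apply _ hs, e]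
    exact hu.flowMeasure_le_rayMeasure μ s
  have h2 : (fun x => ENNReal.ofReal (rayLength u x)) ≤ᵐ[μ]
      fun x => (Module.finrank ℝ E : ℝ≥0∞) * (flowMeasure μ u).rnDeriv μ x := by
    refine ae_le_of_forall_setLIntegral_le_of_sigmaFinite hu.measurable_rayLength.ennreal_ofReal
      fun s hs _ => ?_
    rw [lintegral_const_mul _ (Measure.measurable_rnDeriv _ _), ← withDensity_apply _ hs,
      ← withDensity_apply _ hs, e]
    have := hu.rayMeasure_le_finrank_smul μ s
    simpa [rayMeasure, ENNReal.smul_def] using this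
  filter_upwards [h1, h2, Measure.rnDeriv_lt_top (flowMeasure μ u) μ] with x a b c
  have a' := ENNReal.toReal_mono ENNReal.ofReal_ne_top a
  have b' := ENNReal.toReal_mono (ENNReal.mul_ne_top (by simp) c.ne) b
  rw [ENNReal.toReal_ofReal (hu.rayLength_nonneg x)] at a' b'
  rw [ENNReal.toReal_mul, ENNReal.toReal_natCast] at b'
  exact ⟨a', b'⟩

lemma locallyIntegrable_of_le_rayLength {u g : E → ℝ} (hu : IsNullConvex u) (hg : Measurable g)
    (h : ∀ᵐ x ∂μ, |g x| ≤ rayLength u x) : LocallyIntegrable g μ := by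
  intro x
  refine ⟨Metric.closedBall x 1, Metric.closedBall_mem_nhds x one_pos, ?_⟩
  obtain ⟨M, -, hM⟩ := hu.exists_rayLength_le (‖x‖ + 1)
  refine Measure.integrableOn_of_bounded (M := M) (isCompact_closedBall x 1).measure_lt_top.ne
    hg.aestronglyMeasurable ?_
  filter_upwards [ae_restrict_of_ae h, ae_restrict_mem Metric.isClosed_closedBall.measurableSet]
    with y hy hyx
  refine hy.trans (hM y ?_)
  have h1 := norm_le_norm_add_norm_sub' y x
  have h2 := mem_closedBall_iff_norm.1 hyx
  linarith

/-- Weak convergence against continuous functions improves to bounded measurable functions, if the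
densities are uniformly locally bounded. -/
lemma tendsto_integral_mul_of_continuous {g : ℕ → E → ℝ} {G : E → ℝ}
    (hg : ∀ k, Measurable (g k)) (hG : Measurable G) (hgb : ∀ R : ℝ, ∃ M, ∀ᶠ k in atTop, ∀ᵐ x ∂μ,
      ‖x‖ ≤ R → |g k x| ≤ M) (hGb : ∀ R : ℝ, ∃ M, ∀ᵐ x ∂μ, ‖x‖ ≤ R → |G x| ≤ M)
    (hlim : ∀ f : E → ℝ, Continuous f → HasCompactSupport f →
      Tendsto (fun k => ∫ x, f x * g k x ∂μ) atTop (𝓝 (∫ x, f x * G x ∂μ)))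
    {f : E → ℝ} (hf : Measurable f) (hfc : HasCompactSupport f) {C : ℝ} (hC : ∀ x, |f x| ≤ C) :
    Tendsto (fun k => ∫ x, f x * g k x ∂μ) atTop (𝓝 (∫ x, f x * G x ∂μ)) := by
  obtain ⟨R, hR⟩ := hfc.isBounded.subset_closedBall (0 : E)
  obtain ⟨χ, hχ, hχc, hχ0, hχ1, hχR, hχs⟩ := exists_cutoff (E := E) R
  set R' := max R 0 + 2
  obtain ⟨M₁, hM₁⟩ := hgb R'
  obtain ⟨M₂, hM₂⟩ := hGb R'
  set M := max (max M₁ M₂) 0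
  have hM0 : 0 ≤ M := le_max_right _ _
  have hfi : Integrable f μ := by
    refine (integrableOn_iff_integrable_of_support_subset (subset_tsupport f)).1 ?_
    exact Measure.integrableOn_of_bounded (M := C) hfc.measure_lt_top.ne hf.aestronglyMeasurable
      (Eventually.of_forall hC)
  have hfχ : ∀ x, f x = χ x * f x := fun x => by
    by_cases hx : x ∈ tsupport f
    · rw [hχR x (mem_closedBall_zero_iff.1 (hR hx)), one_mul]
    · rw [image_eq_zero_of_notMem_tsupport hx, mul_zero]
  -- integrals against a function close to `f` in mean are uniformly close
  have bound : ∀ (h w : E → ℝ), Continuous h → Integrable h μ → Measurable w →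
      (∀ᵐ x ∂μ, ‖x‖ ≤ R' → |w x| ≤ M) →
      |∫ x, f x * w x ∂μ - ∫ x, χ x * h x * w x ∂μ| ≤ M * ∫ x, ‖f x - h x‖ ∂μ := by
    intro h w hh hhi hw hwM
    have hb : ∀ᵐ x ∂μ, ‖χ x * w x‖ ≤ M := by
      filter_upwards [hwM] with x hx
      rw [norm_mul, Real.norm_of_nonneg (hχ0 x)]
      by_cases hxs : x ∈ tsupport χ
      · have := hx (mem_closedBall_zero_iff.1 (hχs hxs))
        exact (mul_le_of_le_one_left (abs_nonneg _) (hχ1 x)).trans this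
      · rw [image_eq_zero_of_notMem_tsupport hxs, zero_mul]; exact hM0
    have hm : AEStronglyMeasurable (fun x => χ x * w x) μ :=
      (hχ.continuous.measurable.mul hw).aestronglyMeasurable
    have i1 := hfi.bdd_mul hm hb
    have i2 := hhi.bdd_mul hm hb
    have e1 : ∫ x, f x * w x ∂μ = ∫ x, χ x * w x * f x ∂μ :=
      integral_congr_ae (Eventually.of_forall fun x => by
        change f x * w x = χ x * w x * f x
        nth_rewrite 1 [hfχ x]; ring)
    have e2 : ∫ x, χ x * h x * w x ∂μ = ∫ x, χ x * w x * h x ∂μ :=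
      integral_congr_ae (Eventually.of_forall fun x => by
        change χ x * h x * w x = χ x * w x * h x; ring)
    rw [e1, e2, ← integral_sub i1 i2, ← Real.norm_eq_abs, ← integral_const_mul]
    refine norm_integral_le_of_norm_le ((hfi.sub hhi).norm.const_mul M) ?_
    filter_upwards [hb] with x hx
    rw [← mul_sub, norm_mul]
    exact mul_le_mul_of_nonneg_right hx (norm_nonneg _)
  rw [Metric.tendsto_nhds]
  intro δ hδ
  obtain ⟨h, -, hh, hhc, hhi⟩ := hfi.exists_hasCompactSupport_integral_sub_le
    (ε := δ / (4 * (M + 1))) (by positivity)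
  have hsmall : M * ∫ x, ‖f x - h x‖ ∂μ < δ / 3 := by
    have : M * ∫ x, ‖f x - h x‖ ∂μ ≤ M * (δ / (4 * (M + 1))) := by gcongr
    refine this.trans_lt ?_
    rw [← mul_div_assoc, div_lt_div_iff₀ (by positivity) (by positivity)]
    nlinarith
  have hl := hlim (fun x => χ x * h x) (hχ.continuous.mul hhc) hχc.mul_right
  have hl' := hl.eventually (Metric.ball_mem_nhds _ (by positivity : 0 < δ / 3))
  have hb2 := bound h G hhc hhi hG (by
    filter_upwards [hM₂] with x hx hxR
    exact (hx hxR).trans ((le_max_right _ _).trans (le_max_left _ _)))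
  filter_upwards [hl', hM₁] with k hk hk'
  have hb1 := bound h (g k) hhc hhi (hg k) (by
    filter_upwards [hk'] with x hx hxR
    exact (hx hxR).trans ((le_max_left _ _).trans (le_max_left _ _)))
  rw [Real.dist_eq, abs_lt] at hk
  rw [Real.dist_eq, abs_lt]
  rw [abs_le] at hb1 hb2
  constructor <;> linarith

end Convergence

/-! ### Minkowski geometry and coordinates -/

section Geometry

variable {n : ℕ}

/-- The Minkowski product with a fixed vector, as a continuous linear form. -/
def lorForm (w : Minkowski n) : Minkowski n →L[ℝ] ℝ :=
  -(w.1 • ContinuousLinearMap.fst ℝ ℝ (EuclideanSpace ℝ (Fin n)))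
    + (innerSL ℝ w.2).comp (ContinuousLinearMap.snd ℝ ℝ (EuclideanSpace ℝ (Fin n)))

lemma lorForm_apply (w x : Minkowski n) : lorForm w x = lor x w := by
  simp [lorForm, lor, real_inner_comm, mul_comm]

lemma lor_comm (x y : Minkowski n) : lor x y = lor y x := by
  simp [lor, real_inner_comm, mul_comm]

lemma lor_add_left (x y z : Minkowski n) : lor (x + y) z = lor x z + lor y z := by
  simp only [← lorForm_apply, map_add]

lemma lor_smul_left (c : ℝ) (x z : Minkowski n) : lor (c • x) z = c * lor x z := by
  simp only [← lorForm_apply, map_smul, smul_eq_mul]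

lemma lor_sub_left (x y z : Minkowski n) : lor (x - y) z = lor x z - lor y z := by
  simp only [← lorForm_apply, map_sub]

lemma lor_neg_left (x z : Minkowski n) : lor (-x) z = -lor x z := by
  simp only [← lorForm_apply, map_neg]

lemma lor_add_right (x y z : Minkowski n) : lor x (y + z) = lor x y + lor x z := by
  rw [lor_comm, lor_add_left, lor_comm y, lor_comm z]

lemma lor_smul_right (c : ℝ) (x z : Minkowski n) : lor x (c • z) = c * lor x z := by
  rw [lor_comm, lor_smul_left, lor_comm]

lemma lor_self (w : Minkowski n) : lor w w = ‖w.2‖ ^ 2 - w.1 ^ 2 := by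
  rw [lor, real_inner_self_eq_norm_sq]; ring

/-- The Minkowski form is nondegenerate. -/
lemma eq_of_forall_lor_eq {a b : Minkowski n} (h : ∀ w, lor a w = lor b w) : a = b := by
  have h1 : lor (a - b) (-(a - b).1, (a - b).2) = 0 := by rw [lor_sub_left, h, sub_self]
  have h2 : (a - b).1 ^ 2 + ‖(a - b).2‖ ^ 2 = 0 := by
    rw [← h1, lor, real_inner_self_eq_norm_sq]; ring
  have h3 : (a - b).1 = 0 := by nlinarith [sq_nonneg (a - b).1, sq_nonneg ‖(a - b).2‖]
  have h4 : (a - b).2 = 0 := by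
    rw [← norm_eq_zero]; nlinarith [sq_nonneg (a - b).1, sq_nonneg ‖(a - b).2‖]
  exact sub_eq_zero.1 (Prod.ext h3 h4)

/-- Future causal vectors have negative product with future timelike vectors. -/
lemma lor_neg_of_causal {a b : Minkowski n} (ha : IsFutureCausal a) (hb : lor b b < 0)
    (hb0 : 0 < b.1) : lor a b < 0 := by
  obtain ⟨ha1, ha0⟩ := ha
  rw [lor_self] at ha1 hb
  have h1 : ‖a.2‖ ≤ a.1 := le_of_sq_le_sq (by linarith) ha0.le
  have h2 : ‖b.2‖ < b.1 := lt_of_pow_lt_pow_left₀ 2 hb0.le (by linarith)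
  have h3 := real_inner_le_norm a.2 b.2
  have h4 : ‖a.2‖ * ‖b.2‖ ≤ a.1 * ‖b.2‖ := by gcongr
  have h5 : a.1 * ‖b.2‖ < a.1 * b.1 := by gcongr
  rw [lor]
  linarith

/-- A function squeezed between two differentiable functions with the same value and derivative. -/
lemma hasFDerivAt_of_squeeze {F : Type*} [NormedAddCommGroup F] [NormedSpace ℝ F] {f g h : F → ℝ}
    {f' : F →L[ℝ] ℝ} {x : F} (hf : HasFDerivAt f f' x) (hh : HasFDerivAt h f' x)
    (hfg : ∀ᶠ y in 𝓝 x, f y ≤ g y) (hgh : ∀ᶠ y in 𝓝 x, g y ≤ h y) (hfx : f x = g x)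
    (hhx : h x = g x) : HasFDerivAt g f' x := by
  have a := hasFDerivAt_iff_isLittleO.1 hf
  have b := hasFDerivAt_iff_isLittleO.1 hh
  refine hasFDerivAt_iff_isLittleO.2 ?_
  refine Asymptotics.IsBigO.trans_isLittleO ?_ (a.norm_left.add b.norm_left)
  refine Asymptotics.IsBigO.of_bound 1 ?_
  filter_upwards [hfg, hgh] with y h1 h2
  rw [one_mul, hfx, hhx]
  have e1 := neg_abs_le (f y - g x - f' (y - x))
  have e2 := le_abs_self (h y - g x - f' (y - x))
  have e3 := abs_nonneg (f y - g x - f' (y - x))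
  have e4 := abs_nonneg (h y - g x - f' (y - x))
  simp only [Real.norm_eq_abs]
  rw [abs_of_nonneg (add_nonneg e3 e4), abs_le]
  constructor <;> linarith

section Coordinates

variable {v : Minkowski n} (hv : IsUnitFutureTimelike v)
  {φ : EuclideanSpace ℝ (Fin n) →ₗ[ℝ] Minkowski n} (hφ : IsOrthIsometry v φ)

include hv hφ

lemma lor_coord (x y : EuclideanSpace ℝ (Fin n)) (s t : ℝ) :
    lor (φ x + s • v) (φ y + t • v) = inner ℝ x y - s * t := by
  rw [lor_add_left, lor_add_right, lor_add_right, lor_smul_left, lor_smul_right, lor_smul_left,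
    lor_smul_right, hφ.1, hφ.2, lor_comm v, hφ.2, hv.1]
  ring

lemma lor_coord_self (x : EuclideanSpace ℝ (Fin n)) (s : ℝ) :
    lor (φ x + s • v) (φ x + s • v) = ‖x‖ ^ 2 - s ^ 2 := by
  rw [lor_coord hv hφ, real_inner_self_eq_norm_sq]; ring

lemma lor_coord_time (x : EuclideanSpace ℝ (Fin n)) (s : ℝ) : lor (φ x + s • v) v = -s := by
  rw [lor_add_left, lor_smul_left, hφ.2, hv.1]; ring

lemma lorLength_coord (x : EuclideanSpace ℝ (Fin n)) (s : ℝ) :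
    lorLength (φ x + s • v) = √(s ^ 2 - ‖x‖ ^ 2) := by
  rw [lorLength, lor_coord_self hv hφ, neg_sub]

/-- The coordinates `(x, s) ↦ x + s v` on Minkowski space given by the orthogonal splitting. -/
lemma exists_coordEquiv : ∃ e : (EuclideanSpace ℝ (Fin n) × ℝ) ≃L[ℝ] Minkowski n,
    ∀ x s, e (x, s) = φ x + s • v := by
  let L : EuclideanSpace ℝ (Fin n) × ℝ →ₗ[ℝ] Minkowski n :=
    φ.comp (LinearMap.fst ℝ _ _) + (LinearMap.snd ℝ _ _).smulRight v
  have hL : Function.Injective L := by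
    rw [← LinearMap.ker_eq_bot, LinearMap.ker_eq_bot']
    rintro ⟨x, s⟩ h
    have h' : φ x + s • v = 0 := h
    have h1 := lor_coord_time hv hφ x s
    have h2 := lor_coord_self hv hφ x s
    rw [h'] at h1 h2
    have hs : s = 0 := by
      have : lor (0 : Minkowski n) v = 0 := by simp [lor]
      linarith
    have hx : ‖x‖ ^ 2 = 0 := by
      have : lor (0 : Minkowski n) 0 = 0 := by simp [lor]
      rw [hs] at h2; linarith
    have : x = 0 := by simpa using hx
    rw [this, hs]; rfl
  refine ⟨(LinearEquiv.ofInjectiveOfFinrankEq L hL (by simp [add_comm])).toContinuousLinearEquiv,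
    fun x s => rfl⟩

lemma exists_coord (w : Minkowski n) :
    ∃ (x : EuclideanSpace ℝ (Fin n)) (s : ℝ), w = φ x + s • v := by
  obtain ⟨e, he⟩ := exists_coordEquiv hv hφ
  refine ⟨(e.symm w).1, (e.symm w).2, ?_⟩
  rw [← he]
  simp

omit hv hφ in
lemma coord_sub (x y : EuclideanSpace ℝ (Fin n)) (s t : ℝ) :
    φ x + s • v - (φ y + t • v) = φ (x - y) + (s - t) • v := by
  rw [map_sub]; module

lemma isFutureCausal_coord {x : EuclideanSpace ℝ (Fin n)} {s : ℝ} :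
    IsFutureCausal (φ x + s • v) ↔ ‖x‖ ≤ s ∧ 0 < s := by
  constructor
  · intro h
    have h1 := lor_neg_of_causal h (by rw [hv.1]; norm_num) hv.2
    rw [lor_coord_time hv hφ] at h1
    have h2 := h.1
    rw [lor_coord_self hv hφ] at h2
    exact ⟨le_of_sq_le_sq (by linarith) (by linarith), by linarith⟩
  · rintro ⟨h1, h2⟩
    have h3 : lor (φ x + s • v) (φ x + s • v) ≤ 0 := by
      rw [lor_coord_self hv hφ]; nlinarith [norm_nonneg x]
    have h4 := lor_coord_time hv hφ x s
    refine ⟨h3, ?_⟩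
    set w := φ x + s • v
    by_contra! hw
    rcases hw.lt_or_eq with hw | hw
    · have h5 : IsFutureCausal (-w) :=
        ⟨by rw [lor_neg_left, lor_comm, lor_neg_left]; linarith, by simpa using hw⟩
      have h6 := lor_neg_of_causal h5 (by rw [hv.1]; norm_num) hv.2
      rw [lor_neg_left] at h6
      linarith
    · rw [lor_self, hw] at h3
      have h5 : w.2 = 0 := by
        rw [← norm_eq_zero]; nlinarith [norm_nonneg w.2]
      have h6 : lor w v = 0 := by simp [lor, hw, h5]
      linarith

lemma isFutureTimelike_coord {x : EuclideanSpace ℝ (Fin n)} {s : ℝ} :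
    IsFutureTimelike (φ x + s • v) ↔ ‖x‖ < s := by
  constructor
  · intro h
    obtain ⟨h1, h2⟩ := (isFutureCausal_coord hv hφ).1 ⟨h.1.le, h.2⟩
    have h3 := h.1
    rw [lor_coord_self hv hφ] at h3
    exact lt_of_pow_lt_pow_left₀ 2 h2.le (by linarith)
  · intro h
    have h0 : 0 < s := (norm_nonneg x).trans_lt h
    refine ⟨?_, ((isFutureCausal_coord hv hφ).2 ⟨h.le, h0⟩).2⟩
    rw [lor_coord_self hv hφ]; nlinarith [norm_nonneg x]

/-- Lightlike hyperplanes are the graphs of affine functions with unit gradient. -/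
lemma lightlike_orthPlane {a ξ : Minkowski n} (hξ : IsLightlike ξ) :
    ∃ (e : EuclideanSpace ℝ (Fin n)) (c σ : ℝ), ‖e‖ = 1 ∧ σ ≠ 0 ∧ ξ = σ • (φ e + v) ∧
      ∀ x s, φ x + s • v ∈ orthPlane a ξ ↔ s = inner ℝ e x + c := by
  obtain ⟨z, σ, hz⟩ := exists_coord hv hφ ξ
  obtain ⟨y, t, hy⟩ := exists_coord hv hφ a
  have h1 := hξ.2
  rw [hz, lor_coord_self hv hφ] at h1
  have hσ : σ ≠ 0 := by
    rintro rfl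
    have : z = 0 := by simpa using h1
    exact hξ.1 (by rw [hz, this]; simp)
  refine ⟨σ⁻¹ • z, t - inner ℝ (σ⁻¹ • z) y, σ, ?_, hσ, ?_, fun x s => ?_⟩
  · rw [norm_smul, norm_inv, Real.norm_eq_abs, inv_mul_eq_one₀ (abs_ne_zero.2 hσ)]
    exact (sq_eq_sq₀ (abs_nonneg _) (norm_nonneg _)).1 (by rw [sq_abs]; linarith)
  · rw [hz, smul_add, ← map_smul, smul_inv_smul₀ hσ]
  · rw [orthPlane, mem_ofPred_eq, hy, hz, coord_sub, lor_coord hv hφ, real_inner_smul_left,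
      real_inner_smul_left, real_inner_comm, inner_sub_right]
    constructor
    · intro h
      field_simp
      linarith
    · rintro rfl
      field_simp
      ring

/-- The future of the graph of an affine function with unit gradient is its epigraph. -/
lemma mem_chronFuture_iff {P : Set (Minkowski n)} {e : EuclideanSpace ℝ (Fin n)} {c : ℝ}
    (he : ‖e‖ = 1) (hP : ∀ x s, φ x + s • v ∈ P ↔ s = inner ℝ e x + c)
    (x : EuclideanSpace ℝ (Fin n)) (s : ℝ) :
    φ x + s • v ∈ chronFuture P ↔ inner ℝ e x + c < s := by
  constructor
  · rintro ⟨q, hq, hf⟩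
    obtain ⟨y, t, rfl⟩ := exists_coord hv hφ q
    rw [hP] at hq
    rw [coord_sub, isFutureTimelike_coord hv hφ] at hf
    have h1 := real_inner_le_norm e (x - y)
    rw [he, one_mul, inner_sub_right] at h1
    linarith
  · intro h
    refine ⟨φ x + (inner ℝ e x + c) • v, (hP _ _).2 rfl, ?_⟩
    rw [coord_sub, isFutureTimelike_coord hv hφ, sub_self, norm_zero]
    linarith

/-- A domain of dependence is the strict epigraph of its boundary function, which is a supremum of
affine functions with unit gradients. -/
lemma domain_eq_epigraph {D : Set (Minkowski n)} (hD : IsDomainOfDependence D) :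
    IsNullConvex (boundaryFun D v φ) ∧
      ∀ x s, φ x + s • v ∈ D ↔ boundaryFun D v φ x < s := by
  obtain ⟨F, hF, hDF⟩ := hD.eq_inter
  obtain ⟨a₁, a₂, ξ₁, ξ₂, hξ₁, hξ₂, hne, hp₁, hp₂⟩ := hD.two_planes
  obtain ⟨e₁, c₁, σ₁, he₁, hσ₁, hξe₁, hP₁⟩ := lightlike_orthPlane hv hφ (a := a₁) hξ₁
  obtain ⟨e₂, c₂, σ₂, he₂, hσ₂, hξe₂, hP₂⟩ := lightlike_orthPlane hv hφ (a := a₂) hξ₂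
  -- membership in `D` in terms of affine functions
  have hmem : ∀ (x : EuclideanSpace ℝ (Fin n)) (s : ℝ),
      φ x + s • v ∈ D ↔ ∀ P ∈ F, φ x + s • v ∈ chronFuture P := by
    intro x s; rw [hDF]; simp
  have hplane : ∀ P ∈ F, ∃ (e : EuclideanSpace ℝ (Fin n)) (c : ℝ), ‖e‖ = 1 ∧
      ∀ x s, φ x + s • v ∈ chronFuture P ↔ inner ℝ e x + c < s := by
    intro P hPF
    obtain ⟨a, ξ, hξ, rfl⟩ := hF P hPF
    obtain ⟨e, c, σ, he, -, -, hP⟩ := lightlike_orthPlane hv hφ (a := a) hξ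
    exact ⟨e, c, he, mem_chronFuture_iff hv hφ he hP⟩
  have upward : ∀ (x : EuclideanSpace ℝ (Fin n)) (s t : ℝ),
      φ x + s • v ∈ D → s ≤ t → φ x + t • v ∈ D := by
    intro x s t hs hst
    rw [hmem] at hs ⊢
    intro P hPF
    obtain ⟨e, c, -, h⟩ := hplane P hPF
    have := (h x s).1 (hs P hPF)
    exact (h x t).2 (by linarith)
  have below : ∀ {a ξ : Minkowski n} {e : EuclideanSpace ℝ (Fin n)} {c : ℝ},
      orthPlane a ξ ⊆ Dᶜ → (∀ x s, φ x + s • v ∈ orthPlane a ξ ↔ s = inner ℝ e x + c) →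
      ∀ x s, φ x + s • v ∈ D → inner ℝ e x + c ≤ s := by
    intro a ξ e c hsub hP x s hs
    by_contra! hlt
    exact hsub ((hP x _).2 rfl) (upward x s _ hs hlt.le)
  have bdd : ∀ x, BddBelow {s : ℝ | φ x + s • v ∈ D} := fun x =>
    ⟨inner ℝ e₁ x + c₁, fun s hs => below hp₁ hP₁ x s hs⟩
  have nonempty : ∀ x, {s : ℝ | φ x + s • v ∈ D}.Nonempty := by
    intro x
    obtain ⟨q, hq⟩ := hD.nonempty
    obtain ⟨y, t, rfl⟩ := exists_coord hv hφ q
    refine ⟨t + ‖x - y‖, ?_⟩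
    rw [mem_ofPred_eq, hmem]
    rw [hmem] at hq
    intro P hPF
    obtain ⟨e, c, he, h⟩ := hplane P hPF
    have h1 := (h y t).1 (hq P hPF)
    have h2 := real_inner_le_norm e (x - y)
    rw [he, one_mul, inner_sub_right] at h2
    exact (h x _).2 (by linarith)
  have hiff : ∀ x s, φ x + s • v ∈ D ↔ boundaryFun D v φ x < s := by
    intro x s
    constructor
    · intro hs
      have hopen : IsOpen {s : ℝ | φ x + s • v ∈ D} :=
        hD.isOpen.preimage (f := fun s : ℝ => φ x + s • v) (by fun_prop)
      obtain ⟨r, hr, hball⟩ := Metric.isOpen_iff.1 hopen s hs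
      have h1 : s - r / 2 ∈ {s : ℝ | φ x + s • v ∈ D} := hball (by
        rw [Metric.mem_ball, Real.dist_eq, abs_lt]; constructor <;> linarith)
      have := csInf_le (bdd x) h1
      unfold boundaryFun
      linarith
    · intro hs
      obtain ⟨t, ht, hts⟩ := exists_lt_of_csInf_lt (nonempty x) hs
      exact upward x t s ht hts.le
  have below' : ∀ {a ξ : Minkowski n} {e : EuclideanSpace ℝ (Fin n)} {c : ℝ},
      orthPlane a ξ ⊆ Dᶜ → (∀ x s, φ x + s • v ∈ orthPlane a ξ ↔ s = inner ℝ e x + c) →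
      ∀ x, inner ℝ e x + c ≤ boundaryFun D v φ x := fun hsub hP x =>
    le_csInf (nonempty x) fun s hs => below hsub hP x s hs
  refine ⟨⟨fun x => ?_, ?_⟩, hiff⟩
  · -- the boundary point above `x` is missed by the future of one of the hyperplanes
    have h1 : φ x + boundaryFun D v φ x • v ∉ D := fun h => lt_irrefl _ ((hiff _ _).1 h)
    rw [hmem] at h1
    push Not at h1
    obtain ⟨P, hPF, hP⟩ := h1
    obtain ⟨e, c, he, h⟩ := hplane P hPF
    rw [h, not_lt] at hP
    refine ⟨e, he, fun y => le_csInf (nonempty y) fun s hs => ?_⟩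
    have h2 := (h y s).1 ((hmem y s).1 hs P hPF)
    rw [inner_sub_right]
    linarith
  · -- the mean of two different unit gradients is shorter than one
    have hee : e₁ ≠ e₂ := by
      rintro rfl
      refine hne (σ₂ / σ₁) ?_
      rw [hξe₁, hξe₂, smul_smul, div_mul_cancel₀ _ hσ₁]
    have hm : ‖(1 / 2 : ℝ) • e₁ + (1 / 2 : ℝ) • e₂‖ < 1 :=
      norm_combo_lt_of_ne he₁.le he₂.le hee (by norm_num) (by norm_num) (by norm_num)
    refine ⟨1 - ‖(1 / 2 : ℝ) • e₁ + (1 / 2 : ℝ) • e₂‖, by linarith, -(c₁ + c₂) / 2, fun y => ?_⟩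
    have h1 := below' hp₁ hP₁ y
    have h2 := below' hp₂ hP₂ y
    have h3 := abs_real_inner_le_norm ((1 / 2 : ℝ) • e₁ + (1 / 2 : ℝ) • e₂) y
    have h4 := neg_abs_le (inner ℝ ((1 / 2 : ℝ) • e₁ + (1 / 2 : ℝ) • e₂) y : ℝ)
    rw [inner_add_left, real_inner_smul_left, real_inner_smul_left] at h3 h4
    linarith

/-- Hausdorff convergence on compact sets implies pointwise convergence of the boundary
functions. -/
lemma tendsto_boundaryFun {D : Set (Minkowski n)} (hD : IsDomainOfDependence D)
    {Ds : ℕ → Set (Minkowski n)} (hDs : ∀ k, IsDomainOfDependence (Ds k))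
    (hconv : ConvergesTo Ds D) (x : EuclideanSpace ℝ (Fin n)) :
    Tendsto (fun k => boundaryFun (Ds k) v φ x) atTop (𝓝 (boundaryFun D v φ x)) := by
  obtain ⟨e, he⟩ := exists_coordEquiv hv hφ
  obtain ⟨hu, hiff⟩ := domain_eq_epigraph hv hφ hD
  set A := ‖(e.symm : Minkowski n →L[ℝ] EuclideanSpace ℝ (Fin n) × ℝ)‖
  have hA : 0 ≤ A := norm_nonneg _
  have hcoord : ∀ (y : EuclideanSpace ℝ (Fin n)) (s t : ℝ),
      ‖y - x‖ ≤ A * dist (φ x + s • v) (φ y + t • v) ∧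
      |t - s| ≤ A * dist (φ x + s • v) (φ y + t • v) := by
    intro y s t
    have h1 : (y - x, t - s) = e.symm (φ y + t • v - (φ x + s • v)) := by
      rw [coord_sub, ← he, ContinuousLinearEquiv.symm_apply_apply]
    have h2 := (e.symm : Minkowski n →L[ℝ] EuclideanSpace ℝ (Fin n) × ℝ).le_opNorm
      (φ y + t • v - (φ x + s • v))
    rw [← dist_eq_norm, dist_comm] at h2
    change ‖e.symm (φ y + t • v - (φ x + s • v))‖ ≤ _ at h2
    rw [← h1, Prod.norm_def] at h2
    exact ⟨(le_max_left _ _).trans h2, (le_max_right _ _).trans h2⟩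
  -- a point of the epigraph of `w` near the point `(x, s)` bounds `w x` from above
  have near : ∀ (w : EuclideanSpace ℝ (Fin n) → ℝ) (S : Set (Minkowski n)), IsNullConvex w →
      (∀ y t, φ y + t • v ∈ S ↔ w y < t) → ∀ s δ, 0 < δ →
      φ x + s • v ∈ Metric.thickening (δ / (4 * (A + 1))) S → w x < s + δ / 2 := by
    intro w S hw hS s δ hδ hmem
    obtain ⟨q, hq, hd⟩ := Metric.mem_thickening_iff.1 hmem
    obtain ⟨y, t, rfl⟩ := exists_coord hv hφ q
    obtain ⟨h1, h2⟩ := hcoord y s t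
    have h3 := (hS y t).1 hq
    have h4 := hw.sub_le x y
    rw [norm_sub_rev] at h4
    have h5 : A * dist (φ x + s • v) (φ y + t • v) ≤ A * (δ / (4 * (A + 1))) := by gcongr
    have h6 : A * (δ / (4 * (A + 1))) ≤ δ / 4 := by
      rw [← mul_div_assoc, div_le_div_iff₀ (by positivity) (by positivity)]
      nlinarith
    have h7 := le_abs_self (t - s)
    linarith
  rw [tendsto_order]
  constructor
  · intro a ha
    set δ := boundaryFun D v φ x - a
    have hδ : 0 < δ := sub_pos.2 ha
    filter_upwards [hconv {φ x + (boundaryFun D v φ x - δ / 2) • v} isCompact_singleton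
      (δ / (4 * (A + 1))) (by positivity)] with k hk
    by_contra! hlt
    have hin : φ x + (boundaryFun D v φ x - δ / 2) • v ∈ Ds k :=
      ((domain_eq_epigraph hv hφ (hDs k)).2 _ _).2 (by simp only [δ]; linarith)
    have := near _ D hu hiff _ δ hδ (hk.1 ⟨hin, rfl⟩)
    linarith
  · intro a ha
    set δ := a - boundaryFun D v φ x
    have hδ : 0 < δ := sub_pos.2 ha
    filter_upwards [hconv {φ x + (boundaryFun D v φ x + δ / 2) • v} isCompact_singleton
      (δ / (4 * (A + 1))) (by positivity)] with k hk
    have hin : φ x + (boundaryFun D v φ x + δ / 2) • v ∈ D := (hiff _ _).2 (by linarith)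
    obtain ⟨huk, hiffk⟩ := domain_eq_epigraph hv hφ (hDs k)
    have := near _ (Ds k) huk hiffk _ δ hδ (hk.2 ⟨hin, rfl⟩)
    simp only [δ] at this
    linarith

end Coordinates

end Geometry

/-! ### The cosmological time -/

section CosmologicalTime

variable {n : ℕ}

/-- The reversed Cauchy–Schwarz inequality. -/
lemma lorLength_le_neg_lor {w ν : Minkowski n} (hw : IsFutureCausal w)
    (hν : IsUnitFutureTimelike ν) : lorLength w ≤ -lor w ν := by
  obtain ⟨h1, h0⟩ := hw
  obtain ⟨h2, h3⟩ := hν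
  rw [lor_self] at h1 h2
  have hW : ‖w.2‖ ≤ w.1 := le_of_sq_le_sq (by linarith) h0.le
  have hN : ‖ν.2‖ ≤ ν.1 := le_of_sq_le_sq (by linarith) h3.le
  have h4 := real_inner_le_norm w.2 ν.2
  have h5 : ‖w.2‖ * ‖ν.2‖ ≤ w.1 * ν.1 := mul_le_mul hW hN (norm_nonneg _) h0.le
  have h6 : lorLength w ≤ w.1 * ν.1 - ‖w.2‖ * ‖ν.2‖ := by
    refine Real.sqrt_le_iff.2 ⟨by linarith, ?_⟩
    rw [lor_self]
    have e : (w.1 * ν.1 - ‖w.2‖ * ‖ν.2‖) ^ 2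
        = (w.1 ^ 2 - ‖w.2‖ ^ 2) * (ν.1 ^ 2 - ‖ν.2‖ ^ 2) + (w.1 * ‖ν.2‖ - ν.1 * ‖w.2‖) ^ 2 := by
      ring
    have e2 : ν.1 ^ 2 - ‖ν.2‖ ^ 2 = 1 := by linarith
    rw [e, e2]
    nlinarith [sq_nonneg (w.1 * ‖ν.2‖ - ν.1 * ‖w.2‖)]
  rw [lor]
  linarith

/-- A spacelike support hyperplane of `D` bounds the length of the causal curves in `D`. -/
lemma curveLength_le {D : Set (Minkowski n)} {p : Minkowski n} {c : ℝ → Minkowski n}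
    (hc : IsCausalCurve D p c) {ν r : Minkowski n} (hν : IsUnitFutureTimelike ν)
    (hD : ∀ q ∈ D, lor (q - r) ν ≤ 0) : curveLength c ≤ -lor (p - r) ν := by
  obtain ⟨K, hK⟩ := hc.lipschitz
  set h : ℝ → ℝ := fun t => (-lorForm ν) (c t) with hh
  have hac : AbsolutelyContinuousOnInterval h 0 1 := by
    apply LipschitzOnWith.absolutelyContinuousOnInterval (K := ‖-lorForm ν‖₊ * K)
    rw [uIcc_of_le zero_le_one]
    exact (-lorForm ν).lipschitz.comp_lipschitzOnWith hK
  have hle : ∀ᵐ t ∂volume.restrict (Icc (0 : ℝ) 1), lorLength (deriv c t) ≤ deriv h t := by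
    filter_upwards [hc.causal] with t ht
    have hd : DifferentiableAt ℝ c t := by
      by_contra hd
      rw [deriv_zero_of_not_differentiableAt hd] at ht
      exact lt_irrefl _ ht.2
    have : deriv h t = -lor (deriv c t) ν := by
      rw [← lorForm_apply, ← neg_apply]
      exact ((-lorForm ν).hasFDerivAt.comp_hasDerivAt t hd.hasDerivAt).deriv
    rw [this]
    exact lorLength_le_neg_lor ht hν
  have hint : curveLength c ≤ ∫ t in (0 : ℝ)..1, deriv h t := by
    have hi := hac.intervalIntegrable_deriv
    rw [intervalIntegrable_iff_integrableOn_Ioc_of_le zero_le_one] at hi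
    rw [curveLength, intervalIntegral.integral_of_le zero_le_one,
      intervalIntegral.integral_of_le zero_le_one]
    refine integral_mono_of_nonneg (ae_of_all _ fun t => Real.sqrt_nonneg _) hi ?_
    exact ae_restrict_of_ae_restrict_of_subset Ioc_subset_Icc_self hle
  rw [hac.integral_deriv_eq_sub] at hint
  have h0 := hD _ (hc.mem 0 (by simp))
  simp only [hh, neg_apply, lorForm_apply, hc.endpoint] at hint
  rw [lor_sub_left] at h0 ⊢
  linarith

lemma cosmologicalTime_le {D : Set (Minkowski n)} {ν r : Minkowski n}
    (hν : IsUnitFutureTimelike ν) (hD : ∀ q ∈ D, lor (q - r) ν ≤ 0) (p : Minkowski n) :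
    cosmologicalTime D p ≤ ENNReal.ofReal (-lor (p - r) ν) :=
  iSup₂_le fun _ hc => ENNReal.ofReal_le_ofReal (curveLength_le hc hν hD)

/-- Straight segments bound the cosmological time from below. -/
lemma ofReal_lorLength_le {D : Set (Minkowski n)} {p q : Minkowski n}
    (hpq : IsFutureCausal (p - q)) (hD : ∀ t ∈ Icc (0 : ℝ) 1, q + t • (p - q) ∈ D) :
    ENNReal.ofReal (lorLength (p - q)) ≤ cosmologicalTime D p := by
  have hderiv : ∀ t : ℝ, HasDerivAt (fun t : ℝ => q + t • (p - q)) (p - q) t := fun t => by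
    simpa using ((hasDerivAt_id t).smul_const (p - q)).const_add q
  have hlen : curveLength (fun t : ℝ => q + t • (p - q)) = lorLength (p - q) := by
    simp [curveLength, fun t => (hderiv t).deriv]
  rw [← hlen]
  refine le_iSup₂_of_le _ ⟨⟨‖p - q‖₊, ?_⟩, hD, ?_, by simp⟩ le_rfl
  · refine (LipschitzWith.of_dist_le_mul fun s t => ?_).lipschitzOnWith
    rw [dist_eq_norm, add_sub_add_left_eq_sub, ← sub_smul, norm_smul, mul_comm, coe_nnnorm,
      dist_eq_norm]
  · exact ae_of_all _ fun t => by rw [(hderiv t).deriv]; exact hpq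

lemma hasFDerivAt_lorLength_sub {q r : Minkowski n} (h : lor (q - r) (q - r) < 0) :
    HasFDerivAt (fun p => lorLength (p - r))
      (-((lorLength (q - r))⁻¹ • lorForm (q - r))) q := by
  have h1 : HasFDerivAt (fun p : Minkowski n => -lor (p - r) (p - r))
      (-((2 : ℝ) • lorForm (q - r))) q := by
    have a : HasFDerivAt (fun p : Minkowski n => p - r) (ContinuousLinearMap.id ℝ _) q :=
      (hasFDerivAt_id q).sub_const r
    have b : HasFDerivAt (fun p : Minkowski n => -lor (p - r) (p - r)) _ q :=
      ((a.fst.mul a.fst).neg.add (a.snd.inner ℝ a.snd)).neg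
    refine b.congr_fderiv (ContinuousLinearMap.ext fun w => ?_)
    simp only [neg_apply, smul_apply, add_apply, lorForm_apply, lor,
      ContinuousLinearMap.comp_apply, ContinuousLinearMap.prod_apply, fderivInnerCLM_apply,
      ContinuousLinearMap.coe_fst', ContinuousLinearMap.coe_snd', ContinuousLinearMap.id_apply,
      smul_eq_mul, real_inner_comm w.2]
    ring
  refine (h1.sqrt (by linarith)).congr_fderiv (ContinuousLinearMap.ext fun w => ?_)
  simp only [neg_apply, smul_apply, lorLength, smul_eq_mul]
  ring

section Coordinates

variable {v : Minkowski n} (hv : IsUnitFutureTimelike v)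
  {φ : EuclideanSpace ℝ (Fin n) →ₗ[ℝ] Minkowski n} (hφ : IsOrthIsometry v φ)
  {D : Set (Minkowski n)} {u : EuclideanSpace ℝ (Fin n) → ℝ} (hu : IsNullConvex u)
  (hD : ∀ x s, φ x + s • v ∈ D ↔ u x < s)

/-- The foot point on `∂D` of the point of the level surface above `x`. -/
def footPoint (v : Minkowski n) (φ : EuclideanSpace ℝ (Fin n) →ₗ[ℝ] Minkowski n)
    (u : EuclideanSpace ℝ (Fin n) → ℝ) (ε : ℝ) (x : EuclideanSpace ℝ (Fin n)) : Minkowski n :=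
  φ (prox u ε x) + u (prox u ε x) • v

/-- The point above `x` of the level surface of the cosmological time. -/
def levelPoint (v : Minkowski n) (φ : EuclideanSpace ℝ (Fin n) →ₗ[ℝ] Minkowski n)
    (u : EuclideanSpace ℝ (Fin n) → ℝ) (ε : ℝ) (x : EuclideanSpace ℝ (Fin n)) : Minkowski n :=
  φ x + level u ε x • v

lemma levelPoint_sub_footPoint (ε : ℝ) (x : EuclideanSpace ℝ (Fin n)) :
    levelPoint v φ u ε x - footPoint v φ u ε x = φ (x - prox u ε x) + rho u ε x • v := by
  rw [levelPoint, footPoint, coord_sub, level, rho, add_sub_cancel_left]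

lemma norm_sub_prox_lt {ε : ℝ} (hε : 0 < ε) (x : EuclideanSpace ℝ (Fin n)) :
    ‖x - prox u ε x‖ < level u ε x - u (prox u ε x) := by
  have := norm_lt_hyp hε (x - prox u ε x)
  unfold level; linarith

include hv hφ

lemma lor_levelPoint_sub_footPoint (ε : ℝ) (x : EuclideanSpace ℝ (Fin n)) :
    lor (levelPoint v φ u ε x - footPoint v φ u ε x)
      (levelPoint v φ u ε x - footPoint v φ u ε x) = -ε ^ 2 := by
  rw [levelPoint_sub_footPoint, lor_coord_self hv hφ, rho, hyp_sq]; ring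

lemma lorLength_levelPoint_sub_footPoint {ε : ℝ} (hε : 0 < ε) (x : EuclideanSpace ℝ (Fin n)) :
    lorLength (levelPoint v φ u ε x - footPoint v φ u ε x) = ε := by
  rw [lorLength, lor_levelPoint_sub_footPoint hv hφ, neg_neg, Real.sqrt_sq hε.le]

/-- The unit normal of the level surface points from the foot point to the level surface. -/
lemma isUnitFutureTimelike_normal {ε : ℝ} (hε : 0 < ε) (x : EuclideanSpace ℝ (Fin n)) :
    IsUnitFutureTimelike (ε⁻¹ • (levelPoint v φ u ε x - footPoint v φ u ε x)) := by
  refine ⟨?_, ?_⟩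
  · rw [lor_smul_left, lor_smul_right, lor_levelPoint_sub_footPoint hv hφ]
    field_simp
  · have h : IsFutureTimelike (levelPoint v φ u ε x - footPoint v φ u ε x) := by
      rw [levelPoint_sub_footPoint, isFutureTimelike_coord hv hφ]
      exact norm_lt_hyp hε _
    exact mul_pos (inv_pos.2 hε) h.2

include hu hD

/-- The hyperplane through the foot point that is parallel to the tangent hyperplane of the level
surface supports `D`. -/
lemma lor_sub_footPoint_nonpos {ε : ℝ} (hε : 0 < ε) (x : EuclideanSpace ℝ (Fin n))
    {q : Minkowski n} (hq : q ∈ D) :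
    lor (q - footPoint v φ u ε x) (ε⁻¹ • (levelPoint v φ u ε x - footPoint v φ u ε x)) ≤ 0 := by
  obtain ⟨z, s, rfl⟩ := exists_coord hv hφ q
  rw [hD] at hq
  have h1 := hu.subgradient_prox hε x z
  rw [inner_slope, inv_mul_eq_div] at h1
  have h0 := rho_pos u hε x
  have h2 : inner ℝ (x - prox u ε x) (z - prox u ε x) / rho u ε x ≤ s - u (prox u ε x) := by
    linarith
  rw [div_le_iff₀ h0, real_inner_comm] at h2
  rw [lor_smul_right, levelPoint_sub_footPoint, footPoint, coord_sub, lor_coord hv hφ]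
  exact mul_nonpos_of_nonneg_of_nonpos (inv_nonneg.2 hε.le) (by linarith)

/-- The cosmological time is bounded above by an affine function for every foot point. -/
lemma cosmTime_le {ε : ℝ} (hε : 0 < ε) (x : EuclideanSpace ℝ (Fin n)) {p : Minkowski n}
    (hp : p ∈ D) : cosmTime D p ≤
      -lor (p - footPoint v φ u ε x) (ε⁻¹ • (levelPoint v φ u ε x - footPoint v φ u ε x)) :=
  ENNReal.toReal_le_of_le_ofReal
    (by linarith [lor_sub_footPoint_nonpos hv hφ hu hD hε x hp])
    (cosmologicalTime_le (isUnitFutureTimelike_normal hv hφ hε x)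
      (fun _ hq => lor_sub_footPoint_nonpos hv hφ hu hD hε x hq) p)

/-- The cosmological time is bounded below by the distance to any point of `∂D` in the past. -/
lemma le_cosmTime {x y : EuclideanSpace ℝ (Fin n)} {s : ℝ} (h : ‖x - y‖ < s - u y) :
    √((s - u y) ^ 2 - ‖x - y‖ ^ 2) ≤ cosmTime D (φ x + s • v) := by
  have hfin : cosmologicalTime D (φ x + s • v) ≠ ⊤ :=
    ne_top_of_le_ne_top ENNReal.ofReal_ne_top
      (cosmologicalTime_le (isUnitFutureTimelike_normal hv hφ one_pos x)
        (fun _ hq => lor_sub_footPoint_nonpos hv hφ hu hD one_pos x hq) _)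
  have key : ∀ᶠ a in 𝓝[>] u y,
      √((s - a) ^ 2 - ‖x - y‖ ^ 2) ≤ cosmTime D (φ x + s • v) := by
    filter_upwards [Ioo_mem_nhdsGT (show u y < s - ‖x - y‖ by linarith)] with a ha
    have h1 : φ x + s • v - (φ y + a • v) = φ (x - y) + (s - a) • v := coord_sub x y s a
    have h2 : ‖x - y‖ < s - a := by linarith [ha.2]
    have h3 : ENNReal.ofReal (lorLength (φ x + s • v - (φ y + a • v)))
        ≤ cosmologicalTime D (φ x + s • v) := by
      apply ofReal_lorLength_le
      · rw [h1, isFutureCausal_coord hv hφ]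
        exact ⟨h2.le, (norm_nonneg _).trans_lt h2⟩
      · intro t ht
        have e : φ y + a • v + t • (φ x + s • v - (φ y + a • v))
            = φ (y + t • (x - y)) + (a + t * (s - a)) • v := by
          rw [h1, map_add, map_smul]; module
        rw [e, hD]
        have h4 := hu.sub_le (y + t • (x - y)) y
        rw [add_sub_cancel_left, norm_smul, Real.norm_of_nonneg ht.1] at h4
        have h5 : t * ‖x - y‖ ≤ t * (s - a) := mul_le_mul_of_nonneg_left h2.le ht.1
        linarith [ha.1]
    rw [h1, lorLength_coord hv hφ] at h3
    exact (ENNReal.ofReal_le_iff_le_toReal hfin).1 h3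
  have hcont : Continuous fun a : ℝ => √((s - a) ^ 2 - ‖x - y‖ ^ 2) := by fun_prop
  exact le_of_tendsto (hcont.continuousAt.mono_left nhdsWithin_le_nhds) key

/-- The level surface of the cosmological time is the graph of the Lorentzian inf-convolution. -/
lemma mem_levelSurface_iff {ε : ℝ} (hε : 0 < ε) (x : EuclideanSpace ℝ (Fin n)) (s : ℝ) :
    φ x + s • v ∈ levelSurface D ε ↔ s = level u ε x := by
  set y := prox u ε x with hy
  have hr : rho u ε x = level u ε x - u y := by rw [level, rho, add_sub_cancel_left]
  have hr2 : rho u ε x ^ 2 = ε ^ 2 + ‖x - y‖ ^ 2 := hyp_sq _ _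
  have hr0 := rho_pos u hε x
  have hxy := norm_sub_prox_lt (u := u) hε x
  -- the affine upper bound along the vertical line through `x`
  have hup : u x < s → cosmTime D (φ x + s • v) ≤ ε + ε⁻¹ * rho u ε x * (s - level u ε x) := by
    intro hs
    have h1 := cosmTime_le hv hφ hu hD hε x ((hD x s).2 hs)
    rw [lor_smul_right, levelPoint_sub_footPoint, footPoint, coord_sub, lor_coord hv hφ,
      real_inner_self_eq_norm_sq, ← hy] at h1
    refine h1.trans_eq ?_
    field_simp
    have : s - u y = s - level u ε x + rho u ε x := by rw [hr]; ring
    rw [this]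
    linear_combination hr2
  have hlow : level u ε x ≤ s → √((s - u y) ^ 2 - ‖x - y‖ ^ 2) ≤ cosmTime D (φ x + s • v) :=
    fun hs => le_cosmTime hv hφ hu hD (by linarith)
  constructor
  · rintro ⟨hs, hτ⟩
    rw [hD] at hs
    rcases lt_trichotomy s (level u ε x) with h | h | h
    · have h1 := hup hs
      have h2 : ε⁻¹ * rho u ε x * (s - level u ε x) < 0 :=
        mul_neg_of_pos_of_neg (by positivity) (by linarith)
      linarith
    · exact h
    · have h1 := hlow h.le
      have h2 : ε < √((s - u y) ^ 2 - ‖x - y‖ ^ 2) := by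
        refine Real.lt_sqrt_of_sq_lt ?_
        have : rho u ε x < s - u y := by rw [hr]; linarith
        nlinarith
      linarith
  · rintro rfl
    have hs := hu.lt_level_self hε x
    refine ⟨(hD _ _).2 hs, le_antisymm ?_ ?_⟩
    · simpa using hup hs
    · have h1 := hlow le_rfl
      rwa [← hr, hr2, add_sub_cancel_right, Real.sqrt_sq hε.le] at h1

lemma levelFun_eq {ε : ℝ} (hε : 0 < ε) (x : EuclideanSpace ℝ (Fin n)) :
    levelFun D v φ ε x = level u ε x := by
  have : {s : ℝ | φ x + s • v ∈ levelSurface D ε} = {level u ε x} := by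
    ext s; exact mem_levelSurface_iff hv hφ hu hD hε x s
  rw [levelFun, this, csInf_singleton]

/-- The cosmological time is squeezed between the distance to the foot point and the corresponding
affine function, which touch at the point of the level surface. -/
lemma hasFDerivAt_cosmTime {ε : ℝ} (hε : 0 < ε) (x : EuclideanSpace ℝ (Fin n)) :
    HasFDerivAt (cosmTime D)
      (-lorForm (ε⁻¹ • (levelPoint v φ u ε x - footPoint v φ u ε x))) (levelPoint v φ u ε x) := by
  set r := footPoint v φ u ε x with hr
  set q := levelPoint v φ u ε x with hq
  have hqr : lor (q - r) (q - r) = -ε ^ 2 := lor_levelPoint_sub_footPoint hv hφ ε x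
  have hlen : lorLength (q - r) = ε := lorLength_levelPoint_sub_footPoint hv hφ hε x
  have hτ : cosmTime D q = ε := ((mem_levelSurface_iff hv hφ hu hD hε x _).2 rfl).2
  obtain ⟨e, he⟩ := exists_coordEquiv hv hφ
  have hopen : IsOpen {p : Minkowski n | u (e.symm p).1 < (e.symm p).2} :=
    isOpen_lt (hu.continuous.comp (by fun_prop)) (by fun_prop)
  have hopen2 : IsOpen {p : Minkowski n |
      ‖(e.symm p).1 - prox u ε x‖ < (e.symm p).2 - u (prox u ε x)} :=
    isOpen_lt (by fun_prop) (by fun_prop)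
  have hqe : e.symm q = (x, level u ε x) := by
    rw [hq, levelPoint, ← he, ContinuousLinearEquiv.symm_apply_apply]
  have hrep : ∀ p, p = φ (e.symm p).1 + (e.symm p).2 • v := fun p => by
    rw [← he]; simp
  have hlow : HasFDerivAt (fun p => lorLength (p - r)) (-lorForm (ε⁻¹ • (q - r))) q := by
    refine (hasFDerivAt_lorLength_sub (q := q) (r := r) (by rw [hqr]; nlinarith)).congr_fderiv
      (ContinuousLinearMap.ext fun w => ?_)
    simp only [hlen, neg_apply, smul_apply, lorForm_apply, lor_smul_right, smul_eq_mul]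
  have hup : HasFDerivAt (fun p => (-lorForm (ε⁻¹ • (q - r))) (p - r))
      (-lorForm (ε⁻¹ • (q - r))) q :=
    (-lorForm (ε⁻¹ • (q - r))).hasFDerivAt.comp q ((hasFDerivAt_id q).sub_const r)
  refine hasFDerivAt_of_squeeze hlow hup ?_ ?_ ?_ ?_
  · filter_upwards [hopen2.mem_nhds (by
      rw [mem_ofPred_eq, hqe]; exact norm_sub_prox_lt (u := u) hε x)] with p hp
    have h1 := le_cosmTime hv hφ hu hD hp
    rw [← hrep] at h1
    refine le_trans (le_of_eq ?_) h1
    conv_lhs => rw [hrep p, hr, footPoint, coord_sub, lorLength_coord hv hφ]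
  · filter_upwards [hopen.mem_nhds (by
      rw [mem_ofPred_eq, hqe]; exact hu.lt_level_self hε x)] with p hp
    have hpD : p ∈ D := by rw [hrep p, hD]; exact hp
    rw [neg_apply, lorForm_apply]
    exact cosmTime_le hv hφ hu hD hε x hpD
  · rw [hlen, hτ]
  · rw [neg_apply, lorForm_apply, lor_smul_right, hqr, hτ]
    field_simp

lemma unitNormal_levelPoint {ε : ℝ} (hε : 0 < ε) (x : EuclideanSpace ℝ (Fin n)) :
    unitNormal D (levelPoint v φ u ε x)
      = ε⁻¹ • (levelPoint v φ u ε x - footPoint v φ u ε x) := by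
  have h1 : lorGradient (cosmTime D) (levelPoint v φ u ε x)
      = -(ε⁻¹ • (levelPoint v φ u ε x - footPoint v φ u ε x)) := by
    refine eq_of_forall_lor_eq fun w => ?_
    rw [lor_lorGradient, (hasFDerivAt_cosmTime hv hφ hu hD hε x).fderiv, neg_apply,
      lorForm_apply, lor_neg_left, lor_comm]
  have h2 := (isUnitFutureTimelike_normal hv hφ (u := u) hε x).1
  have h3 : lorLength (-(ε⁻¹ • (levelPoint v φ u ε x - footPoint v φ u ε x))) = 1 := by
    rw [lorLength, lor_neg_left, lor_comm, lor_neg_left, h2]; simp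
  rw [unitNormal, h1, h3, inv_one, one_smul, neg_neg]

lemma levelIntensity_eq {ε : ℝ} (hε : 0 < ε) (x : EuclideanSpace ℝ (Fin n)) :
    levelIntensity D v φ ε x = rho u ε x := by
  have h := unitNormal_levelPoint hv hφ hu hD hε x
  rw [levelPoint] at h
  rw [levelIntensity, levelFun_eq hv hφ hu hD hε, h, ← levelPoint, lor_smul_left,
    levelPoint_sub_footPoint, lor_coord_time hv hφ]
  field_simp

/-- The intensity is the length of the longest past light ray in `∂D`. -/
lemma intensity_eq_rayLength : intensity D v φ = rayLength u := by
  funext x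
  refine Tendsto.limUnder_eq ((hu.tendsto_rho x).congr' ?_)
  filter_upwards [self_mem_nhdsWithin] with ε hε
  exact (levelIntensity_eq hv hφ hu hD hε x).symm

/-- No past light ray in `∂D` starts at a point of the initial singularity. -/
lemma rayLength_eq_zero_of_mem_singularity {x : EuclideanSpace ℝ (Fin n)}
    (hx : φ x + u x • v ∈ singularity D) : rayLength u x = 0 := by
  obtain ⟨-, p, hp, hpx, hτ⟩ := hx
  obtain ⟨x', s, rfl⟩ := exists_coord hv hφ p
  rw [coord_sub, isFutureTimelike_coord hv hφ] at hpx
  rw [coord_sub, lorLength_coord hv hφ] at hτ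
  set ε := √((s - u x) ^ 2 - ‖x' - x‖ ^ 2) with hεdef
  have hpos : 0 < (s - u x) ^ 2 - ‖x' - x‖ ^ 2 := by nlinarith [norm_nonneg (x' - x)]
  have hε : 0 < ε := Real.sqrt_pos.2 hpos
  have hε2 : ε ^ 2 = (s - u x) ^ 2 - ‖x' - x‖ ^ 2 := Real.sq_sqrt hpos.le
  have hs : hyp ε (x' - x) = s - u x := by
    rw [hyp, hε2, sub_add_cancel, Real.sqrt_sq ((norm_nonneg _).trans hpx.le)]
  -- `x` minimizes the inf-convolution at `x'`
  have hmin : ∀ z, s ≤ u z + hyp ε (x' - z) := by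
    intro z
    by_contra! h
    have h1 := norm_le_hyp ε (x' - z)
    have h2 := le_cosmTime hv hφ hu hD (x := x') (y := z) (s := s) (by linarith)
    have h3 : ε < √((s - u z) ^ 2 - ‖x' - z‖ ^ 2) := by
      refine Real.lt_sqrt_of_sq_lt ?_
      have h4 := hyp_sq ε (x' - z)
      have h5 := hyp_pos hε (x' - z)
      nlinarith
    linarith
  obtain ⟨z, hz, hzx⟩ := (hu.isGreatest_rayLength x).1
  by_contra hne
  have hL : 0 < ‖x - z‖ := hz ▸ lt_of_le_of_ne (hu.rayLength_nonneg x) (Ne.symm hne)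
  have hstrict : hyp ε (x' - z) < hyp ε (x' - x) + ‖x - z‖ := by
    have h1 := hyp_pos hε (x' - x)
    refine lt_of_pow_lt_pow_left₀ 2 (by positivity) ?_
    have h2 : ‖x' - x‖ < hyp ε (x' - x) := by rw [hs]; exact hpx
    have h3 := real_inner_le_norm (x' - x) (x - z)
    have h4 : ‖x' - x‖ * ‖x - z‖ < hyp ε (x' - x) * ‖x - z‖ := by gcongr
    have h5 := norm_add_sq_real (x' - x) (x - z)
    rw [sub_add_sub_cancel] at h5
    have h6 := hyp_sq ε (x' - x)
    rw [hyp_sq, h5, add_sq]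
    linarith
  have := hmin z
  rw [← hz] at hzx
  linarith

end Coordinates

end CosmologicalTime

end FlatSpacetime

end

theorem mainTheorem2 (n : ℕ)
    (D : Set (FlatSpacetime.Minkowski n)) (hD : FlatSpacetime.IsDomainOfDependence D)
    (v : FlatSpacetime.Minkowski n) (hv : FlatSpacetime.IsUnitFutureTimelike v)
    (φ : EuclideanSpace ℝ (Fin n) →ₗ[ℝ] FlatSpacetime.Minkowski n)
    (hφ : FlatSpacetime.IsOrthIsometry v φ)
    (Ds : ℕ → Set (FlatSpacetime.Minkowski n))
    (hDs : ∀ k, FlatSpacetime.IsDomainOfDependence (Ds k))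
    (hflat : ∀ k, FlatSpacetime.HasFlatBoundary (Ds k) v φ)
    (hconv : FlatSpacetime.ConvergesTo Ds D) :
    ∃ ιlim : EuclideanSpace ℝ (Fin n) → ℝ,
      FlatSpacetime.WeaklyConvergesL1loc
        (fun k => FlatSpacetime.intensity (Ds k) v φ) ιlim ∧
      ∀ᵐ x, ιlim x ≤ FlatSpacetime.intensity D v φ x ∧
        FlatSpacetime.intensity D v φ x ≤ n * ιlim x := by
  open FlatSpacetime in
  obtain ⟨hu, hmem⟩ := domain_eq_epigraph hv hφ hD
  have hU := fun k => (domain_eq_epigraph hv hφ (hDs k)).1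
  have hlim := tendsto_boundaryFun hv hφ hD hDs hconv
  have hint : intensity D v φ = rayLength (boundaryFun D v φ) :=
    intensity_eq_rayLength hv hφ hu hmem
  have hintk : ∀ k, intensity (Ds k) v φ = rayLength (boundaryFun (Ds k) v φ) := fun k =>
    intensity_eq_rayLength hv hφ (hU k) (domain_eq_epigraph hv hφ (hDs k)).2
  -- the flatness of the boundaries enters here
  have hmeas : ∀ k, flowMeasure volume (boundaryFun (Ds k) v φ)
      = rayMeasure volume (boundaryFun (Ds k) v φ) := by
    intro k
    obtain ⟨ν, hν, hdiv, hsing⟩ := hflat k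
    refine (hU k).flowMeasure_eq_rayMeasure volume ν hdiv ?_
    have h0 : ∀ᵐ x ∂ν, φ x + boundaryFun (Ds k) v φ x • v ∈ singularity (Ds k) := hsing
    filter_upwards [h0] with x hx
    exact rayLength_eq_zero_of_mem_singularity hv hφ (hU k)
      (domain_eq_epigraph hv hφ (hDs k)).2 hx
  have hbounds := flowDensity_bounds volume hu
  rw [finrank_euclideanSpace_fin] at hbounds
  have habs : ∀ᵐ x, |flowDensity volume (boundaryFun D v φ) x|
      ≤ rayLength (boundaryFun D v φ) x := by
    filter_upwards [hbounds] with x hx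
    rw [abs_of_nonneg (flowDensity_nonneg _ _ _)]
    exact hx.1
  refine ⟨flowDensity volume (boundaryFun D v φ), ⟨fun k => ?_,
    locallyIntegrable_of_le_rayLength volume hu (measurable_flowDensity _ _) habs,
    fun f hf hfc ⟨C, hC⟩ => ?_⟩, by rwa [hint]⟩
  · simp only [hintk]
    exact locallyIntegrable_of_le_rayLength volume (hU k) (hU k).measurable_rayLength
      (ae_of_all _ fun x => (abs_of_nonneg ((hU k).rayLength_nonneg x)).le)
  · simp only [hintk]
    refine tendsto_integral_mul_of_continuous volume (fun k => (hU k).measurable_rayLength)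
      (measurable_flowDensity _ _) (fun R => ?_) (fun R => ?_) (fun g hg hgc => ?_) hf hfc hC
    · obtain ⟨M, hM⟩ := eventually_rayLength_le hu hU hlim R
      refine ⟨M, hM.mono fun k hk => ae_of_all _ fun x hx => ?_⟩
      rw [abs_of_nonneg ((hU k).rayLength_nonneg x)]
      exact hk x hx
    · obtain ⟨M, -, hM⟩ := hu.exists_rayLength_le R
      exact ⟨M, habs.mono fun x hx hxR => hx.trans (hM x hxR)⟩
    · have h := tendsto_integral_flowMeasure volume hu hU hlim hg hgc
      simpa only [hmeas, integral_rayMeasure volume (hU _), integral_flowMeasure volume hu]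
        using h
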